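/- Let $\Lambda$ be a lattice in a $g$-dimensional real vector space $V$, let $V^\vee=\mathrm{Hom}_{\mathbb R}(V,\mathbb R)$, $\Lambda^\vee=\mathrm{Hom}_{\mathbb Z}(\Lambda,\mathbb Z)=\{\mu\in V^\vee:\mu(\Lambda)\subset\mathbb Z\}$, $T=V/\Lambda$, $\hat T=V^\vee/\Lambda^\vee$, and let $p\colon T\times\hat T\to T$ be the projection. Let $\mathcal P$ be the Poincaré bundle on $T\times\hat T$, i.e. the $U(1)$ line bundle with factor of automorphy $$a_{\mathcal P}(x,y,\lambda,\mu)=e^{i\pi\mu(\lambda)}\,e^{i\pi(y(\lambda)-\mu(x))},\qquad (x,y)\in V\times V^\vee,\ (\lambda,\mu)\in\Lambda\times\Lambda^\vee .$$ After the change of gauge by $\phi(x,y)=e^{-i\pi y(x)}$ its factor of automorphy becomes $e^{-2\pi i\mu(x)}$, and in this gauge $\mathcal P$ carries the connection $\nabla_{\mathcal P}=d+2\pi i\sum_j y_j\,dx^j$, where $x^j$ are linear coordinates on $V$ and $y_j$ the dual coordinates on $V^\vee$. Let $\mathcal P^\vee$ be the dual bundle with the dual connection $d-2\pi i\sum_j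 y_j\,dx^j$, and let $\hat\nabla_2$ be the $\hat T$-component of that connection. Thus the smooth sections of $\mathcal P^\vee$ over an open $W\subset T\times\hat T$ are the smooth functions $s$ on the inverse image of $W$ in $V\times V^\vee$ with $s(x+\lambda,y+\mu)=e^{2\pi i\mu(x)}s(x,y)$ for all $(\lambda,\mu)\in\Lambda\times\Lambda^\vee$, and $\ker\hat\nabla_2$ is the sheaf of $\mathbb C$-vector spaces on $T\times\hat T$ formed by those $s$ whose derivatives in the $y$-directions vanish. Then: 1. $R^jp_\ast\ker\hat\nabla_2=0$ for $j=0,\dots,g-1$; 2. $R^gp_\ast\ker\hat\nabla_2\simeq\mathbb C(0)$, the one-dimensional skyscraper sheaf at $0\in T$; 3. $H^j(T\times\hat T,\ker\hat\nabla_2)=0$ for $j=0,\dots,g-1$, and $H^g(T\times\hat T,\ker\hat\nabla_2)\simeq\mathbb C$. -/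

import Mathlib

open CategoryTheory TopologicalSpace Opposite
open scoped ContDiff Topology

noncomputable section

namespace PoincareTorus

variable {V : Type} [NormedAddCommGroup V] [NormedSpace ℝ V]

/-! ### The torus, the dual torus and their product -/

/-- The dual lattice `Λ^∨ = Hom(Λ, ℤ)`, realised inside `V^∨` as the functionals that are
integral on `Λ`. -/
def dualLattice (Λ : Submodule ℤ V) : Submodule ℤ (StrongDual ℝ V) where
  carrier := {m | ∀ l ∈ Λ, ∃ n : ℤ, m l = n}
  add_mem' := by
    intro a b ha hb l hl
    obtain ⟨n, hn⟩ := ha l hl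
    obtain ⟨k, hk⟩ := hb l hl
    exact ⟨n + k, by simp [hn, hk]⟩
  zero_mem' := fun l _ => ⟨0, by simp⟩
  smul_mem' := by
    intro c a ha l hl
    obtain ⟨n, hn⟩ := ha l hl
    exact ⟨c * n, by simp [hn]⟩

/-- The torus `T = V / Λ`. -/
abbrev Torus (Λ : Submodule ℤ V) : TopCat.{0} := TopCat.of (V ⧸ Λ)

/-- The dual torus `T̂ = V^∨ / Λ^∨`. -/
abbrev DualTorus (Λ : Submodule ℤ V) : TopCat.{0} := TopCat.of (StrongDual ℝ V ⧸ dualLattice Λ)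

/-- The product `T × T̂`. -/
abbrev TorusProd (Λ : Submodule ℤ V) : TopCat.{0} :=
  TopCat.of ((V ⧸ Λ) × (StrongDual ℝ V ⧸ dualLattice Λ))

/-- The first projection `p : T × T̂ → T`. -/
def proj (Λ : Submodule ℤ V) : TorusProd Λ ⟶ Torus Λ :=
  TopCat.ofHom ⟨Prod.fst, continuous_fst⟩

/-- The universal covering `V × V^∨ → T × T̂`. -/
def cover (Λ : Submodule ℤ V) (v : V × StrongDual ℝ V) : TorusProd Λ :=
  (Submodule.Quotient.mk v.1, Submodule.Quotient.mk v.2)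

theorem continuous_cover (Λ : Submodule ℤ V) : Continuous (cover Λ) :=
  ((continuous_quot_mk : Continuous (Quot.mk _ : V → V ⧸ Λ)).comp continuous_fst).prodMk
    ((continuous_quot_mk :
      Continuous (Quot.mk _ : StrongDual ℝ V → StrongDual ℝ V ⧸ dualLattice Λ)).comp
        continuous_snd)

/-- The inverse image in `V × V^∨` of an open subset of `T × T̂`. -/
def coverOpen (Λ : Submodule ℤ V) (W : Opens (TorusProd Λ)) : Opens (V × StrongDual ℝ V) :=
  ⟨cover Λ ⁻¹' W, W.isOpen.preimage (continuous_cover Λ)⟩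

theorem coverOpen_mono (Λ : Submodule ℤ V) {W W' : Opens (TorusProd Λ)} (h : W ≤ W') :
    coverOpen Λ W ≤ coverOpen Λ W' := fun _ hv => h hv

/-! ### The Poincaré bundle and its connection -/

/-- The alternating form `A((x, y), (x', y')) = y(x') - y'(x)` of the Poincaré bundle. -/
def altForm (v w : V × StrongDual ℝ V) : ℝ := v.2 w.1 - w.2 v.1

/-- The semicharacter `χ(λ, μ) = exp(iπ μ(λ))` of the Poincaré bundle. -/
def semichar (l : V × StrongDual ℝ V) : ℂ := Complex.exp (Real.pi * Complex.I * (l.2 l.1 : ℝ))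

/-- The factor of automorphy `χ(l) exp(iπ A(v, l))` of the Poincaré bundle attached to the pair
`(A, χ)`. -/
def poincareFactor (v l : V × StrongDual ℝ V) : ℂ :=
  semichar l * Complex.exp (Real.pi * Complex.I * (altForm v l : ℝ))

/-- The gauge transformation `φ(x, y) = exp(-iπ y(x))`. -/
def gauge (v : V × StrongDual ℝ V) : ℂ := Complex.exp (-(Real.pi * Complex.I * (v.2 v.1 : ℝ)))

/-- The factor of automorphy of the dual `P^∨` of the Poincaré bundle: the inverse of the factor
of automorphy `φ(v + l) a(v, l) φ(v)⁻¹` of the Poincaré bundle in the gauge `φ`. -/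
def dualFactor (v l : V × StrongDual ℝ V) : ℂ :=
  (gauge (v + l) * poincareFactor v l * (gauge v)⁻¹)⁻¹

theorem dualFactor_eq (v l : V × StrongDual ℝ V) :
    dualFactor v l = Complex.exp (2 * Real.pi * Complex.I * (l.2 v.1 : ℝ)) := by
  simp only [dualFactor, gauge, poincareFactor, semichar, altForm]
  rw [← Complex.exp_neg, ← Complex.exp_add, ← Complex.exp_add, ← Complex.exp_add,
    ← Complex.exp_neg]
  congr 1
  simp only [Prod.fst_add, Prod.snd_add, map_add, add_apply]
  push_cast
  ring

/-- The connection of `P^∨`, in the gauge in which the factor of automorphy is `dualFactor`: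
`∇^∨ = d - 2πi ∑ y_j dx^j`, the dual of the connection `d + 2πi ∑ y_j dx^j` of the Poincaré
bundle. It is evaluated at the point `v` and on the tangent vector `w`. -/
def dualConnection (f : V × StrongDual ℝ V → ℂ) (v w : V × StrongDual ℝ V) : ℂ :=
  fderiv ℝ f v w - 2 * Real.pi * Complex.I * (v.2 w.1 : ℝ) * f v

/-- The `T̂`-component `∇̂₂` of the connection of `P^∨`. -/
def nablaHat2 (f : V × StrongDual ℝ V → ℂ) (v : V × StrongDual ℝ V) (e : StrongDual ℝ V) : ℂ :=
  dualConnection f v (0, e)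

/-- Extension by zero of a function on an open subset. All conditions below involve only its
values and germs at points of the open subset. -/
def extendZero {U : Opens (V × StrongDual ℝ V)} (s : U → ℂ) : V × StrongDual ℝ V → ℂ :=
  Function.extend Subtype.val s 0

theorem extendZero_apply {U : Opens (V × StrongDual ℝ V)} (s : U → ℂ) (v : U) :
    extendZero s v = s v :=
  Subtype.val_injective.extend_apply s 0 v

theorem extendZero_eventuallyEq {U : Opens (V × StrongDual ℝ V)} (s : U → ℂ)
    {U' : Opens (V × StrongDual ℝ V)} (t : U' → ℂ) (h : U' ≤ U)
    (hst : ∀ v : U', t v = s ⟨v, h v.2⟩) (v : U') :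
    extendZero t =ᶠ[𝓝 (v : V × StrongDual ℝ V)] extendZero s := by
  filter_upwards [U'.isOpen.mem_nhds v.2] with w hw
  exact (extendZero_apply t ⟨w, hw⟩).trans
    ((hst ⟨w, hw⟩).trans (extendZero_apply s ⟨w, h hw⟩).symm)

theorem extendZero_add {U : Opens (V × StrongDual ℝ V)} (s t : U → ℂ) :
    extendZero (s + t) = extendZero s + extendZero t := by
  simpa [extendZero] using Function.extend_add Subtype.val s t (0 : V × StrongDual ℝ V → ℂ) 0

theorem extendZero_smul {U : Opens (V × StrongDual ℝ V)} (c : ℂ) (s : U → ℂ) :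
    extendZero (c • s) = c • extendZero s := by
  simpa [extendZero] using Function.extend_smul c Subtype.val s (0 : V × StrongDual ℝ V → ℂ)

theorem extendZero_zero {U : Opens (V × StrongDual ℝ V)} :
    extendZero (0 : U → ℂ) = 0 := by
  simpa using extendZero_smul (0 : ℂ) (0 : U → ℂ)

/-- The space of smooth sections of `P^∨` over `W`: smooth complex functions on the inverse image
of `W` in `V × V^∨` that satisfy the automorphy condition. -/
def dualPoincareSections (Λ : Submodule ℤ V) (W : Opens (TorusProd Λ)) :
    Submodule ℂ (coverOpen Λ W → ℂ) where
  carrier := {s | (∀ v : coverOpen Λ W,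
      ContDiffAt ℝ ∞ (extendZero s) (v : V × StrongDual ℝ V)) ∧
    ∀ (v : coverOpen Λ W) (l : V × StrongDual ℝ V), l.1 ∈ Λ → l.2 ∈ dualLattice Λ →
      extendZero s (v + l) = dualFactor (v : V × StrongDual ℝ V) l * extendZero s v}
  add_mem' := by
    rintro s t ⟨hs, hs'⟩ ⟨ht, ht'⟩
    simp only [Set.mem_ofPred_eq, extendZero_add]
    refine ⟨fun v => (hs v).add (ht v), fun v l h1 h2 => ?_⟩
    simp only [Pi.add_apply, hs' v l h1 h2, ht' v l h1 h2, mul_add]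
  zero_mem' := by
    simp only [Set.mem_ofPred_eq, extendZero_zero]
    exact ⟨fun v => contDiffAt_const, fun v l _ _ => by simp⟩
  smul_mem' := by
    rintro c s ⟨hs, hs'⟩
    simp only [Set.mem_ofPred_eq, extendZero_smul]
    refine ⟨fun v => contDiffAt_const.smul (hs v), fun v l h1 h2 => ?_⟩
    simp only [Pi.smul_apply, hs' v l h1 h2, smul_eq_mul]
    ring

/-- The space of sections over `W` of `ker ∇̂₂`. -/
def kerSections (Λ : Submodule ℤ V) (W : Opens (TorusProd Λ)) :
    Submodule ℂ (coverOpen Λ W → ℂ) where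
  carrier := {s | s ∈ dualPoincareSections Λ W ∧
    ∀ (v : coverOpen Λ W) (e : StrongDual ℝ V), nablaHat2 (extendZero s) v e = 0}
  add_mem' := by
    rintro s t ⟨hs, hs'⟩ ⟨ht, ht'⟩
    refine ⟨add_mem hs ht, fun v e => ?_⟩
    have h1 := (hs.1 v).differentiableAt (by simp)
    have h2 := (ht.1 v).differentiableAt (by simp)
    have h3 := hs' v e
    have h4 := ht' v e
    simp only [nablaHat2, dualConnection, extendZero_add, fderiv_add h1 h2,
      add_apply, Pi.add_apply] at h3 h4 ⊢
    linear_combination h3 + h4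
  zero_mem' := by
    refine ⟨zero_mem _, fun v e => ?_⟩
    simp [nablaHat2, dualConnection, extendZero_zero]
  smul_mem' := by
    rintro c s ⟨hs, hs'⟩
    refine ⟨Submodule.smul_mem _ c hs, fun v e => ?_⟩
    have h1 := (hs.1 v).differentiableAt (by simp)
    have h3 := hs' v e
    simp only [nablaHat2, dualConnection, extendZero_smul, fderiv_const_smul h1,
      smul_apply, Pi.smul_apply, smul_eq_mul] at h3 ⊢
    linear_combination c * h3

theorem add_mem_coverOpen (Λ : Submodule ℤ V) (W : Opens (TorusProd Λ))
    {v l : V × StrongDual ℝ V} (hv : v ∈ coverOpen Λ W) (h1 : l.1 ∈ Λ)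
    (h2 : l.2 ∈ dualLattice Λ) : v + l ∈ coverOpen Λ W := by
  have : cover Λ (v + l) = cover Λ v := by
    refine Prod.ext ?_ ?_
    · exact (Submodule.Quotient.eq Λ).2 (by simpa using h1)
    · exact (Submodule.Quotient.eq (dualLattice Λ)).2 (by simpa using h2)
  change cover Λ (v + l) ∈ W
  rw [this]
  exact hv

/-- Membership in `kerSections` is local: a function that agrees, near every point, with a section
of `ker ∇̂₂` is a section. -/
theorem mem_kerSections_of_local (Λ : Submodule ℤ V) (W : Opens (TorusProd Λ))
    (s : coverOpen Λ W → ℂ)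
    (h : ∀ x ∈ W, ∃ (W' : Opens (TorusProd Λ)) (hW : W' ≤ W), x ∈ W' ∧
      ∃ t ∈ kerSections Λ W', ∀ v : coverOpen Λ W', t v = s ⟨v, coverOpen_mono Λ hW v.2⟩) :
    s ∈ kerSections Λ W := by
  refine ⟨⟨fun v => ?_, fun v l h1 h2 => ?_⟩, fun v e => ?_⟩ <;>
  obtain ⟨W', hW, hx, t, ht, hts⟩ := h (cover Λ v) v.2
  · exact (ht.1.1 ⟨v, hx⟩).congr_of_eventuallyEq
      (extendZero_eventuallyEq s t (coverOpen_mono Λ hW) hts ⟨v, hx⟩).symm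
  · have e1 := (extendZero_eventuallyEq s t (coverOpen_mono Λ hW) hts ⟨v, hx⟩).eq_of_nhds
    have e2 := (extendZero_eventuallyEq s t (coverOpen_mono Λ hW) hts
      ⟨v + l, add_mem_coverOpen Λ W' hx h1 h2⟩).eq_of_nhds
    rw [← e1, ← e2]
    exact ht.1.2 ⟨v, hx⟩ l h1 h2
  · have e1 := extendZero_eventuallyEq s t (coverOpen_mono Λ hW) hts ⟨v, hx⟩
    have e2 := ht.2 ⟨v, hx⟩ e
    simp only [nablaHat2, dualConnection] at e2 ⊢
    rw [← e1.fderiv_eq, ← e1.eq_of_nhds]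
    exact e2

theorem restrict_mem_kerSections (Λ : Submodule ℤ V) {W W' : Opens (TorusProd Λ)} (h : W' ≤ W)
    {s : coverOpen Λ W → ℂ} (hs : s ∈ kerSections Λ W) :
    (fun v : coverOpen Λ W' => s ⟨v, coverOpen_mono Λ h v.2⟩) ∈ kerSections Λ W' := by
  have key := extendZero_eventuallyEq s
    (fun v : coverOpen Λ W' => s ⟨v, coverOpen_mono Λ h v.2⟩) (coverOpen_mono Λ h) (fun _ => rfl)
  refine ⟨⟨fun v => ?_, fun v l h1 h2 => ?_⟩, fun v e => ?_⟩
  · exact (hs.1.1 ⟨v, coverOpen_mono Λ h v.2⟩).congr_of_eventuallyEq (key v)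
  · rw [(key v).eq_of_nhds, (key ⟨v + l, add_mem_coverOpen Λ W' v.2 h1 h2⟩).eq_of_nhds]
    exact hs.1.2 ⟨v, coverOpen_mono Λ h v.2⟩ l h1 h2
  · have e2 := hs.2 ⟨v, coverOpen_mono Λ h v.2⟩ e
    simp only [nablaHat2, dualConnection] at e2 ⊢
    rw [(key v).fderiv_eq, (key v).eq_of_nhds]
    exact e2

/-- Restriction of sections of `ker ∇̂₂`. -/
def kerRestrict (Λ : Submodule ℤ V) {W W' : Opens (TorusProd Λ)} (h : W' ≤ W) :
    kerSections Λ W →ₗ[ℂ] kerSections Λ W' where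
  toFun s := ⟨fun v => s.1 ⟨v, coverOpen_mono Λ h v.2⟩, restrict_mem_kerSections Λ h s.2⟩
  map_add' _ _ := rfl
  map_smul' _ _ := rfl

/-- The presheaf `ker ∇̂₂` of complex vector spaces on `T × T̂`. -/
def kerPresheaf (Λ : Submodule ℤ V) : TopCat.Presheaf (ModuleCat.{0} ℂ) (TorusProd Λ) where
  obj W := ModuleCat.of ℂ (kerSections Λ W.unop)
  map f := ModuleCat.ofHom (kerRestrict Λ f.unop.le)
  map_id _ := rfl
  map_comp _ _ := rfl

theorem kerPresheaf_isSheaf (Λ : Submodule ℤ V) : (kerPresheaf Λ).IsSheaf := by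
  rw [TopCat.Presheaf.isSheaf_iff_isSheaf_comp (CategoryTheory.forget (ModuleCat.{0} ℂ))]
  apply TopCat.Presheaf.isSheaf_of_isSheafUniqueGluing_types
  intro ι U sf hsf
  have hc : ∀ v : coverOpen Λ (iSup U), ∃ i, cover Λ v ∈ U i := fun v => Opens.mem_iSup.1 v.2
  choose idx hidx using hc
  let sf' : ∀ i, kerSections Λ (U i) := sf
  have compat : ∀ (i j : ι) (v : V × StrongDual ℝ V) (hi : cover Λ v ∈ U i)
      (hj : cover Λ v ∈ U j), (sf' i).1 ⟨v, hi⟩ = (sf' j).1 ⟨v, hj⟩ := by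
    intro i j v hi hj
    have h := hsf i j
    have h' : kerRestrict Λ (inf_le_left : U i ⊓ U j ≤ U i) (sf' i) =
        kerRestrict Λ (inf_le_right : U i ⊓ U j ≤ U j) (sf' j) := h
    exact congrFun (congrArg Subtype.val h') ⟨v, ⟨hi, hj⟩⟩
  let s : coverOpen Λ (iSup U) → ℂ := fun v => (sf' (idx v)).1 ⟨v, hidx v⟩
  have hs : s ∈ kerSections Λ (iSup U) := by
    apply mem_kerSections_of_local
    intro x hx
    obtain ⟨i, hi⟩ := Opens.mem_iSup.1 hx
    exact ⟨U i, le_iSup U i, hi, (sf' i).1, (sf' i).2,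
      fun v => compat i _ v v.2 (hidx ⟨v, coverOpen_mono Λ (le_iSup U i) v.2⟩)⟩
  refine ⟨(⟨s, hs⟩ : kerSections Λ (iSup U)), ?_, ?_⟩
  · intro i
    refine Subtype.ext (funext fun v => ?_)
    exact compat _ i v (hidx ⟨v, coverOpen_mono Λ (le_iSup U i) v.2⟩) v.2
  · intro t ht
    refine Subtype.ext (funext fun v => ?_)
    have h1 : kerRestrict Λ (le_iSup U (idx v)) (t : kerSections Λ (iSup U)) = sf' (idx v) :=
      ht (idx v)
    exact congrFun (congrArg Subtype.val h1) ⟨v, hidx v⟩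

/-- The sheaf `ker ∇̂₂` of complex vector spaces on `T × T̂`. -/
def kerSheaf (Λ : Submodule ℤ V) : TopCat.Sheaf (ModuleCat.{0} ℂ) (TorusProd Λ) :=
  ⟨kerPresheaf Λ, kerPresheaf_isSheaf Λ⟩

/-! ### Higher direct images, cohomology and the skyscraper -/

instance pushforward_additive {X Y : TopCat.{0}} (f : X ⟶ Y) :
    (TopCat.Sheaf.pushforward (ModuleCat.{0} ℂ) f).Additive where

instance sections_additive (X : TopCat.{0}) :
    ((sheafSections (Opens.grothendieckTopology X) (ModuleCat.{0} ℂ)).obj (op ⊤)).Additive where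

/-- The higher direct image `R^j f_* F` of a sheaf of complex vector spaces. -/
def higherDirectImage {X Y : TopCat.{0}} (f : X ⟶ Y) (j : ℕ)
    (F : TopCat.Sheaf (ModuleCat.{0} ℂ) X) : TopCat.Sheaf (ModuleCat.{0} ℂ) Y :=
  ((TopCat.Sheaf.pushforward (ModuleCat.{0} ℂ) f).rightDerived j).obj F

/-- The cohomology `H^j(X, F)` of a sheaf of complex vector spaces: the right derived functors of
the functor of global sections. -/
def sheafCohomology (X : TopCat.{0}) (j : ℕ) (F : TopCat.Sheaf (ModuleCat.{0} ℂ) X) :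
    ModuleCat.{0} ℂ :=
  (Functor.rightDerived
    ((sheafSections (Opens.grothendieckTopology X) (ModuleCat.{0} ℂ)).obj (op ⊤)) j).obj F

open Classical in
/-- The one-dimensional skyscraper sheaf `ℂ(x)`. -/
def skyscraper (X : TopCat.{0}) (x : X) : TopCat.Sheaf (ModuleCat.{0} ℂ) X :=
  skyscraperSheaf x (ModuleCat.of ℂ ℂ)

end PoincareTorus

end

/-!
Choosing a basis of `Λ` makes `T × T̂` a product of `T` and `g` circles. A function with vanishing
`y`-derivatives is locally a function of `x`, and the automorphy condition says that it picks up
the factor `e j` given by the `j`-th coordinate character of `T` along the `j`-th circle. So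
`ker ∇̂₂` arises from the sheaf of smooth functions on `T` by twisting along one circle at a time.

Let `p` be the projection that forgets one circle, and let `N` be twisted along this circle by `e`.
On a fibre the cohomology is that of the complex `1 - e : N → N`. If `1 - e` is injective on `N`
with cokernel `M`, then `R⁰p_*` of the twist vanishes, `R¹p_*` is `M`, and derived functors of
`Q ∘ p_*` on the twist are those of `Q` on `M`, shifted by one. The acyclicity this needs comes
from cutting the circle open: a section of the twist is one on the cut-open circle whose boundary
values differ by the factor `e`, and this gives a two-term resolution of the twist.

For smooth functions of `x` along a stratum `A` that is invariant under translation in the `k`-th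
direction, `1 - e k` is injective because its zeros are nowhere dense on `A`, and since they are
simple zeros its cokernel consists of the functions smooth along `A ∩ {e k = 1}`. After `g` steps
the stratum is the point at which all the characters are trivial, and what remains is the skyscraper
in degree `g`.
-/

open CategoryTheory TopologicalSpace Opposite
open scoped ContDiff Topology

noncomputable section

namespace PoincareTorus

section Homological

open Limits

universe v₁ v₂ v₃ u₁ u₂ u₃

variable {C : Type u₁} [Category.{v₁} C] [Abelian C]
  {D : Type u₂} [Category.{v₂} D] [Abelian D]
  {E : Type u₃} [Category.{v₃} E] [Abelian E]

theorem shortExact_cokernel {A B : C} (f : A ⟶ B) [Mono f] :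
    (ShortComplex.mk f (cokernel.π f) (cokernel.condition f)).ShortExact :=
  { exact := ShortComplex.exact_cokernel f
    mono_f := inferInstanceAs (Mono f)
    epi_g := inferInstanceAs (Epi (cokernel.π f)) }

theorem shortExact_of_isColimit {A B Q : C} {f : A ⟶ B} [Mono f] {π : B ⟶ Q} {w : f ≫ π = 0}
    (h : IsColimit (CokernelCofork.ofπ π w)) : (ShortComplex.mk f π w).ShortExact :=
  { exact := ShortComplex.exact_of_g_is_cokernel _ h
    mono_f := inferInstanceAs (Mono f)
    epi_g := Cofork.IsColimit.epi h }

theorem shortExact_map_of_epi (P : C ⥤ D) [P.Additive] [PreservesFiniteLimits P]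
    {S : ShortComplex C} (hS : S.ShortExact) (h : Epi (P.map S.g)) : (S.map P).ShortExact :=
  have := hS.mono_f
  { exact := hS.exact.map_of_mono_of_preservesKernel P hS.mono_f inferInstance
    mono_f := inferInstanceAs (Mono (P.map S.f))
    epi_g := h }

theorem isIso_of_shortExact_of_isZero {S : ShortComplex C} (hS : S.ShortExact)
    (h : IsZero S.X₁) : IsIso S.g :=
  have : Mono S.g := (ShortComplex.exact_iff_mono _ (h.eq_of_src _ _)).1 hS.exact
  have := hS.epi_g
  isIso_of_mono_of_epi _

section Pushout

variable {X₁ X₂ X₃ X₄ : C} {t : X₁ ⟶ X₂} {l : X₁ ⟶ X₃} {r : X₂ ⟶ X₄} {b : X₃ ⟶ X₄}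

theorem shortExact_shortComplex_of_isPushout (h : IsPushout t l r b) [Mono l] :
    h.shortComplex.ShortExact where
  exact := h.exact_shortComplex
  mono_f :=
    have : Mono (biprod.lift t (-l) ≫ biprod.snd) := by rw [biprod.lift_snd]; infer_instance
    mono_of_mono (biprod.lift t (-l)) biprod.snd
  epi_g := h.epi_shortComplex_g

theorem isPushout_map_of_epi (P : C ⥤ D) [P.Additive] [PreservesFiniteLimits P]
    (h : IsPushout t l r b) [Mono l] (hP : Epi (P.map h.shortComplex.g)) :
    IsPushout (P.map t) (P.map l) (P.map r) (P.map b) := by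
  have sq : CommSq (P.map t) (P.map l) (P.map r) (P.map b) := h.toCommSq.map P
  have := preservesBinaryBiproducts_of_preservesBiproducts P
  have map_lift : P.map (biprod.lift t (-l)) ≫ (P.mapBiprod X₂ X₃).hom =
      biprod.lift (P.map t) (-P.map l) := by
    rw [biprod.map_lift_mapBiprod, P.map_neg]
  have map_desc : (P.mapBiprod X₂ X₃).hom ≫ biprod.desc (P.map r) (P.map b) =
      P.map (biprod.desc r b) := biprod.mapBiprod_hom_desc ..
  let e : h.shortComplex.map P ≅ sq.shortComplex :=
    ShortComplex.isoMk (Iso.refl _) (P.mapBiprod X₂ X₃) (Iso.refl _)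
      ((Category.id_comp _).trans map_lift.symm) (map_desc.trans (Category.comp_id _).symm)
  have hS := ShortComplex.shortExact_of_iso e
    (shortExact_map_of_epi P (shortExact_shortComplex_of_isPushout h) hP)
  exact ⟨sq, ⟨sq.isColimitEquivIsColimitCokernelCofork.symm hS.gIsCokernel⟩⟩

theorem exists_shortExact_of_isPushout (h : IsPushout t l r b) {M : C} {m : X₂ ⟶ M}
    {w : t ≫ m = 0} (hm : (ShortComplex.mk t m w).ShortExact) :
    ∃ (m' : X₄ ⟶ M) (w' : b ≫ m' = 0), (ShortComplex.mk b m' w').ShortExact := by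
  have : Mono t := hm.mono_f
  have : Mono b := MorphismProperty.of_isPushout (P := .monomorphisms C) h.flip ‹Mono t›
  have hc : t ≫ m = l ≫ (0 : X₃ ⟶ M) := by rw [w, comp_zero]
  have : Epi m := hm.epi_g
  have epi_desc : Epi (h.desc m 0 hc) := epi_of_epi_fac (h.inl_desc m 0 hc)
  have hr {A : C} (x : X₄ ⟶ A) (hx : b ≫ x = 0) : t ≫ r ≫ x = 0 := by
    rw [reassoc_of% h.w, hx, comp_zero]
  have desc_eq {A : C} (x : X₄ ⟶ A) (hx : b ≫ x = 0) :
      h.desc m 0 hc ≫ hm.exact.desc (r ≫ x) (hr x hx) = x :=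
    h.hom_ext (by rw [h.inl_desc_assoc]; exact hm.exact.g_desc _ _)
      (by rw [h.inr_desc_assoc, zero_comp, hx])
  exact ⟨h.desc m 0 hc, h.inr_desc _ _ _, shortExact_of_isColimit
    (CokernelCofork.IsColimit.ofπ _ _ (fun x hx => hm.exact.desc (r ≫ x) (hr x hx)) desc_eq
      (fun x hx y hy => by rw [← cancel_epi (h.desc m 0 hc), hy, desc_eq x hx]))⟩

theorem shortExact_comp_of_isPushout {N : C} {f : N ⟶ X₁} {w : f ≫ t = 0}
    (h : IsPushout t l r b) [Mono l] (hf : (ShortComplex.mk f t w).ShortExact) :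
    (ShortComplex.mk (f ≫ l) b (by rw [Category.assoc, ← h.w, reassoc_of% w, zero_comp])).ShortExact
      := by
  have : Mono f := hf.mono_f
  have : Epi t := hf.epi_g
  have : Epi b := MorphismProperty.of_isPushout (P := .epimorphisms C) h.flip ‹Epi t›
  have hl {A : C} (x : X₃ ⟶ A) (hx : (f ≫ l) ≫ x = 0) : f ≫ l ≫ x = 0 := by
    rw [← Category.assoc, hx]
  exact shortExact_of_isColimit (CokernelCofork.IsColimit.ofπ _ _
    (fun x hx => h.desc (hf.exact.desc (l ≫ x) (hl x hx)) x (hf.exact.g_desc _ _))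
    (fun x hx => h.inr_desc _ _ _)
    (fun x hx y hy => by rw [← cancel_epi b, hy, h.inr_desc]))

end Pushout

/-- The augmentation of an injective resolution, as a morphism to its term of degree `0`. -/
def resolutionι {Z : C} (J : InjectiveResolution Z) : Z ⟶ J.cocomplex.X 0 := J.ι.f 0

instance {Z : C} (J : InjectiveResolution Z) : Mono (resolutionι J) :=
  inferInstanceAs (Mono (J.ι.f 0))

theorem resolutionι_comp_d {Z : C} (J : InjectiveResolution Z) :
    resolutionι J ≫ J.cocomplex.d 0 1 = 0 := J.ι_f_zero_comp_complex_d

section Splice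

variable {S : ShortComplex C}

theorem comp_resolutionι_comp_d (J : InjectiveResolution S.X₃) :
    (S.g ≫ resolutionι J) ≫ J.cocomplex.d 0 1 = 0 := by
  rw [Category.assoc, resolutionι_comp_d, comp_zero]

/-- The complex `S.X₂ ⟶ J⁰ ⟶ J¹ ⟶ ⋯` obtained by splicing a short complex `S` with a resolution `J`
of its third term. -/
def spliceComplex (J : InjectiveResolution S.X₃) : CochainComplex C ℕ :=
  J.cocomplex.augment (S.g ≫ resolutionι J) (comp_resolutionι_comp_d J)

theorem comp_spliceComplex_d (J : InjectiveResolution S.X₃) :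
    S.f ≫ (spliceComplex J).d 0 1 = 0 := by
  change S.f ≫ S.g ≫ resolutionι J = 0
  rw [S.zero_assoc, zero_comp]

theorem spliceComplex_exactAt (hS : S.ShortExact) (J : InjectiveResolution S.X₃) (n : ℕ) :
    (spliceComplex J).ExactAt (n + 1) := by
  rw [HomologicalComplex.exactAt_iff' _ n (n + 1) (n + 2) (by simp) (by simp)]
  match n with
  | 0 =>
    let α : ShortComplex.mk (S.g ≫ resolutionι J) (J.cocomplex.d 0 1)
        (comp_resolutionι_comp_d J) ⟶ ShortComplex.mk _ _ (resolutionι_comp_d J) :=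
      { τ₁ := S.g, τ₂ := 𝟙 _, τ₃ := 𝟙 _, comm₁₂ := by exact (Category.comp_id _).symm }
    have : Epi α.τ₁ := hS.epi_g
    have : IsIso α.τ₂ := inferInstanceAs (IsIso (𝟙 _))
    have : Mono α.τ₃ := inferInstanceAs (Mono (𝟙 _))
    exact (ShortComplex.exact_iff_of_epi_of_isIso_of_mono α).2 J.exact₀
  | n + 1 => exact J.exact_succ n

theorem exact_comp_resolutionι (hS : S.ShortExact) (J : InjectiveResolution S.X₃) :
    (ShortComplex.mk S.f (S.g ≫ resolutionι J) (by simp)).Exact := by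
  let α : S ⟶ ShortComplex.mk S.f (S.g ≫ resolutionι J) (by simp) :=
    { τ₁ := 𝟙 _, τ₂ := 𝟙 _, τ₃ := resolutionι J }
  have : Epi α.τ₁ := inferInstanceAs (Epi (𝟙 _))
  have : IsIso α.τ₂ := inferInstanceAs (IsIso (𝟙 _))
  have : Mono α.τ₃ := inferInstanceAs (Mono (resolutionι J))
  exact (ShortComplex.exact_iff_of_epi_of_isIso_of_mono α).1 hS.exact

/-- The injective resolution of `S.X₁` obtained by splicing a short exact sequence `S` with
injective middle term and an injective resolution of its third term. -/
def spliceResolution (hS : S.ShortExact) [Injective S.X₂] (J : InjectiveResolution S.X₃) :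
    InjectiveResolution S.X₁ where
  cocomplex := spliceComplex J
  injective n := by
    cases n
    · exact inferInstanceAs (Injective S.X₂)
    · exact J.injective _
  ι := (CochainComplex.fromSingle₀Equiv _ _).symm ⟨S.f, comp_spliceComplex_d J⟩
  quasiIso := ⟨fun n => by
    cases n
    · rw [CochainComplex.quasiIsoAt₀_iff, ShortComplex.quasiIso_iff_of_zeros]
      · refine (ShortComplex.exact_and_mono_f_iff_of_iso ?_).2
          ⟨exact_comp_resolutionι hS J, hS.mono_f⟩
        exact ShortComplex.isoMk (Iso.refl _) (Iso.refl _) (Iso.refl _)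
          ((Category.id_comp _).trans (Eq.trans (CochainComplex.fromSingle₀Equiv_symm_apply_f_zero
            (C := spliceComplex J) S.f (comp_spliceComplex_d J)).symm (Category.comp_id _).symm))
          ((Category.id_comp _).trans (Category.comp_id _).symm)
      all_goals rfl
    · rw [quasiIsoAt_iff_exactAt]
      · exact spliceComplex_exactAt hS J _
      · apply CochainComplex.exactAt_succ_single_obj⟩

end Splice

section DimensionShift

variable [HasInjectiveResolutions C] (T : C ⥤ D) [T.Additive] {S : ShortComplex C}

/-- Dimension shifting: `Rⁿ⁺² T (S.X₁) ≅ Rⁿ⁺¹ T (S.X₃)` if `S` is short exact with injective middle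
term. -/
def rightDerivedSuccSuccIso (hS : S.ShortExact) [Injective S.X₂] (n : ℕ) :
    (T.rightDerived (n + 2)).obj S.X₁ ≅ (T.rightDerived (n + 1)).obj S.X₃ :=
  let J := injectiveResolution S.X₃
  (spliceResolution hS J).isoRightDerivedObj T (n + 2) ≪≫
    HomologicalComplex.homologyIsoSc' _ (n + 1) (n + 2) (n + 3) (by simp) (by simp) ≪≫
    (HomologicalComplex.homologyIsoSc' ((T.mapHomologicalComplex _).obj J.cocomplex)
      n (n + 1) (n + 2) (by simp) (by simp)).symm ≪≫
    (J.isoRightDerivedObj T (n + 1)).symm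

/-- If `K` is a kernel of `S.g`, then the cokernel of the induced morphism `S.X₁ ⟶ K` is the
homology of `S`. -/
def leftHomologyDataOfIsKernel {S : ShortComplex D} {K : D} (g : S.X₁ ⟶ K) {i : K ⟶ S.X₂}
    (w : i ≫ S.g = 0) (hi : IsLimit (KernelFork.ofι i w)) (hg : g ≫ i = S.f) :
    S.LeftHomologyData :=
  have hl : hi.lift (KernelFork.ofι S.f S.zero) = g :=
    Fork.IsLimit.hom_ext hi ((hi.fac _ WalkingParallelPair.zero).trans hg.symm)
  { K := K
    H := cokernel g
    i := i
    π := cokernel.π g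
    wi := w
    hi := hi
    wπ := by rw [hl, cokernel.condition]
    hπ := CokernelCofork.IsColimit.ofπ _ _
      (fun f hf => cokernel.desc _ f (by rw [← hl]; exact hf))
      (fun f hf => cokernel.π_desc _ _ _)
      (fun f hf m hm => by rw [← cancel_epi (cokernel.π _), hm, cokernel.π_desc]) }

/-- Dimension shifting in degree one: `R¹ T (S.X₁)` is the cokernel of `T S.g`. -/
def rightDerivedOneIso [PreservesFiniteLimits T] (hS : S.ShortExact) [Injective S.X₂] :
    (T.rightDerived 1).obj S.X₁ ≅ cokernel (T.map S.g) :=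
  let J := injectiveResolution S.X₃
  let S' : ShortComplex D := ShortComplex.mk (T.map (S.g ≫ resolutionι J))
    (T.map (J.cocomplex.d 0 1)) (by rw [← T.map_comp, comp_resolutionι_comp_d, T.map_zero])
  have w : T.map (resolutionι J) ≫ T.map (J.cocomplex.d 0 1) = 0 := by
    rw [← T.map_comp, resolutionι_comp_d, T.map_zero]
  let L : S'.LeftHomologyData := leftHomologyDataOfIsKernel (T.map S.g) w
    (KernelFork.mapIsLimit _ J.isLimitKernelFork T) (T.map_comp _ _).symm
  (spliceResolution hS J).isoRightDerivedObj T 1 ≪≫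
    HomologicalComplex.homologyIsoSc' _ 0 1 2 (by simp) (by simp) ≪≫ (by exact L.homologyIso)

instance rightDerived_additive (n : ℕ) : (T.rightDerived n).Additive where
  map_add {X Y f g} := by
    let I := injectiveResolution X
    let J := injectiveResolution Y
    rw [T.rightDerived_map_eq n f (InjectiveResolution.desc f J I) (by simp),
      T.rightDerived_map_eq n g (InjectiveResolution.desc g J I) (by simp),
      T.rightDerived_map_eq n (f + g)
        (InjectiveResolution.desc f J I + InjectiveResolution.desc g J I) (by simp)]
    simp only [Functor.map_add, Preadditive.comp_add, Preadditive.add_comp]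

/-- Isomorphic functors have isomorphic derived functors. -/
def rightDerivedMapIso {T T' : C ⥤ D} [T.Additive] [T'.Additive] (α : T ≅ T') (n : ℕ) :
    T.rightDerived n ≅ T'.rightDerived n where
  hom := NatTrans.rightDerived α.hom n
  inv := NatTrans.rightDerived α.inv n
  hom_inv_id := by
    rw [← NatTrans.rightDerived_comp, α.hom_inv_id, NatTrans.rightDerived_id]
  inv_hom_id := by
    rw [← NatTrans.rightDerived_comp, α.inv_hom_id, NatTrans.rightDerived_id]

end DimensionShift

section Composition

/-- An object is a quotient of an injective object. Such objects play the role of the objects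
adapted to the direct image along a projection with one-dimensional fibres. -/
def IsQuotientOfInjective (A : C) : Prop := ∃ (I : C) (f : I ⟶ A), Injective I ∧ Epi f

/-- The functor `P` sends short exact sequences that start with `A` to short exact sequences, at
least at their right ends; for left exact `P` this says that `R¹ P A = 0`. -/
def IsOneAcyclic (P : C ⥤ D) (A : C) : Prop :=
  ∀ ⦃B Q : C⦄ (i : A ⟶ B) (q : B ⟶ Q) (w : i ≫ q = 0),
    (ShortComplex.mk i q w).ShortExact → Epi (P.map q)

variable (P : C ⥤ D) [P.Additive] [PreservesFiniteLimits P]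

theorem rightDerived_comp_of_isOneAcyclic [EnoughInjectives C]
    [HasInjectiveResolutions D] (Q : D ⥤ E) [Q.Additive] [PreservesFiniteLimits Q]
    (hP : ∀ I : C, Injective I → Injective (P.obj I))
    (hG : ∀ A : C, IsQuotientOfInjective A → IsOneAcyclic P A) (n : ℕ) (A : C)
    (hA : IsOneAcyclic P A) :
    Nonempty (((P ⋙ Q).rightDerived n).obj A ≅ (Q.rightDerived n).obj (P.obj A)) := by
  let S := ShortComplex.mk (Injective.ι A) (cokernel.π _) (cokernel.condition _)
  have hS : S.ShortExact := shortExact_cokernel (Injective.ι A)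
  have hS' : (S.map P).ShortExact := shortExact_map_of_epi P hS (hA _ _ _ hS)
  have hI : Injective S.X₂ := inferInstanceAs (Injective (Injective.under A))
  have hPI : Injective (S.map P).X₂ := hP _ hI
  match n with
  | 0 => exact ⟨(P ⋙ Q).rightDerivedZeroIsoSelf.app A ≪≫ (Q.rightDerivedZeroIsoSelf.app _).symm⟩
  | 1 => exact ⟨rightDerivedOneIso (P ⋙ Q) hS ≪≫ (rightDerivedOneIso Q hS').symm⟩
  | n + 2 =>
    obtain ⟨e⟩ := rightDerived_comp_of_isOneAcyclic Q hP hG (n + 1) _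
      (hG _ ⟨S.X₂, S.g, hI, hS.epi_g⟩)
    exact ⟨rightDerivedSuccSuccIso (P ⋙ Q) hS n ≪≫ e ≪≫ (rightDerivedSuccSuccIso Q hS' n).symm⟩

variable {S : ShortComplex C} {M : D} {m : P.obj S.X₃ ⟶ M} {wm : P.map S.g ≫ m = 0}

theorem isZero_map_of_mono_map_g (hS : S.ShortExact) [Mono (P.map S.g)] : IsZero (P.obj S.X₁) := by
  have := hS.mono_f
  have hfg : P.map S.f ≫ P.map S.g = 0 := by rw [← P.map_comp, S.zero, P.map_zero]
  have hf : P.map S.f = 0 := by rw [← cancel_mono (P.map S.g), hfg, zero_comp]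
  exact (IsZero.iff_id_eq_zero _).2 (by rw [← cancel_mono (P.map S.f), hf, comp_zero, comp_zero])

theorem isZero_rightDerived_zero_comp [EnoughInjectives C] (Q : D ⥤ E) [Q.Additive]
    [PreservesFiniteLimits Q] (hS : S.ShortExact) [Mono (P.map S.g)] :
    IsZero (((P ⋙ Q).rightDerived 0).obj S.X₁) :=
  (Q.map_isZero (isZero_map_of_mono_map_g P hS)).of_iso
    ((P ⋙ Q).rightDerivedZeroIsoSelf.app S.X₁)

theorem exists_shortExact_injective [EnoughInjectives C] (hS : S.ShortExact)
    (hE : IsOneAcyclic P S.X₂)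
    (hM : (ShortComplex.mk (P.map S.g) m wm).ShortExact) :
    ∃ (I X : C) (i : S.X₁ ⟶ I) (q : I ⟶ X) (w : i ≫ q = 0) (m' : P.obj X ⟶ M)
      (w' : P.map q ≫ m' = 0), Injective I ∧ (ShortComplex.mk i q w).ShortExact ∧
        (ShortComplex.mk (P.map q) m' w').ShortExact := by
  have h := IsPushout.of_hasPushout S.g (Injective.ι S.X₂)
  have hPh := isPushout_map_of_epi P h
    (hE _ _ _ (shortExact_shortComplex_of_isPushout h))
  obtain ⟨m', w', hm'⟩ := exists_shortExact_of_isPushout hPh hM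
  exact ⟨_, _, _, _, _, m', w', inferInstance, shortExact_comp_of_isPushout h hS, hm'⟩

/-- The derived functors of `P` at `S.X₁` are concentrated in degree one, where the value is `M`, so
the Grothendieck spectral sequence of `P ⋙ Q` would degenerate to these isomorphisms. -/
theorem rightDerived_comp_succ [EnoughInjectives C] [HasInjectiveResolutions D] (Q : D ⥤ E)
    [Q.Additive] [PreservesFiniteLimits Q]
    (hP : ∀ I : C, Injective I → Injective (P.obj I))
    (hG : ∀ A : C, IsQuotientOfInjective A → IsOneAcyclic P A) (hS : S.ShortExact)
    (hE : IsOneAcyclic P S.X₂) (hM : (ShortComplex.mk (P.map S.g) m wm).ShortExact) (n : ℕ) :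
    Nonempty (((P ⋙ Q).rightDerived (n + 1)).obj S.X₁ ≅ (Q.rightDerived n).obj M) := by
  obtain ⟨I, X, i, q, w, m', w', hI, hX, hm'⟩ := exists_shortExact_injective P hS hE hM
  let S' := ShortComplex.mk i q w
  have hI' : Injective S'.X₂ := hI
  have hPI : Injective (P.obj I) := hP I hI
  have hsplit := hm'.splittingOfInjective
  match n with
  | 0 =>
    exact ⟨rightDerivedOneIso (S := S') (P ⋙ Q) hX ≪≫
      (cokernelIsCokernel (Q.map (P.map q))).coconePointUniqueUpToIso
        (hsplit.map Q).shortExact.gIsCokernel ≪≫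
      (Q.rightDerivedZeroIsoSelf.app M).symm⟩
  | n + 1 =>
    obtain ⟨e⟩ := rightDerived_comp_of_isOneAcyclic P Q hP hG (n + 1) X
      (hG X ⟨I, q, hI, hX.epi_g⟩)
    have : IsIso ((Q.rightDerived (n + 1)).map m') :=
      isIso_of_shortExact_of_isZero (hsplit.map (Q.rightDerived (n + 1))).shortExact
        (Q.isZero_rightDerived_obj_injective_succ n _)
    exact ⟨rightDerivedSuccSuccIso (S := S') (P ⋙ Q) hX n ≪≫ e ≪≫
      asIso ((Q.rightDerived (n + 1)).map m')⟩

end Composition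

end Homological

section Sections

open Limits

universe u

/-- Sheaves of `k`-modules on `X`. -/
abbrev Sh (k : Type u) [Ring k] (X : TopCat.{u}) := TopCat.Sheaf (ModuleCat.{u} k) X

variable {k : Type u} [Ring k] {X : TopCat.{u}}

/-- The module of sections of a sheaf over an open set. -/
abbrev Sec (F : Sh k X) (U : Opens X) : ModuleCat.{u} k := F.obj.obj (op U)

/-- Restriction of sections, as a linear map indexed by an inequality of open sets. -/
def res (F : Sh k X) {U V : Opens X} (h : V ≤ U) : Sec F U →ₗ[k] Sec F V :=
  (F.obj.map (homOfLE h).op).hom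

/-- The action of a morphism of sheaves on sections. -/
def secMap {F G : Sh k X} (φ : F ⟶ G) (U : Opens X) : Sec F U →ₗ[k] Sec G U :=
  (φ.hom.app (op U)).hom

theorem res_res (F : Sh k X) {U V W : Opens X} (h : V ≤ U) (h' : W ≤ V) (s : Sec F U) :
    res F h' (res F h s) = res F (h'.trans h) s :=
  (congrArg (fun f => f.hom s) (F.obj.map_comp (homOfLE h).op (homOfLE h').op)).symm

theorem res_self (F : Sh k X) {U : Opens X} (h : U ≤ U) (s : Sec F U) : res F h s = s :=
  congrArg (fun f => f.hom s) (F.obj.map_id (op U))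

theorem secMap_res {F G : Sh k X} (φ : F ⟶ G) {U V : Opens X} (h : V ≤ U) (s : Sec F U) :
    secMap φ V (res F h s) = res G h (secMap φ U s) :=
  congrArg (fun f => f.hom s) (φ.hom.naturality (homOfLE h).op)

theorem secMap_comp {F G H : Sh k X} (φ : F ⟶ G) (ψ : G ⟶ H) (U : Opens X) (s : Sec F U) :
    secMap (φ ≫ ψ) U s = secMap ψ U (secMap φ U s) := rfl

theorem hom_ext_sec {F G : Sh k X} {φ ψ : F ⟶ G} (h : ∀ U s, secMap φ U s = secMap ψ U s) :
    φ = ψ := by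
  apply ObjectProperty.hom_ext
  ext U s
  exact h U.unop s

theorem epi_iff_sec {F G : Sh k X} (φ : F ⟶ G) :
    Epi φ ↔ ∀ (U : Opens X) (t : Sec G U), ∀ x ∈ U,
      ∃ (V : Opens X) (h : V ≤ U), x ∈ V ∧ ∃ s : Sec F V, secMap φ V s = res G h t := by
  rw [← TopCat.Sheaf.isLocallySurjective_iff_epi, TopCat.Presheaf.isLocallySurjective_iff]
  constructor
  · intro h U t x hx
    obtain ⟨V, hV, ⟨s, hs⟩, hxV⟩ := h U t x hx
    exact ⟨V, hV, hxV, s, hs⟩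
  · intro h U t x hx
    obtain ⟨V, hV, hxV, s, hs⟩ := h U t x hx
    exact ⟨V, hV, ⟨s, hs⟩, hxV⟩

instance preservesFiniteLimits_forget_evaluation (U : Opens X) : PreservesFiniteLimits
    (TopCat.Sheaf.forget (ModuleCat.{u} k) X ⋙ (evaluation _ _).obj (op U)) :=
  have : PreservesFiniteLimits ((evaluation (Opens X)ᵒᵖ (ModuleCat.{u} k)).obj (op U)) :=
    inferInstance
  comp_preservesFiniteLimits _ _

theorem secMap_injective {F G : Sh k X} (φ : F ⟶ G) [Mono φ] (U : Opens X) :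
    Function.Injective (secMap φ U) :=
  (ModuleCat.mono_iff_injective _).1 (inferInstanceAs (Mono
    ((TopCat.Sheaf.forget (ModuleCat.{u} k) X ⋙ (evaluation _ _).obj (op U)).map φ)))

theorem mono_of_secMap_injective {F G : Sh k X} (φ : F ⟶ G)
    (h : ∀ U, Function.Injective (secMap φ U)) : Mono φ := by
  constructor
  intro H a b hab
  refine hom_ext_sec fun U s => h U ?_
  rw [← secMap_comp, ← secMap_comp, hab]

theorem exists_secMap_eq_of_exact {S : ShortComplex (Sh k X)} (hS : S.Exact) (hf : Mono S.f)
    {U : Opens X} (b : Sec S.X₂ U) (hb : secMap S.g U b = 0) : ∃ a, secMap S.f U a = b := by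
  let Γ := TopCat.Sheaf.forget (ModuleCat.{u} k) X ⋙ (evaluation _ _).obj (op U)
  have : Γ.Additive := ⟨by intros; rfl⟩
  exact (ShortComplex.moduleCat_exact_iff _).1
    (hS.map_of_mono_of_preservesKernel Γ hf inferInstance) b hb

theorem exact_of_sec (S : ShortComplex (Sh k X))
    (h : ∀ (U : Opens X) (b : Sec S.X₂ U), secMap S.g U b = 0 → ∀ x ∈ U,
      ∃ (V : Opens X) (hV : V ≤ U), x ∈ V ∧ ∃ a, secMap S.f V a = res S.X₂ hV b) : S.Exact := by
  rw [S.exact_iff_epi_toCycles, epi_iff_sec]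
  intro U t x hx
  obtain ⟨V, hV, hxV, a, ha⟩ := h U (secMap S.iCycles U t) (by
    rw [← secMap_comp, S.iCycles_g]; rfl) x hx
  refine ⟨V, hV, hxV, a, secMap_injective S.iCycles V ?_⟩
  rw [← secMap_comp, S.toCycles_i, ha, secMap_res]

theorem exists_glue (F : Sh k X) {U V : Opens X} (s : Sec F U) (t : Sec F V)
    (h : res F (inf_le_left : U ⊓ V ≤ U) s = res F inf_le_right t) :
    ∃ r : Sec F (U ⊔ V), res F le_sup_left r = s ∧ res F le_sup_right r = t := by
  obtain ⟨r, hr, -⟩ := F.existsUnique_gluing' (fun b : Bool => cond b U V) (U ⊔ V)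
    (fun b => homOfLE (by cases b; exacts [le_sup_right, le_sup_left]))
    (sup_le (le_iSup (fun b : Bool => cond b U V) true)
      (le_iSup (fun b : Bool => cond b U V) false))
    (fun | true => s | false => t) (by
      rintro (_ | _) (_ | _)
      · rfl
      · have := congrArg (res F (le_of_eq (inf_comm V U))) h
        rw [res_res, res_res] at this
        exact this.symm
      · exact h
      · rfl)
  exact ⟨r, hr true, hr false⟩

instance subsingleton_sec_bot (F : Sh k X) : Subsingleton (Sec F ⊥) :=
  ⟨fun s t => F.eq_of_locally_eq' (ι := PEmpty.{1}) PEmpty.elim ⊥ (fun i => i.elim) bot_le s t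
    (fun i => i.elim)⟩

instance preservesMonomorphisms_free : (ModuleCat.free k).PreservesMonomorphisms where
  preserves f _ := (ModuleCat.mono_iff_injective _).2
    (Finsupp.mapDomain_injective ((CategoryTheory.mono_iff_injective f).1 inferInstance))

theorem injective_underlying_presheaf (I : Sh k X) [hI : Injective I] :
    Injective (I.obj ⋙ forget (ModuleCat.{u} k)) := by
  have hI' : Injective I.obj :=
    (sheafificationAdjunction (Opens.grothendieckTopology X) (ModuleCat.{u} k)).map_injective I hI
  have : ((Functor.whiskeringRight (Opens X)ᵒᵖ _ _).obj
      (ModuleCat.free k)).PreservesMonomorphisms :=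
    ⟨fun f _ => (NatTrans.mono_iff_mono_app _).2 fun U =>
      inferInstanceAs (Mono ((ModuleCat.free k).map (f.app U)))⟩
  exact ((ModuleCat.adj k).whiskerRight (Opens X)ᵒᵖ).map_injective I.obj hI'

theorem exists_res_eq_of_injective (I : Sh k X) [Injective I] {U V : Opens X} (h : V ≤ U)
    (s : Sec I V) : ∃ t : Sec I U, res I h t = s := by
  have := injective_underlying_presheaf I
  obtain ⟨ψ, hψ⟩ := Injective.factors
    ((yonedaEquiv (F := I.obj ⋙ forget (ModuleCat.{u} k))).symm s) (yoneda.map (homOfLE h))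
  refine ⟨yonedaEquiv ψ, ?_⟩
  have hs := congrArg yonedaEquiv hψ
  rw [Equiv.apply_symm_apply, ← yonedaEquiv_naturality] at hs
  exact hs

theorem injective_pushforward {X Y : TopCat.{u}} (f : X ⟶ Y) (F : Sh k X) (hF : Injective F) :
    Injective ((TopCat.Sheaf.pushforward (ModuleCat.{u} k) f).obj F) :=
  have : PreservesFiniteLimits ((Opens.map f).op.lan : _ ⥤ (_ ⥤ ModuleCat.{u} k)) :=
    lan_preservesFiniteLimits_of_flat _ _
  have : PreservesFiniteLimits (TopCat.Sheaf.pullback (ModuleCat.{u} k) f) :=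
    Functor.sheafPullbackConstruction.preservesFiniteLimits (Opens.map f) (ModuleCat.{u} k)
      (Opens.grothendieckTopology Y) (Opens.grothendieckTopology X)
  (TopCat.Sheaf.pullbackPushforwardAdjunction (ModuleCat.{u} k) f).map_injective F hF

instance additive_pushforward {X Y : TopCat.{u}} (f : X ⟶ Y) :
    (TopCat.Sheaf.pushforward (ModuleCat.{u} k) f).Additive where

theorem epi_pushforward_of_iso {X Y : TopCat.{u}} (f : X ≅ Y) {F G : Sh k X} (φ : F ⟶ G)
    [Epi φ] : Epi ((TopCat.Sheaf.pushforward (ModuleCat.{u} k) f.hom).map φ) := by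
  rw [epi_iff_sec]
  intro U t y hy
  obtain ⟨W, hW, hxW, s, hs⟩ := (epi_iff_sec φ).1 inferInstance ((Opens.map f.hom).obj U) t
    (f.inv y) (show f.hom (f.inv y) ∈ U by simpa using hy)
  have hle : (Opens.map f.hom).obj ((Opens.map f.inv).obj W) ≤ W := fun x hx =>
    by simpa using (show f.inv (f.hom x) ∈ W from hx)
  have hW' : (Opens.map f.inv).obj W ≤ U := fun z hz =>
    by simpa using (show f.hom (f.inv z) ∈ U from hW hz)
  exact ⟨_, hW', hxW, res F hle s,
    (secMap_res φ hle s).trans ((congrArg _ hs).trans (res_res G hW hle t))⟩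

theorem rightDerived_pushforward_iso {X Y : TopCat.{u}} (f : X ≅ Y) {E : Type*} [Category E]
    [Abelian E] (Q : Sh k Y ⥤ E) [Q.Additive] [PreservesFiniteLimits Q] (n : ℕ) (F : Sh k X) :
    Nonempty (((TopCat.Sheaf.pushforward (ModuleCat.{u} k) f.hom ⋙ Q).rightDerived n).obj F ≅
      (Q.rightDerived n).obj ((TopCat.Sheaf.pushforward (ModuleCat.{u} k) f.hom).obj F)) :=
  have acyclic (A : Sh k X) :
      IsOneAcyclic (TopCat.Sheaf.pushforward (ModuleCat.{u} k) f.hom) A :=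
    fun _ _ _ q _ hS => have : Epi q := hS.epi_g; epi_pushforward_of_iso f q
  rightDerived_comp_of_isOneAcyclic _ Q (fun I hI => injective_pushforward _ I hI)
    (fun A _ => acyclic A) n F (acyclic F)

end Sections

section Lifting

universe u

variable {k : Type u} [Ring k] {X : TopCat.{u}}

/-- A section `c` of `C` lifts along `q` on a neighbourhood of `K`. -/
def LiftsNear {B C : Sh k X} (q : B ⟶ C) {W : Opens X} (c : Sec C W) (K : Set X) : Prop :=
  ∃ (W' : Opens X) (h : W' ≤ W), K ⊆ W' ∧ ∃ b : Sec B W', secMap q W' b = res C h c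

/-- Sections of `A` near `K₁ ∩ K₂` are differences of sections near `K₁` and near `K₂`: the
connecting map of the Mayer–Vietoris sequence of the germs of `A` along `K₁` and `K₂` vanishes. -/
def MayerVietoris (A : Sh k X) (K₁ K₂ : Set X) : Prop :=
  ∀ W : Opens X, K₁ ∩ K₂ ⊆ W → ∀ a : Sec A W, ∃ (W₁ W₂ : Opens X) (h : W₁ ⊓ W₂ ≤ W),
    K₁ ⊆ W₁ ∧ K₂ ⊆ W₂ ∧ ∃ (a₁ : Sec A W₁) (a₂ : Sec A W₂),
      res A inf_le_left a₁ - res A inf_le_right a₂ = res A h a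

theorem exists_lift_sup {B C : Sh k X} (q : B ⟶ C) {U₁ U₂ W : Opens X} {c : Sec C W}
    (h₁ : U₁ ≤ W) (h₂ : U₂ ≤ W) {b₁ : Sec B U₁} {b₂ : Sec B U₂}
    (hb₁ : secMap q U₁ b₁ = res C h₁ c) (hb₂ : secMap q U₂ b₂ = res C h₂ c)
    (h : res B (inf_le_left : U₁ ⊓ U₂ ≤ U₁) b₁ = res B inf_le_right b₂) :
    ∃ b : Sec B (U₁ ⊔ U₂), secMap q _ b = res C (sup_le h₁ h₂) c := by
  obtain ⟨b, hr₁, hr₂⟩ := exists_glue B b₁ b₂ h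
  refine ⟨b, C.eq_of_locally_eq₂ (homOfLE le_sup_left) (homOfLE le_sup_right) le_rfl _ _ ?_ ?_⟩
  · change res C _ _ = res C _ _
    rw [← secMap_res, hr₁, res_res, hb₁]
  · change res C _ _ = res C _ _
    rw [← secMap_res, hr₂, res_res, hb₂]

theorem secMap_sub_of_exact {S : ShortComplex (Sh k X)} {U : Opens X} (b : Sec S.X₂ U)
    (a : Sec S.X₁ U) : secMap S.g U (b - secMap S.f U a) = secMap S.g U b := by
  rw [map_sub, ← secMap_comp, S.zero, sub_eq_self]
  rfl

/-- Two local lifts differ by a section of the kernel, which Mayer–Vietoris splits; correcting the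
lifts by the two summands makes them agree. -/
theorem liftsNear_union {S : ShortComplex (Sh k X)} (hS : S.ShortExact) {K₁ K₂ : Set X}
    (hA : MayerVietoris S.X₁ K₁ K₂) {W : Opens X} {c : Sec S.X₃ W}
    (h₁ : LiftsNear S.g c K₁) (h₂ : LiftsNear S.g c K₂) : LiftsNear S.g c (K₁ ∪ K₂) := by
  obtain ⟨W₁, hW₁, hK₁, b₁, hb₁⟩ := h₁
  obtain ⟨W₂, hW₂, hK₂, b₂, hb₂⟩ := h₂
  obtain ⟨a, ha⟩ := exists_secMap_eq_of_exact hS.exact hS.mono_f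
    (res S.X₂ (inf_le_left : W₁ ⊓ W₂ ≤ W₁) b₁ - res S.X₂ (inf_le_right : W₁ ⊓ W₂ ≤ W₂) b₂) (by
      rw [map_sub, secMap_res, secMap_res, hb₁, hb₂, res_res, res_res, sub_self])
  obtain ⟨V₁, V₂, hV, hKV₁, hKV₂, a₁, a₂, haa⟩ := hA (W₁ ⊓ W₂)
    (fun x hx => ⟨hK₁ hx.1, hK₂ hx.2⟩) a
  let U₁ := W₁ ⊓ V₁
  let U₂ := W₂ ⊓ V₂
  let s : Sec S.X₂ U₁ := res S.X₂ inf_le_left b₁ - secMap S.f U₁ (res S.X₁ inf_le_right a₁)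
  let t : Sec S.X₂ U₂ := res S.X₂ inf_le_left b₂ - secMap S.f U₂ (res S.X₁ inf_le_right a₂)
  have hle : U₁ ⊓ U₂ ≤ V₁ ⊓ V₂ := inf_le_inf inf_le_right inf_le_right
  have hst : res S.X₂ (inf_le_left : U₁ ⊓ U₂ ≤ U₁) s = res S.X₂ inf_le_right t := by
    have e1 := congrArg (fun z => secMap S.f _ (res S.X₁ hle z)) haa
    have e2 := congrArg (res S.X₂ (hle.trans hV)) ha
    simp only [map_sub, res_res, secMap_res] at e1 e2
    simp only [s, t, map_sub, res_res, secMap_res]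
    rw [sub_eq_sub_iff_sub_eq_sub, ← e2, e1]
  have hs : secMap S.g U₁ s = res S.X₃ (inf_le_left.trans hW₁) c := by
    rw [secMap_sub_of_exact, secMap_res, hb₁, res_res]
  have ht : secMap S.g U₂ t = res S.X₃ (inf_le_left.trans hW₂) c := by
    rw [secMap_sub_of_exact, secMap_res, hb₂, res_res]
  exact ⟨U₁ ⊔ U₂, sup_le (inf_le_left.trans hW₁) (inf_le_left.trans hW₂),
    Set.union_subset_union (Set.subset_inter hK₁ hKV₁) (Set.subset_inter hK₂ hKV₂),
    exists_lift_sup S.g _ _ hs ht hst⟩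

theorem mayerVietoris_of_separatedNhds (A : Sh k X) {K₁ K₂ : Set X} (h : SeparatedNhds K₁ K₂) :
    MayerVietoris A K₁ K₂ := by
  intro W _ a
  obtain ⟨U, V, hU, hV, hKU, hKV, hd⟩ := h
  have hb : (⟨U, hU⟩ ⊓ ⟨V, hV⟩ : Opens X) = ⊥ := Opens.ext hd.inter_eq
  refine ⟨⟨U, hU⟩, ⟨V, hV⟩, by rw [hb]; exact bot_le, hKU, hKV, 0, 0, ?_⟩
  have : Subsingleton (Sec A (⟨U, hU⟩ ⊓ ⟨V, hV⟩ : Opens X)) := by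
    rw [hb]; infer_instance
  exact Subsingleton.elim _ _

theorem liftsNear_singleton {S : ShortComplex (Sh k X)} (hS : S.ShortExact) {W : Opens X}
    (c : Sec S.X₃ W) {x : X} (hx : x ∈ W) : LiftsNear S.g c {x} := by
  obtain ⟨V, hV, hxV, s, hs⟩ := (epi_iff_sec S.g).1 hS.epi_g W c x hx
  exact ⟨V, hV, by simpa using hxV, s, hs⟩

theorem liftsNear_finite [T2Space X] {S : ShortComplex (Sh k X)} (hS : S.ShortExact) {W : Opens X}
    (c : Sec S.X₃ W) {K : Set X} (hK : K.Finite) (hKW : K ⊆ W) : LiftsNear S.g c K := by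
  induction K, hK using Set.Finite.induction_on with
  | empty => exact ⟨⊥, bot_le, by simp, 0, Subsingleton.elim _ _⟩
  | @insert x K hx hK ih =>
    rw [Set.insert_subset_iff] at hKW
    rw [← Set.singleton_union]
    refine liftsNear_union hS ?_ (liftsNear_singleton hS c hKW.1) (ih hKW.2)
    refine mayerVietoris_of_separatedNhds _ (SeparatedNhds.of_isCompact_isCompact
      isCompact_singleton hK.isCompact ?_)
    simpa using hx

theorem exists_opens_inf_le_of_isCompact [T2Space X] {K₁ K₂ : Set X} (h₁ : IsCompact K₁)
    (h₂ : IsCompact K₂) {V : Opens X} (hV : K₁ ∩ K₂ ⊆ V) :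
    ∃ W₁ W₂ : Opens X, K₁ ⊆ W₁ ∧ K₂ ⊆ W₂ ∧ W₁ ⊓ W₂ ≤ V := by
  obtain ⟨O₁, O₂, hO₁, hO₂, hK₁, hK₂, hd⟩ := SeparatedNhds.of_isCompact_isCompact
    (h₁.diff V.isOpen) (h₂.diff V.isOpen)
    (Set.disjoint_left.2 fun x hx hx' => hx.2 (hV ⟨hx.1, hx'.1⟩))
  refine ⟨V ⊔ ⟨O₁, hO₁⟩, V ⊔ ⟨O₂, hO₂⟩, Set.sdiff_subset_iff.1 hK₁, Set.sdiff_subset_iff.1 hK₂, ?_⟩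
  rw [← sup_inf_left]
  exact sup_le le_rfl fun x hx => absurd hx.2 (Set.disjoint_left.1 hd hx.1)

/-- Lift a section near the finite set `K₁ ∩ K₂` to the injective sheaf, where it extends to all of
`X`; the extension serves as `a₁`, with `a₂ = 0`. -/
theorem mayerVietoris_of_injective [T2Space X] {S : ShortComplex (Sh k X)} (hS : S.ShortExact)
    (hI : Injective S.X₂) {K₁ K₂ : Set X} (h₁ : IsCompact K₁) (h₂ : IsCompact K₂)
    (hf : (K₁ ∩ K₂).Finite) : MayerVietoris S.X₃ K₁ K₂ := by
  intro W hW a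
  obtain ⟨V, hV, hKV, b, hb⟩ := liftsNear_finite hS a hf hW
  obtain ⟨t, ht⟩ := exists_res_eq_of_injective S.X₂ (le_top : V ≤ ⊤) b
  obtain ⟨W₁, W₂, hK₁, hK₂, hWV⟩ := exists_opens_inf_le_of_isCompact h₁ h₂ hKV
  refine ⟨W₁, W₂, hWV.trans hV, hK₁, hK₂, res S.X₃ le_top (secMap S.g ⊤ t), 0, ?_⟩
  rw [map_zero, sub_zero, res_res, ← res_res S.X₃ hV hWV, ← hb, ← ht, secMap_res, res_res]

end Lifting

section FiberwiseLifting

variable {k : Type} [Ring k] {Z : TopCat.{0}}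

/-- The circle `ℝ / ℤ`. -/
abbrev Circ := AddCircle (1 : ℝ)

/-- The product of a space and the circle. -/
abbrev prodCirc (Z : TopCat.{0}) : TopCat.{0} := TopCat.of (Z × Circ)

/-- The projection of `Z × ℝ / ℤ` to `Z`. -/
def prodFst (Z : TopCat.{0}) : prodCirc Z ⟶ Z := TopCat.ofHom ⟨Prod.fst, continuous_fst⟩

/-- The image of `{z} × [a, b]` in `Z × ℝ / ℤ`. -/
def seg (z : Z) (a b : ℝ) : Set (prodCirc Z) :=
  (fun y : ℝ => ((z, (y : Circ)) : Z × Circ)) '' Set.Icc a b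

/-- The Mayer–Vietoris property for consecutive segments in the fibres of `Z × ℝ / ℤ`, which lets
one propagate local lifts once around each circle. -/
def FiberMayerVietoris (A : Sh k (prodCirc Z)) : Prop :=
  ∀ (z : Z) (b c : ℝ), 0 ≤ b → b ≤ c → c ≤ 1 → MayerVietoris A (seg z 0 b) (seg z b c)

theorem continuous_mk_circ (z : Z) :
    Continuous (fun y : ℝ => ((z, (y : Circ)) : Z × Circ)) :=
  continuous_const.prodMk (AddCircle.continuous_mk' 1)

theorem isCompact_seg (z : Z) (a b : ℝ) : IsCompact (seg z a b) :=
  isCompact_Icc.image (continuous_mk_circ z)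

theorem circ_coe_eq_coe_iff {a b : ℝ} : (a : Circ) = b ↔ ∃ n : ℤ, b = a + n := by
  refine (QuotientAddGroup.eq (s := AddSubgroup.zmultiples (1 : ℝ))).trans ?_
  rw [AddSubgroup.mem_zmultiples_iff]
  refine exists_congr fun n => ?_
  rw [zsmul_eq_mul, mul_one]
  constructor <;> intro h <;> linarith

theorem finite_seg_inter_seg (z : Z) {b c : ℝ} (hc : c ≤ 1) :
    (seg z 0 b ∩ seg z b c).Finite := by
  refine ((Set.finite_singleton (z, ((0 : ℝ) : Circ))).insert (z, (b : Circ))).subset ?_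
  rintro _ ⟨⟨y, hy, rfl⟩, ⟨y', hy', h⟩⟩
  have h' : (y' : Circ) = y := congrArg Prod.snd h
  obtain ⟨n, hn⟩ := circ_coe_eq_coe_iff.1 h'
  have h1 : (-1 : ℝ) ≤ n := by linarith [hy.1, hy'.2]
  have h2 : (n : ℝ) ≤ 0 := by linarith [hy.2, hy'.1]
  have h1' : -1 ≤ n := by exact_mod_cast h1
  have h2' : n ≤ 0 := by exact_mod_cast h2
  obtain rfl | rfl : n = -1 ∨ n = 0 := by omega
  · right
    have : y = 0 := by push_cast at hn; linarith [hy.1, hy'.2]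
    simp [this]
  · left
    have : y = b := by push_cast at hn; linarith [hy.2, hy'.1]
    simp [this]

theorem fiberMayerVietoris_of_injective [T2Space Z] {S : ShortComplex (Sh k (prodCirc Z))}
    (hS : S.ShortExact) (hI : Injective S.X₂) : FiberMayerVietoris S.X₃ := fun z _ _ _ _ hc =>
  mayerVietoris_of_injective hS hI (isCompact_seg z _ _) (isCompact_seg z _ _)
    (finite_seg_inter_seg z hc)

theorem liftsNear_seg_zero_one {S : ShortComplex (Sh k (prodCirc Z))} (hS : S.ShortExact)
    (hA : FiberMayerVietoris S.X₁) {W : Opens (prodCirc Z)} (c : Sec S.X₃ W) (z : Z)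
    (hz : ∀ θ : Circ, (z, θ) ∈ W) : LiftsNear S.g c (seg z 0 1) := by
  choose V hV hxV s hs using fun y : ℝ => (epi_iff_sec S.g).1 hS.epi_g W c (z, (y : Circ)) (hz _)
  obtain ⟨t, ht0, htm, ⟨n, hn⟩, ht⟩ := exists_monotone_Icc_subset_open_cover_unitInterval
    (c := fun y : ℝ => {x : unitInterval | ((z, ((x : ℝ) : Circ)) : Z × Circ) ∈ V y})
    (fun y => (V y).isOpen.preimage ((continuous_mk_circ z).comp continuous_subtype_val))
    (fun x _ => Set.mem_iUnion.2 ⟨x, hxV x⟩)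
  have key : ∀ n, LiftsNear S.g c (seg z 0 (t n)) := by
    intro n
    induction n with
    | zero =>
      refine ⟨V 0, hV 0, ?_, s 0, hs 0⟩
      rw [ht0]
      rintro _ ⟨y, hy, rfl⟩
      obtain rfl : y = 0 := le_antisymm hy.2 hy.1
      exact hxV 0
    | succ n ih =>
      have h2 : LiftsNear S.g c (seg z (t n) (t (n + 1))) := by
        obtain ⟨y, hy⟩ := ht n
        refine ⟨V y, hV y, ?_, s y, hs y⟩
        rintro _ ⟨x, hx, rfl⟩
        exact hy (a := ⟨x, (t n).2.1.trans hx.1, hx.2.trans (t (n + 1)).2.2⟩) hx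
      have := liftsNear_union hS (hA z _ _ (t n).2.1 (htm (Nat.le_succ n)) (t (n + 1)).2.2) ih h2
      rwa [seg, seg, ← Set.image_union,
        Set.Icc_union_Icc_eq_Icc (t n).2.1 (htm (Nat.le_succ n))] at this
  have := key n
  rwa [hn n le_rfl] at this

theorem mem_seg_zero_one (z : Z) (θ : Circ) :
    ((z, θ) : Z × Circ) ∈ seg z 0 1 := by
  have h : θ ∈ ((↑) : ℝ → Circ) '' Set.Icc (0 : ℝ) (0 + 1) := by
    rw [AddCircle.coe_image_Icc_eq]; trivial
  rw [zero_add] at h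
  obtain ⟨y, hy, rfl⟩ := h
  exact ⟨y, hy, rfl⟩

theorem epi_pushforward_of_fiberMayerVietoris {S : ShortComplex (Sh k (prodCirc Z))}
    (hS : S.ShortExact) (hA : FiberMayerVietoris S.X₁) :
    Epi ((TopCat.Sheaf.pushforward (ModuleCat.{0} k) (prodFst Z)).map S.g) := by
  rw [epi_iff_sec]
  intro U c z hz
  obtain ⟨W, hW, hzW, b, hb⟩ := liftsNear_seg_zero_one hS hA
    (W := (Opens.map (prodFst Z)).obj U) c z (fun _ => hz)
  obtain ⟨u, v, hu, -, hzu, hvu, huv⟩ := generalized_tube_lemma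
    (isCompact_singleton (x := z)) (isCompact_univ (X := Circ)) W.isOpen (by
      rintro ⟨z', θ⟩ ⟨rfl, -⟩
      exact hzW (mem_seg_zero_one z' θ))
  let U' : Opens Z := ⟨u, hu⟩ ⊓ U
  have hU' : (Opens.map (prodFst Z)).obj U' ≤ W := fun x hx => huv ⟨hx.1, hvu trivial⟩
  refine ⟨U', inf_le_right, ⟨hzu rfl, hz⟩, res S.X₂ hU' b, ?_⟩
  change secMap S.g _ _ = res S.X₃ ((Opens.map (prodFst Z)).monotone inf_le_right) c
  exact (secMap_res _ _ _).trans ((congrArg _ hb).trans (res_res S.X₃ hW hU' c))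

end FiberwiseLifting

section FunctionSheaves

open Limits

universe u

variable {k : Type u} [Ring k] {X : TopCat.{u}} {Y Y' Y'' : Type u}
  {π : Y → X} {π' : Y' → X} {π'' : Y'' → X}

/-- A local condition on `k`-valued functions on a set `Y` over the space `X`: for each `x`, a
submodule of functions that only depends on the germs along the fibres near `x`, and such that the
condition at `x` implies the condition near `x`. All sheaves below are sheaves of functions on some
`Y` cut out by such conditions. -/
structure LocalCondition (k : Type u) [Ring k] {X : TopCat.{u}} {Y : Type u} (π : Y → X) where
  /-- the functions that satisfy the condition at a point -/
  germs : X → Submodule k (Y → k)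
  congr_germ : ∀ {x : X} {f f' : Y → k}, (∀ᶠ x' in 𝓝 x, ∀ y, π y = x' → f y = f' y) →
    f ∈ germs x → f' ∈ germs x
  eventually_mem : ∀ {x : X} {f : Y → k}, f ∈ germs x → ∀ᶠ x' in 𝓝 x, f ∈ germs x'

namespace LocalCondition

open Classical in
/-- Extension by zero of the restriction of a function to the part over `W`. -/
def cut (π : Y → X) (W : Opens X) : (Y → k) →ₗ[k] (Y → k) where
  toFun f y := if π y ∈ W then f y else 0
  map_add' f g := by ext y; by_cases h : π y ∈ W <;> simp [h]
  map_smul' c f := by ext y; by_cases h : π y ∈ W <;> simp [h]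

theorem cut_of_mem {W : Opens X} {y : Y} (h : π y ∈ W) (f : Y → k) : cut π W f y = f y := if_pos h

theorem cut_of_notMem {W : Opens X} {y : Y} (h : π y ∉ W) (f : Y → k) : cut π W f y = 0 := if_neg h

theorem cut_mem (P : LocalCondition k π) {W : Opens X} {x : X} (hx : x ∈ W) {f : Y → k}
    (hf : f ∈ P.germs x) :
    cut π W f ∈ P.germs x := by
  refine P.congr_germ ?_ hf
  filter_upwards [W.isOpen.mem_nhds hx] with x' hx' y hy
  rw [cut_of_mem (by rw [hy]; exact hx')]

/-- The functions over `W` that satisfy the condition, extended by zero. -/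
def sections (P : LocalCondition k π) (W : Opens X) : Submodule k (Y → k) where
  carrier := {f | (∀ y, π y ∉ W → f y = 0) ∧ ∀ x ∈ W, f ∈ P.germs x}
  add_mem' := fun ha hb => ⟨fun y hy => by simp [ha.1 y hy, hb.1 y hy],
    fun x hx => add_mem (ha.2 x hx) (hb.2 x hx)⟩
  zero_mem' := ⟨fun _ _ => rfl, fun _ _ => zero_mem _⟩
  smul_mem' := fun c _ ha => ⟨fun y hy => by simp [ha.1 y hy],
    fun x hx => Submodule.smul_mem _ c (ha.2 x hx)⟩

theorem cut_eq_self (P : LocalCondition k π) {W : Opens X} {f : Y → k} (hf : f ∈ P.sections W) :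
    cut π W f = f := by
  ext y
  by_cases h : π y ∈ W
  · exact cut_of_mem h f
  · rw [cut_of_notMem h, hf.1 y h]

theorem cut_mem_sections (P : LocalCondition k π) {W : Opens X} {f : Y → k}
    (hf : ∀ x ∈ W, f ∈ P.germs x) :
    cut π W f ∈ P.sections W :=
  ⟨fun _ hy => cut_of_notMem hy f, fun x hx => P.cut_mem hx (hf x hx)⟩

/-- Restriction of sections. -/
def restrict (P : LocalCondition k π) {W W' : Opens X} (h : W' ≤ W) :
    P.sections W →ₗ[k] P.sections W' :=
  ((cut π W').comp (P.sections W).subtype).codRestrict _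
    fun f => P.cut_mem_sections fun x hx => f.2.2 x (h hx)

/-- The presheaf of functions that satisfy a local condition. -/
def presheaf (P : LocalCondition k π) : TopCat.Presheaf (ModuleCat.{u} k) X where
  obj W := ModuleCat.of k (P.sections W.unop)
  map f := ModuleCat.ofHom (P.restrict f.unop.le)
  map_id W := by
    ext1
    refine LinearMap.ext fun f => Subtype.ext ?_
    exact P.cut_eq_self f.2
  map_comp {W W' W''} a b := by
    ext1
    refine LinearMap.ext fun f => Subtype.ext (funext fun y => ?_)
    change cut π W''.unop f.1 y = cut π W''.unop (cut π W'.unop f.1) y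
    by_cases h : π y ∈ W''.unop
    · rw [cut_of_mem h, cut_of_mem h, cut_of_mem (b.unop.le h)]
    · rw [cut_of_notMem h, cut_of_notMem h]

open Classical in
theorem exists_forall_eq_of_compatible {ι : Type*} {U : ι → Opens X} {f : ι → Y → k}
    (hf : ∀ i j y, π y ∈ U i → π y ∈ U j → f i y = f j y) :
    ∃ g : Y → k, (∀ y, π y ∉ iSup U → g y = 0) ∧ ∀ i y, π y ∈ U i → g y = f i y := by
  refine ⟨fun y => if h : ∃ i, π y ∈ U i then f h.choose y else 0,
    fun y hy => dif_neg fun h => hy (Opens.mem_iSup.2 h), fun i y hy => ?_⟩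
  have h : ∃ i, π y ∈ U i := ⟨i, hy⟩
  exact (dif_pos h).trans (hf _ _ y h.choose_spec hy)

theorem mem_sections_iSup (P : LocalCondition k π) {ι : Type*} {U : ι → Opens X} {f : ι → Y → k}
    (hf : ∀ i, f i ∈ P.sections (U i)) {g : Y → k} (hg₀ : ∀ y, π y ∉ iSup U → g y = 0)
    (hg : ∀ i y, π y ∈ U i → g y = f i y) : g ∈ P.sections (iSup U) := by
  refine ⟨hg₀, fun x hx => ?_⟩
  obtain ⟨i, hi⟩ := Opens.mem_iSup.1 hx
  refine P.congr_germ ?_ ((hf i).2 x hi)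
  filter_upwards [(U i).isOpen.mem_nhds hi] with x' hx' y hy
  rw [hg i y (by rw [hy]; exact hx')]

theorem presheaf_isSheaf (P : LocalCondition k π) : P.presheaf.IsSheaf := by
  rw [TopCat.Presheaf.isSheaf_iff_isSheaf_comp (CategoryTheory.forget (ModuleCat.{u} k))]
  apply TopCat.Presheaf.isSheaf_of_isSheafUniqueGluing_types
  intro ι U (sf : ∀ i, P.sections (U i)) hsf
  have compat : ∀ (i j : ι) (y : Y), π y ∈ U i → π y ∈ U j → (sf i).1 y = (sf j).1 y := by
    intro i j y hi hj
    have hij : π y ∈ U i ⊓ U j := ⟨hi, hj⟩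
    have : cut π (U i ⊓ U j) (sf i).1 y = cut π (U i ⊓ U j) (sf j).1 y :=
      congrFun (congrArg Subtype.val (hsf i j)) y
    rwa [cut_of_mem hij, cut_of_mem hij] at this
  obtain ⟨s, hs₀, hs⟩ := exists_forall_eq_of_compatible compat
  refine ⟨⟨s, P.mem_sections_iSup (fun i => (sf i).2) hs₀ hs⟩, fun i => ?_,
    fun (t : P.sections (iSup U)) ht => ?_⟩
  · refine Subtype.ext (funext fun y => ?_)
    change cut π (U i) s y = (sf i).1 y
    by_cases h : π y ∈ U i
    · rw [cut_of_mem h, hs i y h]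
    · rw [cut_of_notMem h, (sf i).2.1 y h]
  · refine Subtype.ext (funext fun y => ?_)
    change t.1 y = s y
    by_cases h : π y ∈ iSup U
    · obtain ⟨i, hi⟩ := Opens.mem_iSup.1 h
      rw [hs i y hi, ← show P.restrict (le_iSup U i) t = sf i from ht i]
      exact (cut_of_mem hi _).symm
    · rw [t.2.1 y h, hs₀ y h]

/-- The sheaf of functions that satisfy a local condition. -/
def sheaf (P : LocalCondition k π) : Sh k X := ⟨P.presheaf, P.presheaf_isSheaf⟩

/-- The section given by a function. -/
def sec (P : LocalCondition k π) (W : Opens X) (f : Y → k) (hf : ∀ x ∈ W, f ∈ P.germs x) :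
    Sec P.sheaf W :=
  (⟨cut π W f, P.cut_mem_sections hf⟩ : P.sections W)

/-- The function underlying a section. -/
def val (P : LocalCondition k π) {W : Opens X} (s : Sec P.sheaf W) : Y → k := (s : P.sections W).1

theorem val_mem (P : LocalCondition k π) {W : Opens X} (s : Sec P.sheaf W) {x : X} (hx : x ∈ W) :
    P.val s ∈ P.germs x := (s : P.sections W).2.2 x hx

theorem val_eq_zero (P : LocalCondition k π) {W : Opens X} (s : Sec P.sheaf W) {y : Y}
    (hy : π y ∉ W) :
    P.val s y = 0 := (s : P.sections W).2.1 y hy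

theorem sec_ext (P : LocalCondition k π) {W : Opens X} {s t : Sec P.sheaf W}
    (h : ∀ y, π y ∈ W → P.val s y = P.val t y) : s = t := by
  refine Subtype.ext (funext fun y => ?_)
  by_cases hy : π y ∈ W
  · exact h y hy
  · exact (P.val_eq_zero s hy).trans (P.val_eq_zero t hy).symm

theorem val_sec (P : LocalCondition k π) {W : Opens X} {f : Y → k} {hf : ∀ x ∈ W, f ∈ P.germs x}
    {y : Y} (hy : π y ∈ W) : P.val (P.sec W f hf) y = f y := cut_of_mem hy f

theorem val_res (P : LocalCondition k π) {W W' : Opens X} (h : W' ≤ W) (s : Sec P.sheaf W) {y : Y}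
    (hy : π y ∈ W') : P.val (res P.sheaf h s) y = P.val s y := cut_of_mem hy _

theorem val_sub (P : LocalCondition k π) {W : Opens X} (s t : Sec P.sheaf W) (y : Y) :
    P.val (s - t) y = P.val s y - P.val t y := rfl

/-- A linear map between spaces of functions over `X` that is local over `X`. -/
def IsFiberwise (π : Y → X) (π' : Y' → X) (Φ : (Y → k) →ₗ[k] (Y' → k)) : Prop :=
  ∀ (f : Y → k) (x : X), (∀ y, π y = x → f y = 0) → ∀ y', π' y' = x → Φ f y' = 0

theorem IsFiberwise.congr {Φ : (Y → k) →ₗ[k] (Y' → k)} (h : IsFiberwise π π' Φ) {f g : Y → k}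
    {x : X} (hfg : ∀ y, π y = x → f y = g y) {y' : Y'} (hy' : π' y' = x) : Φ f y' = Φ g y' := by
  have := h (f - g) x (fun y hy => by simp [hfg y hy]) y' hy'
  rw [map_sub] at this
  exact sub_eq_zero.1 this

theorem IsFiberwise.cut {Φ : (Y → k) →ₗ[k] (Y' → k)} (h : IsFiberwise π π' Φ) (W : Opens X)
    (f : Y → k) : Φ (cut π W f) = LocalCondition.cut π' W (Φ f) := by
  ext y'
  by_cases hy' : π' y' ∈ W
  · rw [cut_of_mem hy']
    exact h.congr (fun y hy => cut_of_mem (by rw [hy]; exact hy') f) rfl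
  · rw [cut_of_notMem hy']
    exact h _ _ (fun y hy => cut_of_notMem (by rw [hy]; exact hy') f) _ rfl

/-- The morphism of sheaves given by a fibrewise linear map. -/
def hom (P : LocalCondition k π) (P' : LocalCondition k π') (Φ : (Y → k) →ₗ[k] (Y' → k))
    (hΦ : IsFiberwise π π' Φ) (h : ∀ x f, f ∈ P.germs x → Φ f ∈ P'.germs x) : P.sheaf ⟶ P'.sheaf :=
  ⟨{ app W := ModuleCat.ofHom ((Φ.comp (P.sections W.unop).subtype).codRestrict
      (P'.sections W.unop) fun f => ⟨fun y' hy' => hΦ _ _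
        (fun y hy => f.2.1 y (by rw [hy]; exact hy')) y' rfl, fun x hx => h x _ (f.2.2 x hx)⟩)
     naturality W W' a := by
      ext f
      exact Subtype.ext (hΦ.cut _ _) }⟩

variable {P : LocalCondition k π} {P' : LocalCondition k π'} {P'' : LocalCondition k π''}
  {Φ : (Y → k) →ₗ[k] (Y' → k)} {hΦ : IsFiberwise π π' Φ}
  {h : ∀ x f, f ∈ P.germs x → Φ f ∈ P'.germs x}
  {Ψ : (Y' → k) →ₗ[k] (Y'' → k)} {hΨ : IsFiberwise π' π'' Ψ}
  {h' : ∀ x f, f ∈ P'.germs x → Ψ f ∈ P''.germs x}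

theorem val_secMap_hom {W : Opens X} (s : Sec P.sheaf W) :
    P'.val (secMap (hom P P' Φ hΦ h) W s) = Φ (P.val s) := rfl

theorem val_secMap_hom_sec {W : Opens X} {f : Y → k} {hf : ∀ x ∈ W, f ∈ P.germs x} {y' : Y'}
    (hy' : π' y' ∈ W) : P'.val (secMap (hom P P' Φ hΦ h) W (P.sec W f hf)) y' = Φ f y' :=
  (congrFun (hΦ.cut W f) y').trans (cut_of_mem hy' _)

theorem hom_comp_hom_eq_zero (hz : ∀ f, Ψ (Φ f) = 0) :
    hom P P' Φ hΦ h ≫ hom P' P'' Ψ hΨ h' = 0 :=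
  hom_ext_sec fun _ _ => Subtype.ext (hz _)

theorem exists_opens {p : X → Prop} {x : X} (hp : ∀ᶠ x' in 𝓝 x, p x') {U : Opens X} (hx : x ∈ U) :
    ∃ V : Opens X, V ≤ U ∧ x ∈ V ∧ ∀ x' ∈ V, p x' := by
  obtain ⟨t, ht, ht', hxt⟩ := eventually_nhds_iff.1 hp
  exact ⟨⟨t, ht'⟩ ⊓ U, inf_le_right, ⟨hxt, hx⟩, fun x' hx' => ht x' hx'.1⟩

theorem shortExact (hz : ∀ f, Ψ (Φ f) = 0)
    (hm : ∀ x f, f ∈ P.germs x → (∀ᶠ x' in 𝓝 x, ∀ y', π' y' = x' → Φ f y' = 0) →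
      ∀ y, π y = x → f y = 0)
    (he : ∀ x f, f ∈ P'.germs x → (∀ᶠ x' in 𝓝 x, ∀ y'', π'' y'' = x' → Ψ f y'' = 0) →
      ∃ g ∈ P.germs x, ∀ᶠ x' in 𝓝 x, ∀ y', π' y' = x' → Φ g y' = f y')
    (hs : ∀ x f, f ∈ P''.germs x →
      ∃ g ∈ P'.germs x, ∀ᶠ x' in 𝓝 x, ∀ y'', π'' y'' = x' → Ψ g y'' = f y'') :
    (ShortComplex.mk (hom P P' Φ hΦ h) (hom P' P'' Ψ hΨ h')
      (hom_comp_hom_eq_zero hz)).ShortExact where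
  mono_f := by
    refine mono_of_secMap_injective _ fun U => (injective_iff_map_eq_zero _).2 fun s hs => ?_
    refine P.sec_ext fun y hy => hm (π y) _ (P.val_mem s hy) ?_ y rfl
    refine Filter.Eventually.of_forall fun x' y' _ => ?_
    rw [← val_secMap_hom (P' := P') (hΦ := hΦ) (h := h), hs]
    rfl
  exact := by
    refine exact_of_sec _ fun U b hb x hx => ?_
    obtain ⟨g, hg, hgb⟩ := he x (P'.val b) (P'.val_mem b hx)
      (Filter.Eventually.of_forall fun x' y'' _ => congrFun (congrArg P''.val hb) y'')
    obtain ⟨V, hVU, hxV, hV⟩ := exists_opens ((P.eventually_mem hg).and hgb) hx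
    refine ⟨V, hVU, hxV, P.sec V g fun x' hx' => (hV x' hx').1, P'.sec_ext fun y' hy' => ?_⟩
    refine Eq.trans ?_ ((hV _ hy').2 y' rfl) |>.trans (P'.val_res hVU b hy').symm
    exact val_secMap_hom_sec (hΦ := hΦ) (h := h) hy'
  epi_g := by
    refine (epi_iff_sec _).2 fun U t x hx => ?_
    obtain ⟨g, hg, hgb⟩ := hs x (P''.val t) (P''.val_mem t hx)
    obtain ⟨V, hVU, hxV, hV⟩ := exists_opens ((P'.eventually_mem hg).and hgb) hx
    refine ⟨V, hVU, hxV, P'.sec V g fun x' hx' => (hV x' hx').1, P''.sec_ext fun y' hy' => ?_⟩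
    refine Eq.trans ?_ ((hV _ hy').2 y' rfl) |>.trans (P''.val_res hVU t hy').symm
    exact val_secMap_hom_sec (hΦ := hΨ) (h := h') hy'

theorem exists_opens_of_forall_mem (P : LocalCondition k π) {f : Y → k} {K : Set X}
    (hf : ∀ x ∈ K, f ∈ P.germs x) : ∃ D : Opens X, K ⊆ D ∧ ∀ x ∈ D, f ∈ P.germs x :=
  ⟨⟨{x | ∀ᶠ x' in 𝓝 x, f ∈ P.germs x'}, isOpen_setOfPred_eventually_nhds⟩,
    fun x hx => P.eventually_mem (hf x hx), fun _ hx => hx.self_of_nhds⟩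

theorem mayerVietoris [T2Space X] (P : LocalCondition k π) {K₁ K₂ : Set X} (h₁ : IsCompact K₁)
    (h₂ : IsCompact K₂)
    (H : ∀ a : Y → k, (∀ x ∈ K₁ ∩ K₂, a ∈ P.germs x) → ∃ a₁ a₂ : Y → k,
      (∀ x ∈ K₁, a₁ ∈ P.germs x) ∧ (∀ x ∈ K₂, a₂ ∈ P.germs x) ∧
      ∀ x ∈ K₁ ∩ K₂, ∀ᶠ x' in 𝓝 x, ∀ y, π y = x' → a₁ y - a₂ y = a y) :
    MayerVietoris P.sheaf K₁ K₂ := by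
  intro W hW a
  obtain ⟨a₁, a₂, ha₁, ha₂, haa⟩ := H (P.val a) fun x hx => P.val_mem a (hW hx)
  obtain ⟨D₁, hKD₁, hD₁⟩ := P.exists_opens_of_forall_mem ha₁
  obtain ⟨D₂, hKD₂, hD₂⟩ := P.exists_opens_of_forall_mem ha₂
  let V : Opens X := ⟨{x | ∀ᶠ x' in 𝓝 x, ∀ y, π y = x' → a₁ y - a₂ y = P.val a y},
    isOpen_setOfPred_eventually_nhds⟩
  obtain ⟨W₁, W₂, hKW₁, hKW₂, hWV⟩ := exists_opens_inf_le_of_isCompact (V := V ⊓ W) h₁ h₂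
    fun x hx => ⟨haa x hx, hW hx⟩
  have hle : (W₁ ⊓ D₁) ⊓ (W₂ ⊓ D₂) ≤ V ⊓ W := (inf_le_inf inf_le_left inf_le_left).trans hWV
  refine ⟨W₁ ⊓ D₁, W₂ ⊓ D₂, hle.trans inf_le_right, Set.subset_inter hKW₁ hKD₁,
    Set.subset_inter hKW₂ hKD₂, P.sec _ a₁ fun x hx => hD₁ x hx.2,
    P.sec _ a₂ fun x hx => hD₂ x hx.2, P.sec_ext fun y hy => ?_⟩
  rw [P.val_sub, P.val_res _ _ hy, P.val_res _ _ hy, P.val_res _ _ hy, P.val_sec hy.1,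
    P.val_sec hy.2]
  exact (hle hy).1.self_of_nhds y rfl

end LocalCondition

end FunctionSheaves

section Twist

variable {k : Type} [Field k] {Z : TopCat.{0}}

/-- Local conditions on the functions on `Z` themselves. -/
abbrev FunctionCondition (k : Type) [Ring k] (Z : TopCat.{0}) := LocalCondition k (id : Z → Z)

/-- The covering `Z × ℝ → Z × ℝ / ℤ`. -/
def covCirc (Z : TopCat.{0}) (p : Z × ℝ) : prodCirc Z := (p.1, (p.2 : Circ))

theorem continuous_covCirc : Continuous (covCirc Z) :=
  continuous_fst.prodMk ((AddCircle.continuous_mk' 1).comp continuous_snd)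

theorem isOpenMap_covCirc : IsOpenMap (covCirc Z) :=
  IsOpenMap.id.prodMap (QuotientAddGroup.isOpenMap_coe (N := AddSubgroup.zmultiples (1 : ℝ)))

theorem eventually_covCirc {p : Z × ℝ} {R : prodCirc Z → Prop} :
    (∀ᶠ q in 𝓝 (covCirc Z p), R q) ↔ ∀ᶠ p' in 𝓝 p, R (covCirc Z p') :=
  ⟨fun h => (continuous_covCirc.tendsto p).eventually h,
    fun h => isOpenMap_covCirc.nhds_le p h⟩

theorem covCirc_surjective : Function.Surjective (covCirc Z) := by
  rintro ⟨z, θ⟩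
  obtain ⟨y, rfl⟩ := QuotientAddGroup.mk_surjective θ
  exact ⟨(z, y), rfl⟩

/-- Near `p = (z, y)`, the function `e ^ ⌊y⌋ * f` on `Z × ℝ` is pulled back from a function on `Z`
satisfying `N`. Thus `f`, a section over the circle of the local system with monodromy `e`, is
described by its values on the fundamental domain `0 ≤ y < 1`. -/
def TwistAt (N : FunctionCondition k Z) (e : Z → k) (f : prodCirc Z → k) (p : Z × ℝ) : Prop :=
  ∃ h ∈ N.germs p.1, ∀ᶠ p' in 𝓝 p, e p'.1 ^ ⌊p'.2⌋ * f (covCirc Z p') = h p'.1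

theorem LocalCondition.congr_of_eventuallyEq (N : FunctionCondition k Z) {z : Z} {f g : Z → k}
    (h : ∀ᶠ z' in 𝓝 z, f z' = g z') (hf : f ∈ N.germs z) : g ∈ N.germs z :=
  N.congr_germ (h.mono fun _ h' _ hy => by subst hy; exact h') hf

/-- The function `e` has no zeros, and multiplication by `e` and by `e⁻¹` preserves `N`: it can
serve as the monodromy of a twist of `N` along a circle. -/
structure IsMultiplier (N : FunctionCondition k Z) (e : Z → k) : Prop where
  ne_zero : ∀ z, e z ≠ 0
  mul_mem : ∀ {z f}, f ∈ N.germs z → (fun z => e z * f z) ∈ N.germs z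
  inv_mul_mem : ∀ {z f}, f ∈ N.germs z → (fun z => (e z)⁻¹ * f z) ∈ N.germs z

theorem IsMultiplier.zpow_mul_mem {N : FunctionCondition k Z} {e : Z → k} (he : IsMultiplier N e)
    (n : ℤ) {z : Z} {f : Z → k} (hf : f ∈ N.germs z) : (fun z => e z ^ n * f z) ∈ N.germs z := by
  induction n with
  | zero => simpa using hf
  | succ n ih =>
    convert he.mul_mem ih using 2 with w
    rw [zpow_add_one₀ (he.ne_zero w)]
    ring
  | pred n ih =>
    convert he.inv_mul_mem ih using 2 with w
    rw [zpow_sub_one₀ (he.ne_zero w)]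
    ring

theorem covCirc_add_int (p : Z × ℝ) (n : ℤ) : covCirc Z (p.1, p.2 + n) = covCirc Z p := by
  refine Prod.ext rfl ?_
  exact (circ_coe_eq_coe_iff.2 ⟨n, rfl⟩).symm

theorem twistAt_add_int {N : FunctionCondition k Z} {e : Z → k} (he : IsMultiplier N e)
    {f : prodCirc Z → k} {p : Z × ℝ} (hf : TwistAt N e f p) (n : ℤ) :
    TwistAt N e f (p.1, p.2 + n) := by
  obtain ⟨h, hh, hf⟩ := hf
  refine ⟨fun z => e z ^ n * h z, he.zpow_mul_mem n hh, ?_⟩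
  have hc : Continuous fun p : Z × ℝ => ((p.1, p.2 + (-n : ℤ)) : Z × ℝ) := by fun_prop
  have ht := hc.tendsto ((p.1, p.2 + n) : Z × ℝ)
  rw [show ((p.1, p.2 + n + (-n : ℤ)) : Z × ℝ) = p by simp] at ht
  filter_upwards [ht.eventually hf] with p' hp'
  rw [covCirc_add_int, Int.floor_add_intCast] at hp'
  rw [← hp', ← mul_assoc, ← zpow_add₀ (he.ne_zero _)]
  congr 2
  ring

theorem twistAt_of_covCirc_eq {N : FunctionCondition k Z} {e : Z → k} (he : IsMultiplier N e)
    {f : prodCirc Z → k} {p p' : Z × ℝ} (hf : TwistAt N e f p) (h : covCirc Z p = covCirc Z p') :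
    TwistAt N e f p' := by
  obtain ⟨z, y⟩ := p
  obtain ⟨z', y'⟩ := p'
  obtain rfl : z = z' := congrArg Prod.fst h
  obtain ⟨n, rfl⟩ := circ_coe_eq_coe_iff.1 (congrArg Prod.snd h)
  exact twistAt_add_int he hf n

theorem eventually_twistAt {N : FunctionCondition k Z} {e : Z → k} {f : prodCirc Z → k}
    {p : Z × ℝ} (hf : TwistAt N e f p) : ∀ᶠ p' in 𝓝 p, TwistAt N e f p' := by
  obtain ⟨h, hh, hf⟩ := hf
  filter_upwards [hf.eventually_nhds, (continuous_fst.tendsto p).eventually (N.eventually_mem hh)]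
    with p' h1 h2
  exact ⟨h, h2, h1⟩

/-- The local condition on `Z × ℝ / ℤ` obtained from `N` by twisting with the multiplier `e`. -/
def twist (N : FunctionCondition k Z) {e : Z → k} (he : IsMultiplier N e) :
    FunctionCondition k (prodCirc Z) where
  germs q :=
    { carrier := {f | ∀ p, covCirc Z p = q → TwistAt N e f p}
      add_mem' := by
        intro f g hf hg p hp
        obtain ⟨h, hh, hf⟩ := hf p hp
        obtain ⟨h', hh', hg⟩ := hg p hp
        refine ⟨h + h', add_mem hh hh', ?_⟩
        filter_upwards [hf, hg] with p' h1 h2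
        simp [mul_add, h1, h2]
      zero_mem' := fun p _ => ⟨0, zero_mem _, by simp⟩
      smul_mem' := by
        intro c f hf p hp
        obtain ⟨h, hh, hf⟩ := hf p hp
        refine ⟨c • h, Submodule.smul_mem _ c hh, ?_⟩
        filter_upwards [hf] with p' h1
        simp only [Pi.smul_apply, smul_eq_mul, ← h1]
        ring }
  congr_germ := by
    rintro q f f' hff hf p rfl
    obtain ⟨h, hh, hf⟩ := hf p rfl
    refine ⟨h, hh, ?_⟩
    filter_upwards [hf, eventually_covCirc.1 hff] with p' h1 h2
    rw [← h1, show f (covCirc Z p') = f' (covCirc Z p') from h2 _ rfl]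
  eventually_mem := by
    intro q f hf
    obtain ⟨p, rfl⟩ := covCirc_surjective q
    rw [eventually_covCirc]
    filter_upwards [eventually_twistAt (hf p rfl)] with p' h' p'' hp
    exact twistAt_of_covCirc_eq he h' hp.symm

theorem mem_twist {N : FunctionCondition k Z} {e : Z → k} (he : IsMultiplier N e)
    {f : prodCirc Z → k} {p : Z × ℝ} :
    f ∈ (twist N he).germs (covCirc Z p) ↔ TwistAt N e f p :=
  ⟨fun h => h p rfl, fun h _ hp => twistAt_of_covCirc_eq he h hp.symm⟩

theorem exists_mem_twist {N : FunctionCondition k Z} {e : Z → k} (he : IsMultiplier N e)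
    {h : Z → k} {p : Z × ℝ} (hh : h ∈ N.germs p.1) : ∃ f ∈ (twist N he).germs (covCirc Z p),
      ∀ᶠ p' in 𝓝 p, e p'.1 ^ ⌊p'.2⌋ * f (covCirc Z p') = h p'.1 := by
  let ρ : Circ → ℝ := fun θ => AddCircle.equivIco 1 (p.2 - 1 / 2) θ
  let f : prodCirc Z → k := fun q => (e q.1 ^ ⌊ρ q.2⌋)⁻¹ * h q.1
  have hf : ∀ᶠ p' in 𝓝 p, e p'.1 ^ ⌊p'.2⌋ * f (covCirc Z p') = h p'.1 := by
    have : ∀ᶠ y in 𝓝 p.2, y ∈ Set.Ico (p.2 - 1 / 2) (p.2 - 1 / 2 + 1) :=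
      Ico_mem_nhds (by linarith) (by linarith)
    filter_upwards [(continuous_snd.tendsto p).eventually this] with p' hp'
    have h1 : ρ (p'.2 : Circ) = p'.2 := by
      simp only [ρ]
      rw [AddCircle.equivIco_coe_eq hp']
    simp only [f, covCirc, h1]
    rw [mul_inv_cancel_left₀ (zpow_ne_zero _ (he.ne_zero _))]
  exact ⟨f, (mem_twist he).2 ⟨h, hh, hf⟩, hf⟩

/-- The sequence of sheaves `0 → N → N → M → 0` given by multiplication by `a` and by `σ` is short
exact, expressed on germs. In the application `a = 1 - e` for a multiplier `e`, and `σ` is the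
characteristic function of the zero set of `a`. -/
structure IsMulShortExact (N M : FunctionCondition k Z) (a σ : Z → k) : Prop where
  mul_mem : ∀ {z f}, f ∈ N.germs z → (fun z => a z * f z) ∈ N.germs z
  quot_mem : ∀ {z f}, f ∈ N.germs z → (fun z => σ z * f z) ∈ M.germs z
  quot_mul : ∀ z, σ z * a z = 0
  injective : ∀ {z f}, f ∈ N.germs z → (∀ᶠ z' in 𝓝 z, a z' * f z' = 0) → f z = 0
  exact : ∀ {z f}, f ∈ N.germs z → (∀ᶠ z' in 𝓝 z, σ z' * f z' = 0) →
    ∃ g ∈ N.germs z, ∀ᶠ z' in 𝓝 z, a z' * g z' = f z'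
  surjective : ∀ {z f}, f ∈ M.germs z → ∃ g ∈ N.germs z, ∀ᶠ z' in 𝓝 z, σ z' * g z' = f z'

theorem mul_fst_mem_twist {N M : FunctionCondition k Z} {e : Z → k} {he : IsMultiplier N e}
    {he' : IsMultiplier M e} {a : Z → k}
    (ha : ∀ {z f}, f ∈ N.germs z → (fun z => a z * f z) ∈ M.germs z) {q : prodCirc Z}
    {f : prodCirc Z → k} (hf : f ∈ (twist N he).germs q) :
    (fun q => a q.1 * f q) ∈ (twist M he').germs q := by
  intro p hp
  obtain ⟨h, hh, hf⟩ := hf p hp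
  refine ⟨_, ha hh, ?_⟩
  filter_upwards [hf] with p' hp'
  simp only [← hp', covCirc]
  ring

theorem IsMultiplier.twist {N : FunctionCondition k Z} {e : Z → k} (he : IsMultiplier N e)
    {e' : Z → k} (he' : IsMultiplier N e') :
    IsMultiplier (twist N he) (fun q : prodCirc Z => e' q.1) where
  ne_zero q := he'.ne_zero q.1
  mul_mem hf := mul_fst_mem_twist he'.mul_mem hf
  inv_mul_mem hf := mul_fst_mem_twist (a := fun z => (e' z)⁻¹) he'.inv_mul_mem hf

theorem eventually_mul_eq_zero_of_twist {e a h : Z → k} {f : prodCirc Z → k} {p : Z × ℝ}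
    (hf : ∀ᶠ p' in 𝓝 p, e p'.1 ^ ⌊p'.2⌋ * f (covCirc Z p') = h p'.1)
    (h0 : ∀ᶠ q in 𝓝 (covCirc Z p), a q.1 * f q = 0) : ∀ᶠ z in 𝓝 p.1, a z * h z = 0 := by
  have key : ∀ᶠ p' in 𝓝 p, a p'.1 * h p'.1 = 0 := by
    filter_upwards [hf, eventually_covCirc.1 h0] with p' h1 h2
    rw [← h1, mul_left_comm, show a p'.1 * f (covCirc Z p') = 0 from h2, mul_zero]
  have hc : Continuous fun z : Z => ((z, p.2) : Z × ℝ) := by fun_prop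
  exact (hc.tendsto p.1).eventually key

theorem exists_mem_twist_mul_eq {N : FunctionCondition k Z} {e : Z → k} (he : IsMultiplier N e)
    {a g h : Z → k} {f : prodCirc Z → k} {p : Z × ℝ}
    (hf : ∀ᶠ p' in 𝓝 p, e p'.1 ^ ⌊p'.2⌋ * f (covCirc Z p') = h p'.1) (hg : g ∈ N.germs p.1)
    (hgh : ∀ᶠ z in 𝓝 p.1, a z * g z = h z) :
    ∃ g' ∈ (twist N he).germs (covCirc Z p), ∀ᶠ q in 𝓝 (covCirc Z p), a q.1 * g' q = f q := by
  obtain ⟨g', hg', hgg⟩ := exists_mem_twist he hg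
  refine ⟨g', hg', eventually_covCirc.2 ?_⟩
  filter_upwards [hgg, hf, (continuous_fst.tendsto p).eventually hgh] with p' h1 h2 h3
  apply mul_left_cancel₀ (zpow_ne_zero ⌊p'.2⌋ (he.ne_zero p'.1))
  rw [h2, ← h3, ← h1, mul_left_comm]
  rfl

theorem IsMulShortExact.twist {N M : FunctionCondition k Z} {a σ : Z → k}
    (h : IsMulShortExact N M a σ) {e : Z → k} (he : IsMultiplier N e) (he' : IsMultiplier M e) :
    IsMulShortExact (PoincareTorus.twist N he) (PoincareTorus.twist M he')
      (fun q : prodCirc Z => a q.1) (fun q => σ q.1) where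
  mul_mem hf := mul_fst_mem_twist h.mul_mem hf
  quot_mem hf := mul_fst_mem_twist h.quot_mem hf
  quot_mul q := h.quot_mul q.1
  injective := by
    intro q f hf h0
    obtain ⟨p, rfl⟩ := covCirc_surjective q
    obtain ⟨h₀, hh₀, hf⟩ := hf p rfl
    have h1 := hf.self_of_nhds
    rw [h.injective hh₀ (eventually_mul_eq_zero_of_twist hf h0)] at h1
    exact (mul_eq_zero.1 h1).resolve_left (zpow_ne_zero _ (he.ne_zero _))
  exact := by
    intro q f hf h0
    obtain ⟨p, rfl⟩ := covCirc_surjective q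
    obtain ⟨h₀, hh₀, hf⟩ := hf p rfl
    obtain ⟨g, hg, hgh⟩ := h.exact hh₀ (eventually_mul_eq_zero_of_twist hf h0)
    exact exists_mem_twist_mul_eq he hf hg hgh
  surjective := by
    intro q f hf
    obtain ⟨p, rfl⟩ := covCirc_surjective q
    obtain ⟨h₀, hh₀, hf⟩ := hf p rfl
    obtain ⟨g, hg, hgh⟩ := h.surjective hh₀
    exact exists_mem_twist_mul_eq he hf hg hgh

end Twist

section PathSheaf

open scoped unitInterval

variable {k : Type} [Field k] {Z : TopCat.{0}}

/-- The map `Z × [0, 1] → Z × ℝ / ℤ`. -/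
def pathCov (Z : TopCat.{0}) (q : Z × I) : prodCirc Z := covCirc Z (q.1, q.2)

theorem isClosedMap_pathCov : IsClosedMap (pathCov Z) := by
  have h : Continuous fun y : I => ((y : ℝ) : Circ) :=
    (AddCircle.continuous_mk' 1).comp continuous_subtype_val
  exact (isProperMap_id.prodMap h.isProperMap).isClosedMap

/-- The functions on `Z × [0, 1]` that near `q` are pulled back from a function satisfying `N`. -/
def PathAt (N : FunctionCondition k Z) (f : Z × I → k) (q : Z × I) : Prop :=
  ∃ h ∈ N.germs q.1, ∀ᶠ q' in 𝓝 q, f q' = h q'.1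

theorem eventually_pathAt {N : FunctionCondition k Z} {f : Z × I → k} {q : Z × I}
    (hf : PathAt N f q) : ∀ᶠ q' in 𝓝 q, PathAt N f q' := by
  obtain ⟨h, hh, hf⟩ := hf
  filter_upwards [hf.eventually_nhds, (continuous_fst.tendsto q).eventually (N.eventually_mem hh)]
    with p' h1 h2
  exact ⟨h, h2, h1⟩

theorem eventually_pathCov {q : Z × I} {R : prodCirc Z → Prop}
    (h : ∀ᶠ x in 𝓝 (pathCov Z q), R x) : ∀ᶠ q' in 𝓝 q, R (pathCov Z q') := by
  have hc : Continuous fun q : Z × I => ((q.1, (q.2 : ℝ)) : Z × ℝ) := by fun_prop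
  exact ((continuous_covCirc.comp hc).tendsto q).eventually h

/-- The functions on `Z × [0, 1]` locally pulled back from functions on `Z` satisfying `N`, as a
local condition over `Z × ℝ / ℤ`. -/
def path (N : FunctionCondition k Z) : LocalCondition k (pathCov Z) where
  germs x :=
    { carrier := {f | ∀ q, pathCov Z q = x → PathAt N f q}
      add_mem' := by
        intro f g hf hg q hq
        obtain ⟨h, hh, hf⟩ := hf q hq
        obtain ⟨h', hh', hg⟩ := hg q hq
        refine ⟨h + h', add_mem hh hh', ?_⟩
        filter_upwards [hf, hg] with p' h1 h2
        simp [h1, h2]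
      zero_mem' := fun p _ => ⟨0, zero_mem _, by simp⟩
      smul_mem' := by
        intro c f hf q hq
        obtain ⟨h, hh, hf⟩ := hf q hq
        refine ⟨c • h, Submodule.smul_mem _ c hh, ?_⟩
        filter_upwards [hf] with p' h1
        simp [h1] }
  congr_germ := by
    rintro x f f' hff hf q rfl
    obtain ⟨h, hh, hf⟩ := hf q rfl
    refine ⟨h, hh, ?_⟩
    filter_upwards [hf, eventually_pathCov hff] with p' h1 h2
    rw [← h1, h2 _ rfl]
  eventually_mem {x f} hf := isClosedMap_pathCov.eventually_nhds_fiber x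
    fun q hq => eventually_pathAt (hf q hq)

/-- The inclusion of the base point section `z ↦ (z, 0)`. -/
def zeroSec (Z : TopCat.{0}) (z : Z) : prodCirc Z := covCirc Z (z, 0)

theorem isOpen_ne_zero : IsOpen {x : prodCirc Z | x.2 ≠ ((0 : ℝ) : Circ)} :=
  isOpen_ne.preimage continuous_snd

/-- The condition `N` on the base point section. -/
def atZero (N : FunctionCondition k Z) : LocalCondition k (zeroSec Z) where
  germs x :=
    { carrier := {f | x.2 = ((0 : ℝ) : Circ) → f ∈ N.germs x.1}
      add_mem' := fun hf hg hx => add_mem (hf hx) (hg hx)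
      zero_mem' := fun _ => zero_mem _
      smul_mem' := fun c _ hf hx => Submodule.smul_mem _ c (hf hx) }
  congr_germ := by
    intro x f f' hff hf hx
    obtain ⟨z, θ⟩ := x
    obtain rfl : θ = ((0 : ℝ) : Circ) := hx
    refine N.congr_of_eventuallyEq ?_ (hf rfl)
    have hc : Continuous fun z : Z => ((z, 0) : Z × ℝ) := by fun_prop
    filter_upwards [((continuous_covCirc.comp hc).tendsto z).eventually hff] with z' hz'
    exact hz' z' rfl
  eventually_mem := by
    intro x f hf
    by_cases hx : x.2 = ((0 : ℝ) : Circ)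
    · filter_upwards [(continuous_fst.tendsto x).eventually (N.eventually_mem (hf hx))]
        with x' hx' _
      exact hx'
    · filter_upwards [isOpen_ne_zero.mem_nhds hx] with x' hx' h
      exact absurd h hx'

/-- The map from twisted functions to functions on `Z × [0, 1]`. -/
def toPath (e : Z → k) : (prodCirc Z → k) →ₗ[k] (Z × I → k) where
  toFun f q := e q.1 ^ ⌊(q.2 : ℝ)⌋ * f (pathCov Z q)
  map_add' f g := by ext q; simp [mul_add]
  map_smul' c f := by ext q; simp only [Pi.smul_apply, smul_eq_mul, RingHom.id_apply]; ring

/-- The difference of the boundary values, twisted by `e`. -/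
def bdry (e : Z → k) : (Z × I → k) →ₗ[k] (Z → k) where
  toFun f z := f (z, 1) - e z * f (z, 0)
  map_add' f g := by ext z; simp only [Pi.add_apply]; ring
  map_smul' c f := by ext z; simp only [Pi.smul_apply, smul_eq_mul, RingHom.id_apply]; ring

theorem pathCov_zero (z : Z) : pathCov Z (z, 0) = zeroSec Z z := by simp [pathCov, zeroSec]

theorem pathCov_one (z : Z) : pathCov Z (z, 1) = zeroSec Z z :=
  Prod.ext rfl (circ_coe_eq_coe_iff.2 ⟨-1, by simp⟩)

theorem isFiberwise_toPath (e : Z → k) :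
    LocalCondition.IsFiberwise (id : prodCirc Z → prodCirc Z) (pathCov Z) (toPath e) := by
  rintro f x hf q rfl
  change _ * f (pathCov Z q) = 0
  rw [hf (pathCov Z q) rfl, mul_zero]

theorem isFiberwise_bdry (e : Z → k) :
    LocalCondition.IsFiberwise (pathCov Z) (zeroSec Z) (bdry e) := by
  rintro f x hf z rfl
  simp [bdry, hf _ (pathCov_zero z), hf _ (pathCov_one z)]

theorem toPath_mem {N : FunctionCondition k Z} {e : Z → k} (he : IsMultiplier N e)
    (x : prodCirc Z) (f) (hf : f ∈ (twist N he).germs x) : toPath e f ∈ (path N).germs x := by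
  rintro q rfl
  obtain ⟨h, hh, hf⟩ := hf (q.1, q.2) rfl
  have hc : Continuous fun q : Z × I => ((q.1, (q.2 : ℝ)) : Z × ℝ) := by fun_prop
  exact ⟨h, hh, (hc.tendsto q).eventually hf⟩

theorem slice_mem {N : FunctionCondition k Z} {f : Z × I → k} {z : Z} {y : I}
    (hf : PathAt N f (z, y)) : (fun z => f (z, y)) ∈ N.germs z := by
  obtain ⟨h, hh, hf⟩ := hf
  have hc : Continuous fun z : Z => ((z, y) : Z × I) := by fun_prop
  exact N.congr_of_eventuallyEq (((hc.tendsto z).eventually hf).mono fun _ h => h.symm) hh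

theorem eventually_eq_slice {N : FunctionCondition k Z} {f : Z × I → k} {z : Z} {y : I}
    (hf : PathAt N f (z, y)) : ∀ᶠ q in 𝓝 (z, y), f q = f (q.1, y) := by
  obtain ⟨h, -, hf⟩ := hf
  have hc : Continuous fun q : Z × I => ((q.1, y) : Z × I) := by fun_prop
  filter_upwards [hf, (hc.tendsto (z, y)).eventually hf] with q h1 h2
  rw [h1, h2]
theorem bdry_mem {N : FunctionCondition k Z} {e : Z → k} (he : IsMultiplier N e)
    (x : prodCirc Z) (f) (hf : f ∈ (path N).germs x) : bdry e f ∈ (atZero N).germs x := by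
  intro hx
  have hx' : zeroSec Z x.1 = x := Prod.ext rfl hx.symm
  have h0 := slice_mem (hf (x.1, 0) ((pathCov_zero _).trans hx'))
  have h1 := slice_mem (hf (x.1, 1) ((pathCov_one _).trans hx'))
  exact sub_mem h1 (he.mul_mem h0)

theorem bdry_toPath (e : Z → k) (f : prodCirc Z → k) : bdry e (toPath e f) = 0 := by
  ext z
  simp [bdry, toPath, pathCov_zero, pathCov_one]

/-- The representative in `[0, 1)` of a point of the circle. -/
def circRep (θ : Circ) : I :=
  ⟨AddCircle.equivIco 1 0 θ, by
    have := (AddCircle.equivIco (1 : ℝ) 0 θ).2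
    exact ⟨this.1, (this.2.trans_eq (zero_add 1)).le⟩⟩

theorem coe_circRep (θ : Circ) : ((circRep θ : ℝ) : Circ) = θ := AddCircle.coe_equivIco

theorem circRep_coe {y : I} (hy : (y : ℝ) < 1) : circRep ((y : ℝ) : Circ) = y := by
  apply Subtype.ext
  change ((AddCircle.equivIco (1 : ℝ) 0 ((y : ℝ) : Circ)) : ℝ) = y
  rw [AddCircle.equivIco_coe_eq (by simpa using ⟨y.2.1, hy⟩)]

theorem circRep_lt (θ : Circ) : (circRep θ : ℝ) < 1 := by
  have := (AddCircle.equivIco (1 : ℝ) 0 θ).2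
  exact this.2.trans_eq (zero_add 1)

/-- The function on `Z × ℝ / ℤ` with given values on `Z × [0, 1)`. -/
def ofPath (f : Z × I → k) (x : prodCirc Z) : k := f (x.1, circRep x.2)

theorem toPath_ofPath {e : Z → k} {f : Z × I → k} {q : Z × I}
    (h : zeroSec Z q.1 = pathCov Z q → bdry e f q.1 = 0) : toPath e (ofPath f) q = f q := by
  obtain ⟨z, y⟩ := q
  by_cases hy : (y : ℝ) < 1
  · have : ⌊(y : ℝ)⌋ = 0 := Int.floor_eq_zero_iff.2 ⟨y.2.1, hy⟩
    change e z ^ ⌊(y : ℝ)⌋ * f (z, circRep ((y : ℝ) : Circ)) = _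
    rw [this, circRep_coe hy]
    simp
  · obtain rfl : y = 1 := Subtype.ext (le_antisymm y.2.2 (not_lt.1 hy))
    have h' := h (pathCov_one z).symm
    have h0 : circRep (((1 : I) : ℝ) : Circ) = 0 := by
      have h1 : (((1 : I) : ℝ) : Circ) = (((0 : I) : ℝ) : Circ) :=
        circ_coe_eq_coe_iff.2 ⟨-1, by simp⟩
      rw [h1, circRep_coe (by simp)]
    change e z ^ ⌊((1 : I) : ℝ)⌋ * f (z, circRep (((1 : I) : ℝ) : Circ)) = _
    rw [h0]
    have h2 : f (z, 1) - e z * f (z, 0) = 0 := h'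
    simp only [Set.Icc.coe_one, Int.floor_one, zpow_one]
    exact (sub_eq_zero.1 h2).symm

theorem eventually_comap_proj {p : Z × ℝ} {y : I} (hy : (y : ℝ) = p.2) {R : Z × I → Prop}
    (h : ∀ᶠ q in 𝓝 (p.1, y), R q) :
    ∀ᶠ p' in 𝓝 p, R (p'.1, Set.projIcc (0 : ℝ) 1 zero_le_one p'.2) := by
  have hc : Continuous fun p' : Z × ℝ => ((p'.1, Set.projIcc (0 : ℝ) 1 zero_le_one p'.2) : Z × I) :=
    continuous_fst.prodMk (continuous_projIcc.comp continuous_snd)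
  have ht := hc.tendsto p
  rw [← hy, Set.projIcc_val] at ht
  exact ht.eventually h

theorem zpow_mul_ofPath_of_nonneg (e : Z → k) (f : Z × I → k) {p : Z × ℝ} (h0 : 0 ≤ p.2)
    (h1 : p.2 < 1) : e p.1 ^ ⌊p.2⌋ * ofPath f (covCirc Z p) =
      f (p.1, Set.projIcc (0 : ℝ) 1 zero_le_one p.2) := by
  rw [Int.floor_eq_zero_iff.2 ⟨h0, h1⟩, zpow_zero, one_mul, Set.projIcc_of_mem _ ⟨h0, h1.le⟩]
  change f (p.1, circRep (p.2 : Circ)) = _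
  rw [← circRep_coe (y := ⟨p.2, h0, h1.le⟩) h1]

theorem zpow_mul_ofPath_of_neg (e : Z → k) (f : Z × I → k) {p : Z × ℝ} (h0 : -1 < p.2)
    (h1 : p.2 < 0) : e p.1 ^ ⌊p.2⌋ * ofPath f (covCirc Z p) =
      (e p.1)⁻¹ * f (p.1, Set.projIcc (0 : ℝ) 1 zero_le_one (p.2 + 1)) := by
  have hfloor : ⌊p.2⌋ = -1 := Int.floor_eq_iff.2 ⟨by push_cast; linarith, by push_cast; linarith⟩
  have hmem : p.2 + 1 ∈ Set.Icc (0 : ℝ) 1 := ⟨by linarith, by linarith⟩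
  have hlt : ((⟨p.2 + 1, hmem⟩ : I) : ℝ) < 1 := by change p.2 + 1 < 1; linarith
  have hcirc : ((p.2 + 1 : ℝ) : Circ) = (p.2 : Circ) := circ_coe_eq_coe_iff.2 ⟨-1, by simp⟩
  rw [hfloor, zpow_neg_one, Set.projIcc_of_mem _ hmem, ← circRep_coe hlt]
  change _ * f (p.1, circRep (p.2 : Circ)) = _ * f (p.1, circRep ((p.2 + 1 : ℝ) : Circ))
  rw [hcirc]

theorem ofPath_mem_of_pos {N : FunctionCondition k Z} {e : Z → k} (he : IsMultiplier N e)
    {f : Z × I → k} {z : Z} {y : I} (hf : PathAt N f (z, y)) (h0 : 0 < (y : ℝ))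
    (h1 : (y : ℝ) < 1) : ofPath f ∈ (twist N he).germs (pathCov Z (z, y)) := by
  obtain ⟨h, hh, hfh⟩ := hf
  refine (mem_twist (p := (z, (y : ℝ))) he).2 ⟨h, hh, ?_⟩
  have hsnd := continuous_snd.tendsto (z, (y : ℝ))
  filter_upwards [eventually_comap_proj (p := (z, (y : ℝ))) rfl hfh,
    hsnd.eventually (Ioi_mem_nhds h0), hsnd.eventually (Iio_mem_nhds h1)] with p hp hp0 hp1
  rw [zpow_mul_ofPath_of_nonneg e f (le_of_lt hp0) hp1, hp]

theorem ofPath_mem_zeroSec {N : FunctionCondition k Z} {e : Z → k} (he : IsMultiplier N e)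
    {f : Z × I → k} {z : Z} (hf0 : PathAt N f (z, 0)) (hf1 : PathAt N f (z, 1))
    (hb : ∀ᶠ z' in 𝓝 z, bdry e f z' = 0) : ofPath f ∈ (twist N he).germs (zeroSec Z z) := by
  have heq1 := eventually_eq_slice hf1
  obtain ⟨h, hh, hfh⟩ := hf0
  refine (mem_twist (p := (z, 0)) he).2 ⟨h, hh, ?_⟩
  have hfst := continuous_fst.tendsto ((z, 0) : Z × ℝ)
  have hsnd := continuous_snd.tendsto ((z, 0) : Z × ℝ)
  have hzero : Continuous fun p : Z × ℝ => ((p.1, 0) : Z × I) := by fun_prop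
  have hshift : Continuous fun p : Z × ℝ => ((p.1, p.2 + 1) : Z × ℝ) := by fun_prop
  filter_upwards [eventually_comap_proj (p := (z, 0)) (y := 0) rfl hfh,
    (hzero.tendsto (z, 0)).eventually hfh,
    (hshift.tendsto (z, 0)).eventually
      (eventually_comap_proj (p := (z, 0 + 1)) (y := 1) (by simp) heq1),
    hfst.eventually hb, hsnd.eventually (Ioi_mem_nhds (show (-1 : ℝ) < 0 by norm_num)),
    hsnd.eventually (Iio_mem_nhds zero_lt_one)] with p hp hp0 hp1 hpb hgt hlt
  rcases le_or_gt 0 p.2 with h0 | h0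
  · rw [zpow_mul_ofPath_of_nonneg e f h0 hlt, hp]
  · have hends : f (p.1, 1) = e p.1 * f (p.1, 0) := sub_eq_zero.1 hpb
    rw [zpow_mul_ofPath_of_neg e f hgt h0, hp1, hends, inv_mul_cancel_left₀ (he.ne_zero _), hp0]

theorem ofPath_mem {N : FunctionCondition k Z} {e : Z → k} (he : IsMultiplier N e)
    {x : prodCirc Z} {f : Z × I → k} (hf : f ∈ (path N).germs x)
    (hb : ∀ᶠ x' in 𝓝 x, ∀ z, zeroSec Z z = x' → bdry e f z = 0) :
    ofPath f ∈ (twist N he).germs x := by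
  obtain ⟨⟨z, y⟩, hy1, rfl⟩ : ∃ q : Z × I, (q.2 : ℝ) < 1 ∧ pathCov Z q = x :=
    ⟨(x.1, circRep x.2), circRep_lt _, Prod.ext rfl (coe_circRep _)⟩
  rcases y.2.1.lt_or_eq with hy0 | hy0
  · exact ofPath_mem_of_pos he (hf (z, y) rfl) hy0 hy1
  · obtain rfl : y = 0 := Subtype.ext hy0.symm
    rw [pathCov_zero] at hf hb ⊢
    have hc : Continuous (zeroSec Z) := continuous_covCirc.comp (by fun_prop)
    refine ofPath_mem_zeroSec he (hf _ (pathCov_zero z)) (hf _ (pathCov_one z)) ?_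
    exact ((hc.tendsto z).eventually hb).mono fun z' hz' => hz' z' rfl

/-- The function on `Z × [0, 1]` equal to `u` before time `s` and to `v` from time `s` on. -/
def jump {α : Type} (s : ℝ) (u v : Z → α) (q : Z × I) : α := if (q.2 : ℝ) < s then u q.1 else v q.1

theorem eventually_jump_of_lt {α : Type} {s : ℝ} {q : Z × I} (u v : Z → α) (h : (q.2 : ℝ) < s) :
    ∀ᶠ q' in 𝓝 q, jump s u v q' = u q'.1 := by
  have hc : Continuous fun q : Z × I => (q.2 : ℝ) := by fun_prop
  filter_upwards [(hc.tendsto q).eventually (Iio_mem_nhds h)] with q' hq'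
  exact if_pos hq'

theorem eventually_jump_of_gt {α : Type} {s : ℝ} {q : Z × I} (u v : Z → α) (h : s < (q.2 : ℝ)) :
    ∀ᶠ q' in 𝓝 q, jump s u v q' = v q'.1 := by
  have hc : Continuous fun q : Z × I => (q.2 : ℝ) := by fun_prop
  filter_upwards [(hc.tendsto q).eventually (Ioi_mem_nhds h)] with q' hq'
  exact if_neg (not_lt.2 (le_of_lt hq'))

theorem pathAt_jump {N : FunctionCondition k Z} {s : ℝ} {u v : Z → k} {q : Z × I}
    (hu : u ∈ N.germs q.1) (hv : v ∈ N.germs q.1) (hq : (q.2 : ℝ) ≠ s) :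
    PathAt N (jump s u v) q := by
  rcases lt_or_gt_of_ne hq with h | h
  · exact ⟨u, hu, eventually_jump_of_lt _ _ h⟩
  · exact ⟨v, hv, eventually_jump_of_gt _ _ h⟩

theorem exists_bdry_eq {N : FunctionCondition k Z} (e : Z → k) {x : prodCirc Z} {g : Z → k}
    (hg : g ∈ (atZero N).germs x) : ∃ f ∈ (path N).germs x,
      ∀ᶠ x' in 𝓝 x, ∀ z, zeroSec Z z = x' → bdry e f z = g z := by
  by_cases hx : x.2 = ((0 : ℝ) : Circ)
  · refine ⟨jump (1 / 2) 0 g, ?_, .of_forall fun x' z _ => ?_⟩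
    · rintro q rfl
      refine pathAt_jump (zero_mem _) (hg hx) fun h => ?_
      obtain ⟨n, hn⟩ := circ_coe_eq_coe_iff.1 hx
      dsimp only at hn
      rw [h] at hn
      have h1 : (2 * n : ℝ) = -1 := by linarith
      have h2 : 2 * n = -1 := by exact_mod_cast h1
      omega
    · simp only [bdry, jump, LinearMap.coe_mk, AddHom.coe_mk, Set.Icc.coe_one, Set.Icc.coe_zero]
      norm_num
  · refine ⟨0, zero_mem _, ?_⟩
    filter_upwards [isOpen_ne_zero.mem_nhds hx] with x' hx' z hz
    subst hz
    exact absurd rfl hx'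

/-- The resolution `0 → twist N → path N → N → 0` of a twist: a twisted function is a function on
paths once around the circle whose end values differ by the monodromy. -/
def pathComplex (N : FunctionCondition k Z) {e : Z → k} (he : IsMultiplier N e) :
    ShortComplex (Sh k (prodCirc Z)) :=
  ShortComplex.mk
    (LocalCondition.hom (twist N he) (path N) (toPath e) (isFiberwise_toPath e) (toPath_mem he))
    (LocalCondition.hom (path N) (atZero N) (bdry e) (isFiberwise_bdry e) (bdry_mem he))
    (LocalCondition.hom_comp_hom_eq_zero (bdry_toPath e))

theorem pathComplex_shortExact (N : FunctionCondition k Z) {e : Z → k} (he : IsMultiplier N e) :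
    (pathComplex N he).ShortExact := by
  refine LocalCondition.shortExact (bdry_toPath e) ?_ ?_ fun x g hg => exists_bdry_eq e hg
  · rintro x f - hf y rfl
    have hy : pathCov Z (y.1, circRep y.2) = y := Prod.ext rfl (coe_circRep _)
    have hfy := hf.self_of_nhds (y.1, circRep y.2) hy
    change e y.1 ^ ⌊(circRep y.2 : ℝ)⌋ * f (pathCov Z (y.1, circRep y.2)) = 0 at hfy
    rw [hy] at hfy
    exact (mul_eq_zero.1 hfy).resolve_left (zpow_ne_zero _ (he.ne_zero _))
  · intro x f hf hb
    refine ⟨ofPath f, ofPath_mem he hf hb, ?_⟩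
    filter_upwards [hb] with x' hx' q hq
    exact toPath_ofPath fun h => hx' _ (h.trans hq)

theorem snd_of_pathCov_mem_seg {z : Z} {s t : ℝ} (hs : 0 ≤ s) (ht : t ≤ 1) {q : Z × I}
    (hq : pathCov Z q ∈ seg z s t) : q.1 = z ∧ ((s ≤ (q.2 : ℝ) ∧ (q.2 : ℝ) ≤ t) ∨
      (s ≤ 0 ∧ (q.2 : ℝ) = 1) ∨ (1 ≤ t ∧ (q.2 : ℝ) = 0)) := by
  obtain ⟨y, hy, h⟩ := hq
  obtain ⟨n, hn⟩ := circ_coe_eq_coe_iff.1 (congrArg Prod.snd h)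
  refine ⟨(congrArg Prod.fst h).symm, ?_⟩
  dsimp only at hn
  have h0 := q.2.2.1
  have h1 := q.2.2.2
  have hl : (-1 : ℝ) ≤ n := by linarith [hy.2]
  have hu : (n : ℝ) ≤ 1 := by linarith [hy.1]
  have hl' : -1 ≤ n := by exact_mod_cast hl
  have hu' : n ≤ 1 := by exact_mod_cast hu
  obtain rfl | rfl | rfl : n = -1 ∨ n = 0 ∨ n = 1 := by omega
  · push_cast at hn
    exact Or.inr (Or.inr ⟨by linarith [hy.2], by linarith [hy.2]⟩)
  · push_cast at hn
    exact Or.inl ⟨by linarith [hy.1], by linarith [hy.2]⟩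
  · push_cast at hn
    exact Or.inr (Or.inl ⟨by linarith [hy.1], by linarith [hy.1]⟩)
theorem snd_of_pathCov_mem_seg_inter {z : Z} {b c : ℝ} (hb : 0 < b) (hbc : b < c) (hc : c ≤ 1)
    {q : Z × I} (hq : pathCov Z q ∈ seg z 0 b ∩ seg z b c) : q.1 = z ∧ ((q.2 : ℝ) = b ∨
      (1 ≤ c ∧ (q.2 : ℝ) = 0) ∨ (1 ≤ c ∧ (q.2 : ℝ) = 1)) := by
  obtain ⟨hz, h₁⟩ := snd_of_pathCov_mem_seg le_rfl (hbc.le.trans hc) hq.1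
  obtain ⟨-, h₂⟩ := snd_of_pathCov_mem_seg hb.le hc hq.2
  refine ⟨hz, ?_⟩
  rcases h₁ with h | h | h
  · rcases h₂ with h' | h' | h'
    · exact Or.inl (le_antisymm h.2 h'.1)
    · linarith
    · exact Or.inr (Or.inl h')
  · rcases h₂ with h' | h' | h'
    · exact Or.inr (Or.inr ⟨h.2 ▸ h'.2, h.2⟩)
    · linarith
    · exact Or.inr (Or.inl h')
  · linarith

theorem exists_end_germs {N : FunctionCondition k Z} {a : Z × I → k} {z : Z} {b c : ℝ}
    (hb : 0 ≤ b) (hbc : b ≤ c) (hc : c ≤ 1)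
    (ha : ∀ x ∈ seg z 0 b ∩ seg z b c, a ∈ (path N).germs x) :
    ∃ u₀ ∈ N.germs z, ∃ u₁ ∈ N.germs z, 1 ≤ c →
      (∀ᶠ q in 𝓝 ((z, 0) : Z × I), a q = u₀ q.1) ∧ ∀ᶠ q in 𝓝 ((z, 1) : Z × I), a q = u₁ q.1 := by
  by_cases h1 : 1 ≤ c
  · obtain rfl : c = 1 := le_antisymm hc h1
    have hm : zeroSec Z z ∈ seg z 0 b ∩ seg z b 1 :=
      ⟨⟨0, ⟨le_rfl, hb⟩, rfl⟩, ⟨1, ⟨hbc, le_rfl⟩, by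
        rw [← pathCov_one]; simp [pathCov, covCirc]⟩⟩
    obtain ⟨u₀, hu₀, h₀⟩ := ha _ hm (z, 0) (pathCov_zero z)
    obtain ⟨u₁, hu₁, h₁⟩ := ha _ hm (z, 1) (pathCov_one z)
    exact ⟨u₀, hu₀, u₁, hu₁, fun _ => ⟨h₀, h₁⟩⟩
  · exact ⟨0, zero_mem _, 0, zero_mem _, fun h => absurd h h1⟩

/-- Near the overlap at time `b` take `a₁ = a` and `a₂ = 0`. If `c = 1`, the segments also meet at
the base point, whose preimages are the times `0` and `1`; after time `b` and before time `b`
respectively, `a₁` and `a₂` are changed to split `a` there. -/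
theorem exists_sub_eq_of_path (N : FunctionCondition k Z) {a : Z × I → k} {z : Z} {b c : ℝ}
    (hb : 0 < b) (hbc : b < c) (hc : c ≤ 1)
    (ha : ∀ x ∈ seg z 0 b ∩ seg z b c, a ∈ (path N).germs x) : ∃ a₁ a₂ : Z × I → k,
      (∀ x ∈ seg z 0 b, a₁ ∈ (path N).germs x) ∧ (∀ x ∈ seg z b c, a₂ ∈ (path N).germs x) ∧
      ∀ x ∈ seg z 0 b ∩ seg z b c, ∀ᶠ x' in 𝓝 x, ∀ q, pathCov Z q = x' → a₁ q - a₂ q = a q := by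
  let b' : I := ⟨b, hb.le, hbc.le.trans hc⟩
  have hab : PathAt N a (z, b') := ha (pathCov Z (z, b'))
    ⟨⟨b, ⟨hb.le, le_rfl⟩, rfl⟩, ⟨b, ⟨le_rfl, hbc.le⟩, rfl⟩⟩ _ rfl
  obtain ⟨u₀, hu₀, u₁, hu₁, hu⟩ := exists_end_germs hb.le hbc.le hc ha
  let w : Z → k := fun z => a (z, b')
  have hw : w ∈ N.germs z := slice_mem hab
  refine ⟨jump ((b + 1) / 2) w u₁,
    jump (b / 2) (w - u₀) 0, ?_, ?_, fun x hx => ?_⟩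
  · rintro x hx q rfl
    obtain ⟨rfl, h⟩ := snd_of_pathCov_mem_seg le_rfl (hbc.le.trans hc) hx
    exact pathAt_jump hw hu₁ fun hq => by rcases h with h | h | h <;> linarith
  · rintro x hx q rfl
    obtain ⟨rfl, h⟩ := snd_of_pathCov_mem_seg hb.le hc hx
    exact pathAt_jump (sub_mem hw hu₀) (zero_mem _) fun hq => by
      rcases h with h | h | h <;> linarith
  refine isClosedMap_pathCov.eventually_nhds_fiber x ?_
  rintro ⟨z', y⟩ rfl
  obtain ⟨hz : z' = z, hy⟩ := snd_of_pathCov_mem_seg_inter hb hbc hc hx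
  subst hz
  rcases hy with h | ⟨h, h'⟩ | ⟨h, h'⟩
  · obtain rfl : y = b' := Subtype.ext h
    have hlt : ((z', b').2 : ℝ) < (b + 1) / 2 := by linarith
    have hgt : b / 2 < ((z', b').2 : ℝ) := by linarith
    filter_upwards [eventually_jump_of_lt w u₁ hlt, eventually_jump_of_gt (w - u₀) 0 hgt,
      eventually_eq_slice hab]
      with q h1 h2 h3
    simp only [h1, h2, h3, Pi.zero_apply, sub_zero, w]
  · obtain rfl : y = 0 := Subtype.ext h'
    have hlt : ((z', (0 : I)).2 : ℝ) < (b + 1) / 2 := by linarith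
    have hlt' : ((z', (0 : I)).2 : ℝ) < b / 2 := by linarith
    filter_upwards [eventually_jump_of_lt w u₁ hlt, eventually_jump_of_lt (w - u₀) 0 hlt',
      (hu h).1] with q h1 h2 h3
    simp only [h1, h2, h3, Pi.sub_apply, sub_sub_cancel]
  · obtain rfl : y = 1 := Subtype.ext h'
    have hgt : (b + 1) / 2 < ((z', (1 : I)).2 : ℝ) := by linarith
    have hgt' : b / 2 < ((z', (1 : I)).2 : ℝ) := by linarith
    filter_upwards [eventually_jump_of_gt w u₁ hgt, eventually_jump_of_gt (w - u₀) 0 hgt',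
      (hu h).2] with q h1 h2 h3
    simp only [h1, h2, h3, Pi.zero_apply, sub_zero]

theorem fiberMayerVietoris_path [T2Space Z] (N : FunctionCondition k Z) :
    FiberMayerVietoris (path N).sheaf := by
  intro z b c hb hbc hc
  refine (path N).mayerVietoris (isCompact_seg z _ _) (isCompact_seg z _ _) fun a ha => ?_
  rcases hb.eq_or_lt with rfl | hb'
  · have hsub : seg z 0 0 ⊆ seg z 0 c := Set.image_mono (Set.Icc_subset_Icc le_rfl hbc)
    exact ⟨a, 0, fun x hx => ha x ⟨hx, hsub hx⟩, fun x _ => zero_mem _,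
      fun x _ => .of_forall fun x' y _ => sub_zero _⟩
  rcases hbc.eq_or_lt with rfl | hbc'
  · have hsub : seg z b b ⊆ seg z 0 b := Set.image_mono (Set.Icc_subset_Icc hb le_rfl)
    exact ⟨0, -a, fun x _ => zero_mem _, fun x hx => neg_mem (ha x ⟨hsub hx, hx⟩),
      fun x _ => .of_forall fun x' y _ => (zero_sub _).trans (neg_neg _)⟩
  exact exists_sub_eq_of_path N hb' hbc' hc ha

theorem eventually_path_eq {N : FunctionCondition k Z} {f : Z × I → k} {z : Z}
    (hf : ∀ y, PathAt N f (z, y)) : ∀ᶠ z' in 𝓝 z, ∀ y, f (z', y) = f (z', 0) := by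
  let A : Set I := {y | ∀ᶠ q in 𝓝 ((z, y) : Z × I), f q = f (q.1, 0)}
  have hcy : Continuous fun y : I => ((z, y) : Z × I) := by fun_prop
  have hA : IsClopen A := by
    constructor
    · rw [← isOpen_compl_iff, isOpen_iff_mem_nhds]
      intro y hy
      filter_upwards [(hcy.tendsto y).eventually (eventually_eq_slice (hf y)).eventually_nhds]
        with y' hy' hmem
      have hcq : Continuous fun q : Z × I => ((q.1, y') : Z × I) := by fun_prop
      refine hy ?_
      filter_upwards [eventually_eq_slice (hf y), (hcq.tendsto (z, y)).eventually hy',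
        (hcq.tendsto (z, y)).eventually hmem] with q e1 e2 e3
      rw [e1, ← e3, e2]
    · rw [isOpen_iff_mem_nhds]
      exact fun y hy => (hcy.tendsto y).eventually hy.eventually_nhds
  have hA_univ : A = Set.univ := hA.eq_univ ⟨0, eventually_eq_slice (hf 0)⟩
  have := isCompact_univ.eventually_forall_of_forall_eventually (x₀ := z)
    (P := fun z' y => f (z', y) = f (z', 0)) (K := (Set.univ : Set I))
    fun y _ => hA_univ.ge (Set.mem_univ y)
  exact this.mono fun z' h y => h y trivial

end PathSheaf

section Step

open Limits

variable {k : Type} [Field k] {Z : TopCat.{0}}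

/-- The map `p_* (atZero N) → M` given by multiplication by `σ`. -/
def cokerHom {N M : FunctionCondition k Z} {a σ : Z → k} (ht : IsMulShortExact N M a σ) :
    (TopCat.Sheaf.pushforward (ModuleCat.{0} k) (prodFst Z)).obj (atZero N).sheaf ⟶ M.sheaf :=
  ⟨{ app U := ModuleCat.ofHom
      { toFun := fun s => (⟨fun z => σ z * (atZero N).val s z,
          fun z hz => (congrArg (σ z * ·)
            ((atZero N).val_eq_zero s (y := z) (fun h => hz h))).trans (mul_zero _),
          fun z hz => ht.quot_mem ((atZero N).val_mem s (x := zeroSec Z z) hz rfl)⟩ :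
            M.sections U.unop)
        map_add' := fun s t => Subtype.ext (funext fun z => mul_add _ _ _)
        map_smul' := fun c s => Subtype.ext (funext fun z => mul_left_comm _ _ _) }
     naturality U U' i := by
      ext1
      refine LinearMap.ext fun s => Subtype.ext (funext fun z => ?_)
      by_cases hz : z ∈ U'.unop
      · exact (congrArg (σ z * ·) (LocalCondition.cut_of_mem (π := zeroSec Z) (y := z)
          (W := (Opens.map (prodFst Z)).obj U'.unop) hz _)).trans
          (LocalCondition.cut_of_mem (π := (id : Z → Z)) (y := z) hz
            (fun z => σ z * (atZero N).val s z)).symm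
      · refine Eq.trans ?_ (LocalCondition.cut_of_notMem (π := (id : Z → Z)) (y := z) hz _).symm
        exact (congrArg (σ z * ·) (LocalCondition.cut_of_notMem (π := zeroSec Z) (y := z)
          (W := (Opens.map (prodFst Z)).obj U'.unop) hz _)).trans (mul_zero _) }⟩

theorem germs_and_eventually_const_of_path {N : FunctionCondition k Z} {U : Opens Z}
    (s : Sec (path N).sheaf ((Opens.map (prodFst Z)).obj U)) {z : Z} (hz : z ∈ U) :
    (fun z => (path N).val s (z, 0)) ∈ N.germs z ∧
      ∀ᶠ z' in 𝓝 z, ∀ y, (path N).val s (z', y) = (path N).val s (z', 0) := by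
  have h : ∀ y, PathAt N ((path N).val s) (z, y) := fun y =>
    (path N).val_mem s (x := pathCov Z (z, y)) hz _ rfl
  exact ⟨slice_mem (h 0), eventually_path_eq h⟩

theorem pushforward_pathComplex_cokerHom {N M : FunctionCondition k Z} {e σ : Z → k}
    (he : IsMultiplier N e) (ht : IsMulShortExact N M (fun z => 1 - e z) σ) :
    (TopCat.Sheaf.pushforward (ModuleCat.{0} k) (prodFst Z)).map (pathComplex N he).g ≫
      cokerHom ht = 0 := by
  refine hom_ext_sec fun U s => M.sec_ext fun z hz => ?_
  obtain ⟨-, h⟩ := germs_and_eventually_const_of_path (N := N) (U := U) s hz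
  change σ z * ((path N).val s (z, 1) - e z * (path N).val s (z, 0)) = 0
  have h1 := ht.quot_mul z
  have h2 : (path N).val s (z, 1) = (path N).val s (z, 0) := h.self_of_nhds 1
  linear_combination (path N).val s (z, 0) * h1 + σ z * h2

theorem mono_pushforward_pathComplex_g {N M : FunctionCondition k Z} {e σ : Z → k}
    (he : IsMultiplier N e) (ht : IsMulShortExact N M (fun z => 1 - e z) σ) :
    Mono ((TopCat.Sheaf.pushforward (ModuleCat.{0} k) (prodFst Z)).map (pathComplex N he).g) := by
  refine mono_of_secMap_injective _ fun U => (injective_iff_map_eq_zero _).2 fun s hs => ?_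
  refine (path N).sec_ext fun q hq => ?_
  obtain ⟨z, y⟩ := q
  have hz : z ∈ U := hq
  obtain ⟨h1, h2⟩ := germs_and_eventually_const_of_path (N := N) (U := U) s hz
  have h3 : (path N).val s (z, 0) = 0 := by
    refine ht.injective h1 (h2.mono fun z' h => ?_)
    have h4 : (path N).val s (z', 1) - e z' * (path N).val s (z', 0) = 0 :=
      congrFun (congrArg (atZero N).val hs) z'
    rw [h 1] at h4
    linear_combination h4
  exact (h2.self_of_nhds y).trans h3

theorem epi_cokerHom {N M : FunctionCondition k Z} {a σ : Z → k} (ht : IsMulShortExact N M a σ) :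
    Epi (cokerHom ht) := by
  refine (epi_iff_sec _).2 fun U t z hz => ?_
  obtain ⟨g, hg, hgs⟩ := ht.surjective (M.val_mem t hz)
  obtain ⟨V, hVU, hzV, hV⟩ := LocalCondition.exists_opens ((N.eventually_mem hg).and hgs) hz
  let W := (Opens.map (prodFst Z)).obj V
  refine ⟨V, hVU, hzV, (atZero N).sec W g fun x hx _ => (hV _ hx).1, M.sec_ext fun z' hz' => ?_⟩
  refine Eq.trans ?_ (M.val_res hVU t hz').symm
  refine Eq.trans ?_ ((hV z' hz').2)
  exact congrArg (σ z' * ·) ((atZero N).val_sec (W := W) (y := z') hz')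

theorem pushforward_shortExact {N M : FunctionCondition k Z} {e σ : Z → k}
    (he : IsMultiplier N e) (ht : IsMulShortExact N M (fun z => 1 - e z) σ) :
    (ShortComplex.mk _ _ (pushforward_pathComplex_cokerHom he ht)).ShortExact where
  mono_f := mono_pushforward_pathComplex_g he ht
  exact := by
    refine exact_of_sec _ fun U s hs z hz => ?_
    obtain ⟨g, hg, hgs⟩ := ht.exact ((atZero N).val_mem s (x := zeroSec Z z) hz rfl)
      (Filter.Eventually.of_forall fun z' => congrFun (congrArg M.val hs) z')
    obtain ⟨V, hVU, hzV, hV⟩ := LocalCondition.exists_opens ((N.eventually_mem hg).and hgs) hz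
    let W := (Opens.map (prodFst Z)).obj V
    refine ⟨V, hVU, hzV, (path N).sec W (fun q => g q.1) ?_, (atZero N).sec_ext fun z' hz' => ?_⟩
    · rintro x hx q rfl
      exact ⟨g, (hV _ hx).1, Filter.Eventually.of_forall fun _ => rfl⟩
    · refine (LocalCondition.val_secMap_hom_sec (W := W) (hΦ := isFiberwise_bdry e)
        (h := bdry_mem he) (P := path N) (P' := atZero N) hz').trans ?_
      refine Eq.trans ?_ ((atZero N).val_res
        ((Opens.map (prodFst Z)).monotone hVU) s (y := z') hz').symm
      rw [← (hV z' hz').2]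
      simp only [bdry, LinearMap.coe_mk, AddHom.coe_mk]
      ring
  epi_g := epi_cokerHom ht

theorem isOneAcyclic_of_isQuotientOfInjective [T2Space Z] {A : Sh k (prodCirc Z)}
    (hA : IsQuotientOfInjective A) :
    IsOneAcyclic (TopCat.Sheaf.pushforward (ModuleCat.{0} k) (prodFst Z)) A := by
  obtain ⟨J, f, hJ, hf⟩ := hA
  refine fun B Q i q w hS => epi_pushforward_of_fiberMayerVietoris hS ?_
  exact fiberMayerVietoris_of_injective
    (S := ShortComplex.mk (kernel.ι f) f (kernel.condition f))
    { exact := ShortComplex.exact_kernel f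
      mono_f := inferInstanceAs (Mono (kernel.ι f))
      epi_g := hf } hJ

variable {E : Type*} [Category E] [Abelian E] (Q : Sh k Z ⥤ E) [Q.Additive]
  [PreservesFiniteLimits Q] {N M : FunctionCondition k Z} {e σ : Z → k} (he : IsMultiplier N e)
  (ht : IsMulShortExact N M (fun z => 1 - e z) σ)

include ht

theorem isZero_rightDerived_zero_twist : IsZero
    (((TopCat.Sheaf.pushforward (ModuleCat.{0} k) (prodFst Z) ⋙ Q).rightDerived 0).obj
      (twist N he).sheaf) :=
  have := (pushforward_shortExact he ht).mono_f
  isZero_rightDerived_zero_comp _ Q (pathComplex_shortExact N he)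

theorem rightDerived_succ_twist [T2Space Z] (n : ℕ) : Nonempty
    (((TopCat.Sheaf.pushforward (ModuleCat.{0} k) (prodFst Z) ⋙ Q).rightDerived (n + 1)).obj
      (twist N he).sheaf ≅ (Q.rightDerived n).obj M.sheaf) :=
  rightDerived_comp_succ _ Q (fun I hI => injective_pushforward _ I hI)
    (fun _ hA => isOneAcyclic_of_isQuotientOfInjective hA) (pathComplex_shortExact N he)
    (fun _ _ _ _ _ hS => epi_pushforward_of_fiberMayerVietoris hS (fiberMayerVietoris_path N))
    (pushforward_shortExact he ht) n

end Step

section Analysis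

variable {V E : Type*} [NormedAddCommGroup V] [NormedSpace ℝ V] [NormedAddCommGroup E]
  [NormedSpace ℝ E]

open MeasureTheory in
theorem contDiff_intervalIntegral {ψ : V × ℝ → E} (hψ : ContDiff ℝ ∞ ψ) :
    ContDiff ℝ ∞ (fun x => ∫ θ in (0 : ℝ)..1, ψ (x, θ)) := by
  let χ : ContDiffBump (0 : ℝ) := ⟨2, 3, by norm_num, by norm_num⟩
  let f : ℝ → ℝ := Set.indicator (Set.Ioc 0 1) 1
  let g : V → ℝ → E := fun p t => χ t • ψ (p, -t)
  have hf : LocallyIntegrable f volume := by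
    refine (IntegrableOn.integrable_indicator ?_ measurableSet_Ioc).locallyIntegrable
    exact integrableOn_const (by simp) (by simp)
  have hg : ContDiffOn ℝ ∞ ↿g (Set.univ ×ˢ Set.univ) := by
    have h1 : ContDiff ℝ ∞ fun q : V × ℝ => χ q.2 := χ.contDiff.comp contDiff_snd
    have h2 : ContDiff ℝ ∞ fun q : V × ℝ => ψ (q.1, -q.2) :=
      hψ.comp (contDiff_fst.prodMk contDiff_snd.neg)
    exact (h1.smul h2).contDiffOn
  have key := contDiffOn_convolution_right_with_param_comp (μ := volume) (n := ⊤)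
    (ContinuousLinearMap.lsmul ℝ ℝ : ℝ →L[ℝ] E →L[ℝ] E) (s := (Set.univ : Set V))
    (v := fun _ => (0 : ℝ)) contDiffOn_const isOpen_univ (isCompact_closedBall (0 : ℝ) 3)
    (f := f) (g := g) (fun p x _ hx => by
      have : χ x = 0 := χ.zero_of_le_dist (by
        rw [Metric.mem_closedBall, not_le] at hx
        exact hx.le)
      simp [g, this]) hf hg
  rw [contDiffOn_univ] at key
  convert key using 2 with x
  rw [intervalIntegral.integral_of_le zero_le_one, ← integral_indicator measurableSet_Ioc]
  refine integral_congr_ae (Filter.Eventually.of_forall fun t => Eq.symm ?_)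
  by_cases ht : t ∈ Set.Ioc (0 : ℝ) 1
  · have h1 : χ (-t) = 1 := χ.one_of_mem_closedBall (by
      simp only [Metric.mem_closedBall, dist_zero_right, norm_neg, Real.norm_eq_abs, χ]
      rw [abs_of_pos ht.1]
      linarith [ht.2])
    simp [f, g, ht, h1]
  · simp [f, ht]

theorem exists_contDiff_eventuallyEq [FiniteDimensional ℝ V] {h : V → E} {x : V}
    (hh : ∀ᶠ x' in 𝓝 x, ContDiffAt ℝ ∞ h x') :
    ∃ H : V → E, ContDiff ℝ ∞ H ∧ ∀ᶠ x' in 𝓝 x, h x' = H x' := by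
  obtain ⟨r, hr, hball⟩ := Metric.eventually_nhds_iff_ball.1 hh
  let χ : ContDiffBump x := ⟨r / 4, r / 2, by positivity, by linarith⟩
  refine ⟨fun y => χ y • h y, ?_, ?_⟩
  · rw [contDiff_iff_contDiffAt]
    intro y
    by_cases hy : dist y x < r
    · exact χ.contDiff.contDiffAt.smul (hball y hy)
    · have : ∀ᶠ y' in 𝓝 y, χ y' • h y' = 0 := by
        have hy' : r / 2 < dist y x := by linarith
        have hc : Continuous fun y' => dist y' x := by fun_prop
        filter_upwards [(hc.tendsto y).eventually (Ioi_mem_nhds hy')] with y' hy'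
        rw [χ.zero_of_le_dist (le_of_lt hy'), zero_smul]
      exact contDiffAt_const.congr_of_eventuallyEq this
  · filter_upwards [Metric.ball_mem_nhds x (show 0 < r / 4 by positivity)] with y hy
    rw [χ.one_of_mem_closedBall (Metric.ball_subset_closedBall hy), one_smul]

/-- Hadamard's lemma along the line `ℝ b`: the quotient is the mean of the derivative in the
direction `b` over the segment from `x - (u x - c) • b` to `x`. -/
theorem exists_contDiff_sub_eq_smul [CompleteSpace E] {h : V → E} (hh : ContDiff ℝ ∞ h)
    (u : StrongDual ℝ V) (b : V) (c : ℝ) : ∃ r : V → E, ContDiff ℝ ∞ r ∧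
      ∀ x, h x - h (x - (u x - c) • b) = (u x - c) • r x := by
  let γ : V × ℝ → V := fun p => p.1 - (u p.1 - c) • b + p.2 • (u p.1 - c) • b
  have hγ : ContDiff ℝ ∞ γ := by
    have h1 : ContDiff ℝ ∞ fun p : V × ℝ => u p.1 - c :=
      (u.contDiff.comp contDiff_fst).sub contDiff_const
    exact (contDiff_fst.sub (h1.smul contDiff_const)).add
      (contDiff_snd.smul (h1.smul contDiff_const))
  let ψ : V × ℝ → E := fun p => fderiv ℝ h (γ p) b
  have hψ : ContDiff ℝ ∞ ψ :=
    ((hh.fderiv_right (m := ∞) (by simp)).comp hγ).clm_apply contDiff_const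
  refine ⟨fun x => ∫ θ in (0 : ℝ)..1, ψ (x, θ), contDiff_intervalIntegral hψ, fun x => ?_⟩
  have hderiv : ∀ θ ∈ Set.uIcc (0 : ℝ) 1,
      HasDerivAt (fun θ => h (γ (x, θ))) ((u x - c) • ψ (x, θ)) θ := by
    intro θ _
    have hγ' : HasDerivAt (fun θ : ℝ => γ (x, θ)) ((u x - c) • b) θ := by
      simpa only [one_smul, id_eq] using
        ((hasDerivAt_id θ).smul_const ((u x - c) • b)).const_add (x - (u x - c) • b)
    have hhd := (hh.differentiable (by simp)).differentiableAt (x := γ (x, θ))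
    rw [← map_smul]
    exact hhd.hasFDerivAt.comp_hasDerivAt θ hγ'
  have hcont : Continuous fun θ => (u x - c) • ψ (x, θ) :=
    (hψ.continuous.comp (by fun_prop)).const_smul _
  have hint := intervalIntegral.integral_eq_sub_of_hasDerivAt hderiv
    (hcont.intervalIntegrable 0 1)
  rw [intervalIntegral.integral_smul] at hint
  simpa [γ] using hint.symm

theorem exists_contDiff_eventually_sub_eq_smul [CompleteSpace E] [FiniteDimensional ℝ V]
    {h : V → E} {x : V} (hh : ∀ᶠ x' in 𝓝 x, ContDiffAt ℝ ∞ h x') (u : StrongDual ℝ V) (b : V) :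
    ∃ r : V → E, ContDiff ℝ ∞ r ∧
      ∀ᶠ x' in 𝓝 x, h x' - h (x' - (u x' - u x) • b) = (u x' - u x) • r x' := by
  obtain ⟨H, hH, hhH⟩ := exists_contDiff_eventuallyEq hh
  obtain ⟨r, hr, hHr⟩ := exists_contDiff_sub_eq_smul hH u b (u x)
  have hproj : Continuous fun x' : V => x' - (u x' - u x) • b := by fun_prop
  have hprojt := hproj.tendsto x
  rw [sub_self, zero_smul, sub_zero] at hprojt
  refine ⟨r, hr, ?_⟩
  filter_upwards [hhH, hprojt.eventually hhH] with x' h1 h2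
  rw [h1, h2, hHr]

theorem exists_analyticAt_sub_eq_mul {F : ℂ → ℂ} {z₀ : ℂ} (hF : AnalyticAt ℂ F z₀)
    (hF0 : F z₀ = 0) (hF' : deriv F z₀ ≠ 0) :
    ∃ G : ℂ → ℂ, AnalyticAt ℂ G z₀ ∧ ∀ᶠ z in 𝓝 z₀, z - z₀ = F z * G z := by
  obtain ⟨p, hp⟩ := hF
  have hG : AnalyticAt ℂ (dslope F z₀) z₀ := hp.has_fpower_series_dslope_fslope.analyticAt
  have hG0 : dslope F z₀ z₀ ≠ 0 := by rwa [dslope_same]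
  refine ⟨fun z => (dslope F z₀ z)⁻¹, hG.inv hG0, ?_⟩
  filter_upwards [hG.continuousAt.eventually_ne hG0] with z hz
  have hFz : (z - z₀) * dslope F z₀ z = F z := by
    simpa only [hF0, sub_zero, smul_eq_mul] using sub_smul_dslope F z₀ z
  rw [← hFz, mul_inv_cancel_right₀ hz]

theorem exists_sub_eq_one_sub_exp_mul {x : V} (u : StrongDual ℝ V) (n : ℤ) (hu : u x = n) :
    ∃ w : V → ℂ, (∀ᶠ x' in 𝓝 x, ContDiffAt ℝ ∞ w x') ∧ ∀ᶠ x' in 𝓝 x,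
      (u x' - n : ℝ) = (1 - Complex.exp (2 * Real.pi * Complex.I * (u x' : ℝ))) * w x' := by
  let F : ℂ → ℂ := fun z => 1 - Complex.exp (2 * Real.pi * Complex.I * z)
  have hderiv : HasDerivAt F (-(Complex.exp (2 * Real.pi * Complex.I * 0) *
      (2 * Real.pi * Complex.I * 1))) 0 :=
    (((hasDerivAt_id (0 : ℂ)).const_mul (2 * Real.pi * Complex.I)).cexp).const_sub 1
  obtain ⟨G, hG, hFG⟩ := exists_analyticAt_sub_eq_mul (F := F) (z₀ := 0) (by fun_prop)
    (by simp [F]) (by rw [hderiv.deriv]; simp [Real.pi_ne_zero])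
  let ι : V → ℂ := fun x' => ((u x' - n : ℝ) : ℂ)
  have hι : ContDiff ℝ ∞ ι :=
    Complex.ofRealCLM.contDiff.comp (u.contDiff.sub contDiff_const)
  have hιt : Filter.Tendsto ι (𝓝 x) (𝓝 0) := by
    simpa [ι, hu] using hι.continuous.tendsto x
  refine ⟨G ∘ ι, ?_, ?_⟩
  · filter_upwards [hιt.eventually hG.eventually_analyticAt] with x' hx'
    exact (hx'.contDiffAt.restrict_scalars ℝ).comp x' hι.contDiffAt
  · filter_upwards [hιt.eventually hFG] with x' hx'
    have hperiod : Complex.exp (2 * Real.pi * Complex.I * (u x' : ℝ)) =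
        Complex.exp (2 * Real.pi * Complex.I * ι x') :=
      Complex.exp_eq_exp_iff_exists_int.2 ⟨n, by simp only [ι]; push_cast; ring⟩
    rw [hperiod]
    exact (sub_zero _).symm.trans hx'

end Analysis

section Base

variable {V : Type} [NormedAddCommGroup V] {Λ : Submodule ℤ V}

/-- The covering `V → V / Λ`. -/
def torusMk (Λ : Submodule ℤ V) (x : V) : Torus Λ := Submodule.Quotient.mk x

theorem continuous_torusMk : Continuous (torusMk Λ) := continuous_quot_mk

theorem isOpenMap_torusMk : IsOpenMap (torusMk Λ) :=
  QuotientAddGroup.isOpenMap_coe (N := Λ.toAddSubgroup)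

theorem torusMk_surjective : Function.Surjective (torusMk Λ) := Submodule.Quotient.mk_surjective Λ

theorem torusMk_eq_iff {x y : V} : torusMk Λ x = torusMk Λ y ↔ x - y ∈ Λ :=
  Submodule.Quotient.eq Λ

theorem eventually_torusMk {x : V} {R : Torus Λ → Prop} :
    (∀ᶠ t in 𝓝 (torusMk Λ x), R t) ↔ ∀ᶠ x' in 𝓝 x, R (torusMk Λ x') :=
  ⟨fun h => (continuous_torusMk.tendsto x).eventually h, fun h => isOpenMap_torusMk.nhds_le x h⟩

theorem exists_local_section [DiscreteTopology Λ] (x : V) :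
    ∃ s : Torus Λ → V, ∀ᶠ x' in 𝓝 x, s (torusMk Λ x') = x' := by
  classical
  obtain ⟨r, hr, hΛ⟩ := Metric.exists_ball_inter_eq_singleton_of_mem_discrete
    (s := (Λ : Set V)) (isDiscrete_iff_discreteTopology.2 ‹_›) (zero_mem Λ)
  let s : Torus Λ → V := fun t =>
    if ht : ∃ y ∈ Metric.ball x (r / 2), torusMk Λ y = t then ht.choose else x
  refine ⟨s, ?_⟩
  filter_upwards [Metric.ball_mem_nhds x (half_pos hr)] with x' hx'
  have ht : ∃ y ∈ Metric.ball x (r / 2), torusMk Λ y = torusMk Λ x' := ⟨x', hx', rfl⟩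
  have hs : s (torusMk Λ x') = ht.choose := dif_pos ht
  have hball : ht.choose - x' ∈ Metric.ball (0 : V) r := by
    have h1 := ht.choose_spec.1
    rw [Metric.mem_ball] at h1 hx'
    rw [mem_ball_zero_iff, ← dist_eq_norm]
    linarith [dist_triangle_right ht.choose x' x]
  have hzero : ht.choose - x' ∈ ({0} : Set V) :=
    hΛ ▸ ⟨hball, torusMk_eq_iff.1 ht.choose_spec.2⟩
  rw [hs, sub_eq_zero.1 hzero]

variable [NormedSpace ℝ V]

/-- The functions on the torus that near `x` are a smooth function restricted to `A` and extended
by zero. -/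
def SmoothAt (A : Set (Torus Λ)) (f : Torus Λ → ℂ) (x : V) : Prop :=
  ∃ h : V → ℂ, (∀ᶠ x' in 𝓝 x, ContDiffAt ℝ ∞ h x') ∧
    ∀ᶠ x' in 𝓝 x, f (torusMk Λ x') = A.indicator 1 (torusMk Λ x') * h x'

theorem SmoothAt.of_torusMk_eq {A : Set (Torus Λ)} {f : Torus Λ → ℂ} {x y : V}
    (hf : SmoothAt A f x) (hxy : torusMk Λ x = torusMk Λ y) : SmoothAt A f y := by
  obtain ⟨h, hh, hf⟩ := hf
  have hc : ContDiff ℝ ∞ fun v : V => v + (x - y) := contDiff_id.add contDiff_const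
  have ht := hc.continuous.tendsto y
  rw [add_sub_cancel] at ht
  refine ⟨fun v => h (v + (x - y)), ?_, ?_⟩
  · filter_upwards [ht.eventually hh] with v hv
    exact ContDiffAt.comp v hv hc.contDiffAt
  · filter_upwards [ht.eventually hf] with v hv
    have : torusMk Λ (v + (x - y)) = torusMk Λ v :=
      torusMk_eq_iff.2 (by simpa using torusMk_eq_iff.1 hxy)
    rwa [this] at hv

/-- The local condition of being smooth along `A` and zero elsewhere. -/
def smoothOn (A : Set (Torus Λ)) : FunctionCondition ℂ (Torus Λ) where
  germs t :=
    { carrier := {f | ∀ x, torusMk Λ x = t → SmoothAt A f x}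
      add_mem' := by
        intro f g hf hg x hx
        obtain ⟨h, hh, hf⟩ := hf x hx
        obtain ⟨h', hh', hg⟩ := hg x hx
        refine ⟨h + h', ?_, ?_⟩
        · filter_upwards [hh, hh'] with x' h1 h2
          exact h1.add h2
        · filter_upwards [hf, hg] with p' h1 h2
          simp [mul_add, h1, h2]
      zero_mem' := fun p _ => ⟨0, Filter.Eventually.of_forall fun _ => contDiffAt_const, by simp⟩
      smul_mem' := by
        intro c f hf x hx
        obtain ⟨h, hh, hf⟩ := hf x hx
        refine ⟨c • h, ?_, ?_⟩
        · filter_upwards [hh] with x' h1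
          exact contDiffAt_const.smul h1
        filter_upwards [hf] with p' h1
        simp only [Pi.smul_apply, smul_eq_mul, h1]
        ring }
  congr_germ := by
    rintro t f f' hff hf x rfl
    obtain ⟨h, hh, hf⟩ := hf x rfl
    refine ⟨h, hh, ?_⟩
    filter_upwards [hf, eventually_torusMk.1 hff] with x' h1 h2
    rw [← h1, show f (torusMk Λ x') = f' (torusMk Λ x') from h2 _ rfl]
  eventually_mem := by
    intro t f hf
    obtain ⟨x, rfl⟩ := torusMk_surjective t
    rw [eventually_torusMk]
    obtain ⟨h, hh, hf⟩ := hf x rfl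
    filter_upwards [hh.eventually_nhds, hf.eventually_nhds] with x' h1 h2 x'' hx
    exact SmoothAt.of_torusMk_eq ⟨h, h1, h2⟩ hx.symm

theorem mem_smoothOn {A : Set (Torus Λ)} {f : Torus Λ → ℂ} {x : V} :
    f ∈ (smoothOn A).germs (torusMk Λ x) ↔ SmoothAt A f x :=
  ⟨fun h => h x rfl, fun h _ hx => h.of_torusMk_eq hx.symm⟩

theorem exists_mem_smoothOn [DiscreteTopology Λ] (A : Set (Torus Λ)) {h : V → ℂ} {x : V}
    (hh : ∀ᶠ x' in 𝓝 x, ContDiffAt ℝ ∞ h x') : ∃ f ∈ (smoothOn A).germs (torusMk Λ x),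
      ∀ᶠ x' in 𝓝 x, f (torusMk Λ x') = A.indicator 1 (torusMk Λ x') * h x' := by
  obtain ⟨s, hs⟩ := exists_local_section (Λ := Λ) x
  have : ∀ᶠ x' in 𝓝 x, (fun t => A.indicator 1 t * h (s t)) (torusMk Λ x') =
      A.indicator 1 (torusMk Λ x') * h x' := by
    filter_upwards [hs] with x' hx'
    simp only [hx']
  exact ⟨fun t => A.indicator 1 t * h (s t), mem_smoothOn.2 ⟨h, hh, this⟩, this⟩

theorem mul_mem_smoothOn {A : Set (Torus Λ)} {a f : Torus Λ → ℂ} {x : V}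
    (ha : ∀ᶠ x' in 𝓝 x, ContDiffAt ℝ ∞ (fun v => a (torusMk Λ v)) x')
    (hf : f ∈ (smoothOn A).germs (torusMk Λ x)) :
    (fun t => a t * f t) ∈ (smoothOn A).germs (torusMk Λ x) := by
  obtain ⟨h, hh, hf⟩ := hf x rfl
  refine mem_smoothOn.2 ⟨fun x => a (torusMk Λ x) * h x, ?_, ?_⟩
  · filter_upwards [ha, hh] with x' h1 h2
    exact h1.mul h2
  · filter_upwards [hf] with x' h1
    rw [h1, mul_left_comm]

theorem indicator_mul_mem_smoothOn {A : Set (Torus Λ)} (A' : Set (Torus Λ)) {f : Torus Λ → ℂ}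
    {t : Torus Λ} (hf : f ∈ (smoothOn A).germs t) :
    (fun t => A'.indicator 1 t * f t) ∈ (smoothOn (A ∩ A')).germs t := by
  rintro x rfl
  obtain ⟨h, hh, hf⟩ := hf x rfl
  refine ⟨h, hh, ?_⟩
  filter_upwards [hf] with x' h1
  rw [h1, ← mul_assoc, Set.inter_comm, Set.inter_indicator_one, Pi.mul_apply]

theorem exists_indicator_mul_eq_of_mem_smoothOn_inter [DiscreteTopology Λ]
    {A A' : Set (Torus Λ)} {f : Torus Λ → ℂ} {t : Torus Λ}
    (hf : f ∈ (smoothOn (A ∩ A')).germs t) :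
    ∃ f' ∈ (smoothOn A).germs t, ∀ᶠ t' in 𝓝 t, A'.indicator 1 t' * f' t' = f t' := by
  obtain ⟨x, rfl⟩ := torusMk_surjective t
  obtain ⟨h, hh, hf⟩ := hf x rfl
  obtain ⟨f', hf', hfe⟩ := exists_mem_smoothOn A hh
  refine ⟨f', hf', eventually_torusMk.2 ?_⟩
  filter_upwards [hf, hfe] with x' h1 h2
  rw [h1, h2, ← mul_assoc, Set.inter_comm, Set.inter_indicator_one, Pi.mul_apply]

theorem exists_mul_eq_of_mem_smoothOn {A : Set (Torus Λ)} {a f : Torus Λ → ℂ} {t : Torus Λ}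
    (ha : ContDiff ℝ ∞ fun x => a (torusMk Λ x)) (hat : a t ≠ 0)
    (hf : f ∈ (smoothOn A).germs t) :
    ∃ f' ∈ (smoothOn A).germs t, ∀ᶠ t' in 𝓝 t, a t' * f' t' = f t' := by
  obtain ⟨x, rfl⟩ := torusMk_surjective t
  have hne : ∀ᶠ x' in 𝓝 x, a (torusMk Λ x') ≠ 0 := ha.continuous.continuousAt.eventually_ne hat
  refine ⟨fun t => (a t)⁻¹ * f t, mul_mem_smoothOn ?_ hf, eventually_torusMk.2 ?_⟩
  · filter_upwards [hne] with x' h1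
    exact ha.contDiffAt.inv h1
  · filter_upwards [hne] with x' h1
    exact mul_inv_cancel_left₀ h1 _

/-- A basis `b` of the lattice `Λ` and the dual basis `u`. Both are indexed by `ℕ`, with meaningful
values at the indices `k < g` only, so that recursions over the coordinates avoid `Fin g`. -/
structure LatticeFrame (Λ : Submodule ℤ V) (g : ℕ) where
  u : ℕ → StrongDual ℝ V
  b : ℕ → V
  integral : ∀ k, ∀ l ∈ Λ, ∃ n : ℤ, u k l = n
  u_b : ∀ k < g, ∀ j, u j (b k) = if j = k then 1 else 0
  b_mem : ∀ k, b k ∈ Λ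
  expand : ∀ x, x = ∑ k ∈ Finset.range g, u k x • b k

theorem exists_latticeFrame [FiniteDimensional ℝ V] (Λ : Submodule ℤ V) [DiscreteTopology Λ]
    [IsZLattice ℝ Λ] : Nonempty (LatticeFrame Λ (Module.finrank ℝ V)) := by
  classical
  have : Module.Finite ℤ Λ := ZLattice.module_finite ℝ Λ
  have : Module.Free ℤ Λ := ZLattice.module_free ℝ Λ
  let β := Module.finBasisOfFinrankEq ℤ Λ (ZLattice.rank ℝ Λ)
  let B := β.ofZLatticeBasis ℝ Λ
  let g := Module.finrank ℝ V
  have hB : ∀ i, B i = β i := fun i => β.ofZLatticeBasis_apply ℝ Λ i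
  refine ⟨⟨fun k => if h : k < g then LinearMap.toContinuousLinearMap (B.coord ⟨k, h⟩) else 0,
    fun k => if h : k < g then B ⟨k, h⟩ else 0, ?_, ?_, ?_, ?_⟩⟩
  · intro k l hl
    by_cases h : k < g
    · refine ⟨β.repr ⟨l, hl⟩ ⟨k, h⟩, ?_⟩
      simp only [h, dite_true]
      exact β.ofZLatticeBasis_repr_apply ℝ Λ ⟨l, hl⟩ ⟨k, h⟩
    · exact ⟨0, by simp [h]⟩
  · intro k hk j
    have hk' : k < g := hk
    by_cases h : j < g
    · simp only [h, hk', dite_true]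
      change B.repr (B ⟨k, hk⟩) ⟨j, h⟩ = _
      rw [B.repr_self, Finsupp.single_apply]
      simp [Fin.ext_iff, eq_comm]
    · have : j ≠ k := by rintro rfl; exact h hk
      simp [h, this]
  · intro k
    by_cases h : k < g
    · simp only [h, dite_true, hB]
      exact (β ⟨k, h⟩).2
    · simp [h]
  · intro x
    rw [← Fin.sum_univ_eq_sum_range (fun k => (if h : k < g then
      LinearMap.toContinuousLinearMap (B.coord ⟨k, h⟩) else 0 : StrongDual ℝ V) x •
        (if h : k < g then B ⟨k, h⟩ else 0))]
    conv_lhs => rw [← B.sum_repr x]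
    refine Finset.sum_congr rfl fun i _ => ?_
    simp [g]

namespace LatticeFrame

variable {g : ℕ} (B : LatticeFrame Λ g)

/-- The character `exp (2πi x_k)` of the torus. -/
def e (k : ℕ) (t : Torus Λ) : ℂ :=
  Complex.exp (2 * Real.pi * Complex.I * (B.u k (Function.surjInv torusMk_surjective t) : ℝ))

theorem e_torusMk (k : ℕ) (x : V) :
    B.e k (torusMk Λ x) = Complex.exp (2 * Real.pi * Complex.I * (B.u k x : ℝ)) := by
  have h := Function.surjInv_eq (torusMk_surjective (Λ := Λ)) (torusMk Λ x)
  obtain ⟨n, hn⟩ := B.integral k _ (torusMk_eq_iff.1 h)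
  rw [e, Complex.exp_eq_exp_iff_exists_int]
  refine ⟨n, ?_⟩
  rw [map_sub, sub_eq_iff_eq_add] at hn
  rw [hn]
  push_cast
  ring

theorem e_eq_one_iff (k : ℕ) (x : V) : B.e k (torusMk Λ x) = 1 ↔ ∃ n : ℤ, B.u k x = n := by
  rw [e_torusMk, Complex.exp_eq_one_iff]
  refine exists_congr fun n => ?_
  have h : (2 * Real.pi * Complex.I : ℂ) ≠ 0 := Complex.two_pi_I_ne_zero
  rw [mul_comm (n : ℂ), mul_right_inj' h]
  exact_mod_cast Iff.rfl

theorem contDiff_e (k : ℕ) : ContDiff ℝ ∞ fun x => B.e k (torusMk Λ x) := by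
  simp only [e_torusMk]
  exact (contDiff_const.mul (Complex.ofRealCLM.contDiff.comp (B.u k).contDiff)).cexp

theorem contDiff_one_sub_e (k : ℕ) : ContDiff ℝ ∞ fun x => 1 - B.e k (torusMk Λ x) :=
  contDiff_const.sub (B.contDiff_e k)

theorem e_ne_zero (k : ℕ) (t : Torus Λ) : B.e k t ≠ 0 := Complex.exp_ne_zero _

theorem isMultiplier (A : Set (Torus Λ)) (k : ℕ) : IsMultiplier (smoothOn A) (B.e k) where
  ne_zero := B.e_ne_zero k
  mul_mem {t _} hf := by
    obtain ⟨x, rfl⟩ := torusMk_surjective t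
    exact mul_mem_smoothOn (.of_forall fun _ => (B.contDiff_e k).contDiffAt) hf
  inv_mul_mem {t _} hf := by
    obtain ⟨x, rfl⟩ := torusMk_surjective t
    exact mul_mem_smoothOn (a := fun t => (B.e k t)⁻¹)
      (.of_forall fun _ => (B.contDiff_e k).contDiffAt.inv (B.e_ne_zero k _)) hf

theorem eventually_e_add_smul_ne_one {k : ℕ} (hk : k < g) (x : V) :
    ∀ᶠ r in 𝓝[>] (0 : ℝ), B.e k (torusMk Λ (x + r • B.b k)) ≠ 1 := by
  have hlt : (0 : ℝ) < ⌊B.u k x⌋ + 1 - B.u k x := sub_pos.2 (Int.lt_floor_add_one _)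
  filter_upwards [Ioo_mem_nhdsGT hlt] with r hr he
  obtain ⟨n, hn⟩ := (B.e_eq_one_iff k _).1 he
  rw [map_add, map_smul, B.u_b k hk, if_pos rfl, smul_eq_mul, mul_one] at hn
  have hfloor := Int.floor_le (B.u k x)
  have hn_gt : ⌊B.u k x⌋ < n := by
    have : (⌊B.u k x⌋ : ℝ) < n := by linarith [hr.1]
    exact_mod_cast this
  have hn_lt : n < ⌊B.u k x⌋ + 1 := by
    have : (n : ℝ) < ⌊B.u k x⌋ + 1 := by linarith [hr.2]
    exact_mod_cast this
  lia

theorem eq_zero_of_eventually_one_sub_e_mul_eq_zero {k : ℕ} (hk : k < g) {A : Set (Torus Λ)}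
    (hA : ∀ (x : V) (r : ℝ), torusMk Λ x ∈ A → torusMk Λ (x + r • B.b k) ∈ A) {t : Torus Λ}
    {f : Torus Λ → ℂ} (hf : f ∈ (smoothOn A).germs t)
    (h0 : ∀ᶠ t' in 𝓝 t, (1 - B.e k t') * f t' = 0) : f t = 0 := by
  obtain ⟨x, rfl⟩ := torusMk_surjective t
  obtain ⟨h, hh, hf⟩ := hf x rfl
  by_cases hx : torusMk Λ x ∈ A
  · have hline : Filter.Tendsto (fun r : ℝ => x + r • B.b k) (𝓝[>] 0) (𝓝 x) := by
      have hc : Continuous fun r : ℝ => x + r • B.b k := by fun_prop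
      simpa using (hc.tendsto 0).mono_left nhdsWithin_le_nhds
    have hz : ∀ᶠ r in 𝓝[>] (0 : ℝ), h (x + r • B.b k) = 0 := by
      filter_upwards [B.eventually_e_add_smul_ne_one hk x,
        hline.eventually (eventually_torusMk.1 h0), hline.eventually hf] with r h1 h2 h3
      rw [Set.indicator_of_mem (hA x r hx), Pi.one_apply, one_mul] at h3
      rw [← h3]
      exact (mul_eq_zero.1 h2).resolve_left (sub_ne_zero.2 h1.symm)
    have hlim : Filter.Tendsto (fun r => h (x + r • B.b k)) (𝓝[>] (0 : ℝ)) (𝓝 (h x)) :=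
      hh.self_of_nhds.continuousAt.tendsto.comp hline
    have hhx : h x = 0 := tendsto_nhds_unique hlim ((Filter.tendsto_congr' hz).2 tendsto_const_nhds)
    rw [hf.self_of_nhds, hhx, mul_zero]
  · rw [hf.self_of_nhds, Set.indicator_of_notMem hx, zero_mul]

/-- A function vanishing on the hypersurface `u k = n` is divisible by `u k - n` by Hadamard's
lemma, and `u k - n` is divisible by `1 - e k`. -/
theorem exists_one_sub_e_mul_eq_of_vanishing [FiniteDimensional ℝ V] {k : ℕ} {x : V} {n : ℤ}
    (hx : B.u k x = n) {h : V → ℂ} (hh : ∀ᶠ x' in 𝓝 x, ContDiffAt ℝ ∞ h x') :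
    ∃ q : V → ℂ, (∀ᶠ x' in 𝓝 x, ContDiffAt ℝ ∞ q x') ∧ ∀ᶠ x' in 𝓝 x,
      h (x' - (B.u k x' - n) • B.b k) = 0 → (1 - B.e k (torusMk Λ x')) * q x' = h x' := by
  obtain ⟨r, hr, hrh⟩ := exists_contDiff_eventually_sub_eq_smul hh (B.u k) (B.b k)
  obtain ⟨w, hw, hwu⟩ := exists_sub_eq_one_sub_exp_mul (B.u k) n hx
  refine ⟨fun x => w x * r x, hw.mono fun x' h1 => h1.mul hr.contDiffAt, ?_⟩
  filter_upwards [hrh, hwu] with x' h1 h2 h3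
  rw [hx, h3, sub_zero, Complex.real_smul, h2] at h1
  rw [e_torusMk, h1]
  exact (mul_assoc _ _ _).symm

theorem exists_one_sub_e_mul_eq [FiniteDimensional ℝ V] [DiscreteTopology Λ] {k : ℕ} (hk : k < g)
    {A : Set (Torus Λ)} (hA : ∀ (x : V) (r : ℝ), torusMk Λ x ∈ A → torusMk Λ (x + r • B.b k) ∈ A)
    {t : Torus Λ} (ht : B.e k t = 1) {f : Torus Λ → ℂ} (hf : f ∈ (smoothOn A).germs t)
    (h0 : ∀ᶠ t' in 𝓝 t, {t | B.e k t = 1}.indicator 1 t' * f t' = 0) :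
    ∃ f' ∈ (smoothOn A).germs t, ∀ᶠ t' in 𝓝 t, (1 - B.e k t') * f' t' = f t' := by
  obtain ⟨x, rfl⟩ := torusMk_surjective t
  obtain ⟨h, hh, hf⟩ := hf x rfl
  obtain ⟨n, hn⟩ := (B.e_eq_one_iff k x).1 ht
  obtain ⟨q, hq, hqh⟩ := B.exists_one_sub_e_mul_eq_of_vanishing hn hh
  obtain ⟨f', hf', hfq⟩ := exists_mem_smoothOn A hq
  refine ⟨f', hf', eventually_torusMk.2 ?_⟩
  have hproj : Filter.Tendsto (fun x' : V => x' - (B.u k x' - n) • B.b k) (𝓝 x) (𝓝 x) := by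
    have hc : Continuous fun x' : V => x' - (B.u k x' - n) • B.b k := by fun_prop
    simpa [hn] using hc.tendsto x
  filter_upwards [hf, hqh, hfq, hproj.eventually (eventually_torusMk.1 h0), hproj.eventually hf]
    with x' hfx hqx hf'x h0x hfproj
  rw [hfx, hf'x]
  by_cases hxA : torusMk Λ x' ∈ A
  · have hprojA : torusMk Λ (x' - (B.u k x' - n) • B.b k) ∈ A := by
      simpa only [neg_smul, ← sub_eq_add_neg] using hA x' (-(B.u k x' - n)) hxA
    have hproj1 : B.e k (torusMk Λ (x' - (B.u k x' - n) • B.b k)) = 1 := by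
      rw [e_eq_one_iff]
      exact ⟨n, by simp [B.u_b k hk]⟩
    rw [Set.indicator_of_mem (by exact hproj1), Pi.one_apply, one_mul, hfproj,
      Set.indicator_of_mem hprojA, Pi.one_apply, one_mul] at h0x
    rw [Set.indicator_of_mem hxA, Pi.one_apply, one_mul, one_mul, hqx h0x]
  · simp [Set.indicator_of_notMem hxA]

theorem isMulShortExact [FiniteDimensional ℝ V] [DiscreteTopology Λ] {k : ℕ} (hk : k < g)
    {A : Set (Torus Λ)}
    (hA : ∀ (x : V) (r : ℝ), torusMk Λ x ∈ A → torusMk Λ (x + r • B.b k) ∈ A) :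
    IsMulShortExact (smoothOn A) (smoothOn (A ∩ {t | B.e k t = 1})) (fun t => 1 - B.e k t)
      ({t | B.e k t = 1}.indicator 1) where
  mul_mem {t _} hf := by
    obtain ⟨x, rfl⟩ := torusMk_surjective t
    exact mul_mem_smoothOn (a := fun t => 1 - B.e k t)
      (.of_forall fun _ => (B.contDiff_one_sub_e k).contDiffAt) hf
  quot_mem hf := indicator_mul_mem_smoothOn _ hf
  quot_mul t := by
    by_cases h : B.e k t = 1
    · simp [h]
    · rw [Set.indicator_of_notMem (by exact h), zero_mul]
  injective hf h0 := B.eq_zero_of_eventually_one_sub_e_mul_eq_zero hk hA hf h0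
  exact {t _} hf h0 := by
    by_cases ht : B.e k t = 1
    · exact B.exists_one_sub_e_mul_eq hk hA ht hf h0
    · exact exists_mul_eq_of_mem_smoothOn (B.contDiff_one_sub_e k) (sub_ne_zero.2 (Ne.symm ht)) hf
  surjective hf := exists_indicator_mul_eq_of_mem_smoothOn_inter hf

/-- The points of the torus whose coordinates `x_j`, `k ≤ j < g`, are integral. -/
def stratum (k : ℕ) : Set (Torus Λ) := {t | ∀ j, k ≤ j → j < g → B.e j t = 1}

theorem stratum_eq_inter {k : ℕ} (hk : k < g) :
    B.stratum k = B.stratum (k + 1) ∩ {t | B.e k t = 1} := by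
  ext t
  constructor
  · exact fun h => ⟨fun j hj hj' => h j (by omega) hj', h k le_rfl hk⟩
  · rintro ⟨h, h'⟩ j hj hj'
    rcases hj.eq_or_lt with rfl | hlt
    · exact h'
    · exact h j hlt hj'

theorem add_mem_stratum {k : ℕ} (hk : k < g) (x : V) (r : ℝ)
    (hx : torusMk Λ x ∈ B.stratum (k + 1)) : torusMk Λ (x + r • B.b k) ∈ B.stratum (k + 1) := by
  intro j hj hj'
  have h := hx j hj hj'
  rw [e_torusMk] at h ⊢
  rwa [map_add, map_smul, B.u_b k hk, if_neg (by omega), smul_zero, add_zero]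

theorem stratum_self : B.stratum g = Set.univ :=
  Set.eq_univ_of_forall fun _ _ h h' => absurd h' (not_lt.2 h)

theorem stratum_zero : B.stratum 0 = {torusMk Λ 0} := by
  ext t
  obtain ⟨x, rfl⟩ := torusMk_surjective t
  constructor
  · intro h
    rw [Set.mem_singleton_iff, torusMk_eq_iff, sub_zero, B.expand x]
    refine sum_mem fun k hk => ?_
    obtain ⟨n, hn⟩ := (B.e_eq_one_iff k x).1 (h k (Nat.zero_le _) (Finset.mem_range.1 hk))
    rw [hn, Int.cast_smul_eq_zsmul]
    exact Submodule.smul_mem _ _ (B.b_mem k)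
  · intro h j _ _
    rw [Set.mem_singleton_iff] at h
    rw [h, e_eq_one_iff]
    exact ⟨0, by simp⟩

theorem isMulShortExact_stratum [FiniteDimensional ℝ V] [DiscreteTopology Λ] {k : ℕ}
    (hk : k < g) :
    IsMulShortExact (smoothOn (B.stratum (k + 1))) (smoothOn (B.stratum k))
      (fun t => 1 - B.e k t) ({t | B.e k t = 1}.indicator 1) := by
  rw [B.stratum_eq_inter hk]
  exact B.isMulShortExact hk (B.add_mem_stratum hk)

end LatticeFrame

end Base

section Tower

open Limits

variable {k : Type} [Field k] (Z : TopCat.{0})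

/-- The product of `Z` and `n` circles, built one circle at a time. -/
def tower : ℕ → TopCat.{0}
  | 0 => Z
  | n + 1 => prodCirc (tower n)

/-- The projection of the tower over `Z` to `Z`. -/
def towerMap : ∀ n, tower Z n ⟶ Z
  | 0 => 𝟙 _
  | n + 1 => prodFst (tower Z n) ≫ towerMap n

theorem t2Space_tower [T2Space Z] : ∀ n, T2Space (tower Z n)
  | 0 => inferInstanceAs (T2Space Z)
  | n + 1 =>
    have := t2Space_tower n
    inferInstanceAs (T2Space (tower Z n × Circ))

variable {Z}

/-- The iterated twist of `N`, the `n`-th circle being twisted by `e n`, bundled with the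
multiplier property that the next twist needs. -/
def iteratedTwistData (N : FunctionCondition k Z) {e : ℕ → Z → k}
    (he : ∀ j, IsMultiplier N (e j)) :
    ∀ n, {N' : FunctionCondition k (tower Z n) //
      ∀ j, IsMultiplier N' fun x => e j (towerMap Z n x)}
  | 0 => ⟨N, he⟩
  | n + 1 => ⟨twist (iteratedTwistData N he n).1 ((iteratedTwistData N he n).2 n),
      fun j => ((iteratedTwistData N he n).2 n).twist ((iteratedTwistData N he n).2 j)⟩

/-- The iterated twist of `N` over the tower, the `n`-th circle being twisted by `e n`. -/
def iteratedTwist (N : FunctionCondition k Z) {e : ℕ → Z → k} (he : ∀ j, IsMultiplier N (e j))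
    (n : ℕ) : FunctionCondition k (tower Z n) := (iteratedTwistData N he n).1

theorem isMultiplier_iteratedTwist (N : FunctionCondition k Z) {e : ℕ → Z → k}
    (he : ∀ j, IsMultiplier N (e j)) (n j : ℕ) :
    IsMultiplier (iteratedTwist N he n) fun x => e j (towerMap Z n x) :=
  (iteratedTwistData N he n).2 j

theorem IsMulShortExact.iteratedTwist {N M : FunctionCondition k Z} {a σ : Z → k}
    (h : IsMulShortExact N M a σ) {e : ℕ → Z → k} (he : ∀ j, IsMultiplier N (e j))
    (he' : ∀ j, IsMultiplier M (e j)) (n : ℕ) :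
    IsMulShortExact (PoincareTorus.iteratedTwist N he n) (PoincareTorus.iteratedTwist M he' n)
      (fun x => a (towerMap Z n x)) (fun x => σ (towerMap Z n x)) := by
  induction n with
  | zero => exact h
  | succ n ih =>
    exact ih.twist (isMultiplier_iteratedTwist N he n n) (isMultiplier_iteratedTwist M he' n n)

variable {E : Type*} [Category E]

/-- The functor `Q ∘ p_*` for the projection `p` of the tower to `Z`, with `p_*` factored into the
pushforwards along the single circles. -/
def towerFunctor (Q : Sh k Z ⥤ E) : ∀ n, Sh k (tower Z n) ⥤ E
  | 0 => Q
  | n + 1 => TopCat.Sheaf.pushforward (ModuleCat.{0} k) (prodFst (tower Z n)) ⋙ towerFunctor Q n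

/-- `towerFunctor Q n` is the pushforward along `towerMap` followed by `Q`. -/
def towerFunctorIso (Q : Sh k Z ⥤ E) : ∀ n,
    towerFunctor Q n ≅ TopCat.Sheaf.pushforward (ModuleCat.{0} k) (towerMap Z n) ⋙ Q
  | 0 => Q.leftUnitor.symm ≪≫ Functor.isoWhiskerRight (Iso.refl _) Q
  | n + 1 => Functor.isoWhiskerLeft _ (towerFunctorIso Q n) ≪≫ (Functor.associator _ _ _).symm ≪≫
      Functor.isoWhiskerRight (Iso.refl _) Q

variable [Abelian E] (Q : Sh k Z ⥤ E) [Q.Additive] [PreservesFiniteLimits Q]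

instance additive_towerFunctor : ∀ n, (towerFunctor Q n).Additive
  | 0 => inferInstanceAs Q.Additive
  | n + 1 =>
    have := additive_towerFunctor n
    inferInstanceAs (TopCat.Sheaf.pushforward (ModuleCat.{0} k) (prodFst (tower Z n)) ⋙
      towerFunctor Q n).Additive

instance preservesFiniteLimits_towerFunctor : ∀ n, PreservesFiniteLimits (towerFunctor Q n)
  | 0 => inferInstanceAs (PreservesFiniteLimits Q)
  | n + 1 =>
    have := preservesFiniteLimits_towerFunctor n
    inferInstanceAs (PreservesFiniteLimits
      (TopCat.Sheaf.pushforward (ModuleCat.{0} k) (prodFst (tower Z n)) ⋙ towerFunctor Q n))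

/-- Each circle shifts the degree by one and replaces `N (n + 1)` by the cokernel `N n` of
`1 - e n`, so the derived functors are concentrated in the degree equal to the number of circles. -/
theorem rightDerived_towerFunctor [T2Space Z] {N : ℕ → FunctionCondition k Z}
    {e σ : ℕ → Z → k} (he : ∀ i j, IsMultiplier (N i) (e j)) (n : ℕ)
    (ht : ∀ i < n, IsMulShortExact (N (i + 1)) (N i) (fun z => 1 - e i z) (σ i)) :
    (∀ j < n, IsZero (((towerFunctor Q n).rightDerived j).obj
        (iteratedTwist (N n) (he n) n).sheaf)) ∧
      Nonempty (((towerFunctor Q n).rightDerived n).obj (iteratedTwist (N n) (he n) n).sheaf ≅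
        Q.obj (N 0).sheaf) := by
  induction n with
  | zero => exact ⟨fun j hj => absurd hj (Nat.not_lt_zero j), ⟨Q.rightDerivedZeroIsoSelf.app _⟩⟩
  | succ n ih =>
    obtain ⟨hzero, ⟨htop⟩⟩ := ih fun i hi => ht i (by lia)
    have := t2Space_tower Z n
    have hmul := isMultiplier_iteratedTwist (N (n + 1)) (he (n + 1)) n n
    have hexact := (ht n (by lia)).iteratedTwist (he (n + 1)) (he n) n
    have hshift (j : ℕ) := rightDerived_succ_twist (towerFunctor Q n) hmul hexact j
    refine ⟨fun j hj => ?_, ⟨(hshift n).some ≪≫ htop⟩⟩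
    cases j with
    | zero => exact isZero_rightDerived_zero_twist (towerFunctor Q n) hmul hexact
    | succ j => exact (hzero j (by lia)).of_iso (hshift j).some

end Tower

section Coordinates

variable {V : Type} [NormedAddCommGroup V] {Λ : Submodule ℤ V}

theorem t2Space_torus [DiscreteTopology Λ] : T2Space (Torus Λ) := by
  have : DiscreteTopology Λ.toAddSubgroup := ‹DiscreteTopology Λ›
  have h : IsClosed (Λ : Set V) := AddSubgroup.isClosed_of_discrete (H := Λ.toAddSubgroup)
  have : T3Space (V ⧸ Λ) := Submodule.t3_quotient_of_isClosed Λ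
  exact inferInstanceAs (T2Space (V ⧸ Λ))

variable [NormedSpace ℝ V]

theorem compactSpace_quotient {W : Type} [NormedAddCommGroup W] [NormedSpace ℝ W]
    (L : Submodule ℤ W) {g : ℕ} {w : ℕ → W} (hw : ∀ k, w k ∈ L) {c : W → ℕ → ℝ}
    (hc : ∀ x, x = ∑ k ∈ Finset.range g, c x k • w k) : CompactSpace (W ⧸ L) := by
  let F : (ℕ → ℝ) → W ⧸ L := fun y =>
    Submodule.Quotient.mk (∑ k ∈ Finset.range g, y k • w k)
  have hF : Continuous F := by
    have h1 : Continuous fun y : ℕ → ℝ => ∑ k ∈ Finset.range g, y k • w k := by fun_prop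
    exact (continuous_quot_mk : Continuous (Quot.mk _ : W → W ⧸ L)).comp h1
  have hK : IsCompact (Set.univ.pi fun _ : ℕ => Set.Icc (0 : ℝ) 1) :=
    isCompact_univ_pi fun _ => isCompact_Icc
  refine ⟨?_⟩
  convert hK.image hF
  symm
  refine Set.eq_univ_of_forall fun q => ?_
  obtain ⟨x, rfl⟩ := Submodule.Quotient.mk_surjective L q
  refine ⟨fun k => Int.fract (c x k), fun k _ => ⟨Int.fract_nonneg _, (Int.fract_lt_one _).le⟩, ?_⟩
  refine (Submodule.Quotient.eq L).2 ?_
  have hx : ∑ k ∈ Finset.range g, Int.fract (c x k) • w k - x =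
      ∑ k ∈ Finset.range g, (Int.fract (c x k) - c x k) • w k := by
    simp only [sub_smul, Finset.sum_sub_distrib]
    rw [← hc x]
  rw [hx]
  refine sum_mem fun k _ => ?_
  rw [show Int.fract (c x k) - c x k = ((-⌊c x k⌋ : ℤ) : ℝ) by
    push_cast; linarith [Int.self_sub_floor (c x k)], Int.cast_smul_eq_zsmul]
  exact Submodule.smul_mem _ _ (hw k)

/-- The covering `V^∨ → T̂`. -/
def dualMk (Λ : Submodule ℤ V) (φ : StrongDual ℝ V) : DualTorus Λ := Submodule.Quotient.mk φ

theorem continuous_dualMk : Continuous (dualMk Λ) := continuous_quot_mk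

theorem isOpenMap_dualMk : IsOpenMap (dualMk Λ) :=
  QuotientAddGroup.isOpenMap_coe (N := (dualLattice Λ).toAddSubgroup)

theorem dualMk_surjective : Function.Surjective (dualMk Λ) :=
  Submodule.Quotient.mk_surjective (dualLattice Λ)

theorem dualMk_eq_iff {φ ψ : StrongDual ℝ V} :
    dualMk Λ φ = dualMk Λ ψ ↔ φ - ψ ∈ dualLattice Λ := Submodule.Quotient.eq _

theorem isOpenMap_cover : IsOpenMap (cover Λ) := isOpenMap_torusMk.prodMap isOpenMap_dualMk

theorem cover_surjective : Function.Surjective (cover Λ) :=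
  Function.Surjective.prodMap torusMk_surjective dualMk_surjective

theorem cover_eq_iff {v w : V × StrongDual ℝ V} :
    cover Λ v = cover Λ w ↔ v.1 - w.1 ∈ Λ ∧ v.2 - w.2 ∈ dualLattice Λ :=
  Prod.ext_iff.trans (and_congr torusMk_eq_iff dualMk_eq_iff)

namespace LatticeFrame

variable {g : ℕ} (B : LatticeFrame Λ g)

theorem u_mem (k : ℕ) : B.u k ∈ dualLattice Λ := B.integral k

theorem dual_expand (φ : StrongDual ℝ V) : φ = ∑ k ∈ Finset.range g, φ (B.b k) • B.u k := by
  ext x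
  conv_lhs => rw [B.expand x, map_sum]
  rw [sum_apply]
  refine Finset.sum_congr rfl fun k _ => ?_
  simp [mul_comm]

theorem compactSpace_torusProd (B : LatticeFrame Λ g) : CompactSpace (TorusProd Λ) := by
  have : CompactSpace (V ⧸ Λ) :=
    compactSpace_quotient Λ B.b_mem (c := fun x k => B.u k x) B.expand
  have : CompactSpace (StrongDual ℝ V ⧸ dualLattice Λ) :=
    compactSpace_quotient (dualLattice Λ) B.u_mem (c := fun φ k => φ (B.b k)) B.dual_expand
  exact inferInstanceAs (CompactSpace ((V ⧸ Λ) × (StrongDual ℝ V ⧸ dualLattice Λ)))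

/-- The coordinate `y_k` on the dual torus, with values in `ℝ / ℤ`. -/
def dualCoord (k : ℕ) (t : DualTorus Λ) : Circ :=
  ((Function.surjInv dualMk_surjective t (B.b k) : ℝ) : Circ)

theorem dualCoord_dualMk (k : ℕ) (φ : StrongDual ℝ V) :
    B.dualCoord k (dualMk Λ φ) = ((φ (B.b k) : ℝ) : Circ) := by
  have h := Function.surjInv_eq (dualMk_surjective (Λ := Λ)) (dualMk Λ φ)
  obtain ⟨n, hn⟩ := dualMk_eq_iff.1 h.symm (B.b k) (B.b_mem k)
  refine circ_coe_eq_coe_iff.2 ⟨n, ?_⟩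
  rw [← hn]
  simp

theorem continuous_dualCoord (k : ℕ) : Continuous (B.dualCoord k) := by
  have hq : IsOpenQuotientMap (dualMk Λ) := ⟨dualMk_surjective, continuous_dualMk, isOpenMap_dualMk⟩
  rw [hq.isQuotientMap.continuous_iff]
  have : B.dualCoord k ∘ dualMk Λ = fun φ => ((φ (B.b k) : ℝ) : Circ) :=
    funext fun φ => B.dualCoord_dualMk k φ
  rw [this]
  exact (AddCircle.continuous_mk' 1).comp (by fun_prop)

/-- The map `T × T̂ → T × (ℝ / ℤ)^k` given by the first `k` coordinates on the dual torus. -/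
def towerCoord : ∀ k, TorusProd Λ → tower (Torus Λ) k
  | 0 => fun p => p.1
  | k + 1 => fun p => (towerCoord k p, B.dualCoord k p.2)

theorem continuous_towerCoord : ∀ k, Continuous (B.towerCoord k)
  | 0 => continuous_fst
  | k + 1 => (continuous_towerCoord k).prodMk ((B.continuous_dualCoord k).comp continuous_snd)

theorem towerMap_towerCoord (k : ℕ) (p : TorusProd Λ) :
    towerMap (Torus Λ) k (B.towerCoord k p) = p.1 := by
  induction k with
  | zero => rfl
  | succ _ ih => exact ih

theorem towerCoord_eq_iff {k : ℕ} {p p' : TorusProd Λ} : B.towerCoord k p = B.towerCoord k p' ↔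
    p.1 = p'.1 ∧ ∀ j < k, B.dualCoord j p.2 = B.dualCoord j p'.2 := by
  induction k with
  | zero => exact ⟨fun h => ⟨h, fun j hj => absurd hj (Nat.not_lt_zero j)⟩, And.left⟩
  | succ k ih =>
    refine Prod.ext_iff.trans ((and_congr_left' ih).trans ?_)
    rw [and_assoc, Nat.forall_lt_succ_right]
    rfl

theorem towerCoord_injective : Function.Injective (B.towerCoord g) := by
  intro p p' h
  obtain ⟨h1, h2⟩ := B.towerCoord_eq_iff.1 h
  refine Prod.ext h1 ?_
  obtain ⟨φ, hφ⟩ := dualMk_surjective p.2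
  obtain ⟨φ', hφ'⟩ := dualMk_surjective p'.2
  rw [← hφ, ← hφ'] at h2 ⊢
  refine dualMk_eq_iff.2 ?_
  rw [B.dual_expand (φ - φ')]
  refine sum_mem fun k hk => ?_
  have h3 := h2 k (Finset.mem_range.1 hk)
  rw [dualCoord_dualMk, dualCoord_dualMk] at h3
  obtain ⟨n, hn⟩ := circ_coe_eq_coe_iff.1 h3.symm
  rw [show (φ - φ') (B.b k) = (n : ℝ) by simp [hn],
    show (n : ℝ) • B.u k = n • B.u k by ext; simp]
  exact Submodule.smul_mem _ _ (B.u_mem k)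

theorem exists_towerCoord_eq {k : ℕ} (hk : k ≤ g) (x : tower (Torus Λ) k) :
    ∃ p : TorusProd Λ, B.towerCoord k p = x := by
  induction k with
  | zero => exact ⟨(x, 0), rfl⟩
  | succ k ih =>
    obtain ⟨x, θ⟩ := x
    obtain ⟨⟨t, y⟩, rfl⟩ := ih (by lia) x
    obtain ⟨φ, rfl⟩ := dualMk_surjective y
    obtain ⟨s, rfl⟩ := QuotientAddGroup.mk_surjective θ
    refine ⟨(t, dualMk Λ (φ + (s - φ (B.b k)) • B.u k)), Prod.ext ?_ ?_⟩
    · refine B.towerCoord_eq_iff.2 ⟨rfl, fun j hj => ?_⟩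
      simp [dualCoord_dualMk, B.u_b j (by lia), hj.ne']
    · refine (B.dualCoord_dualMk k _).trans ?_
      simp [B.u_b k hk]

theorem towerCoord_surjective : Function.Surjective (B.towerCoord g) :=
  B.exists_towerCoord_eq le_rfl

/-- The coordinates identify `T × T̂` with the tower of `g` circles over `T`. -/
def towerCoordIso [DiscreteTopology Λ] : TorusProd Λ ≅ tower (Torus Λ) g :=
  have := B.compactSpace_torusProd
  have := t2Space_torus (Λ := Λ)
  have := t2Space_tower (Torus Λ) g
  TopCat.isoOfHomeo (Continuous.homeoOfEquivCompactToT2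
    (f := Equiv.ofBijective (B.towerCoord g) ⟨B.towerCoord_injective, B.towerCoord_surjective⟩)
    (B.continuous_towerCoord g))

theorem isOpenMap_towerCoord [DiscreteTopology Λ] : IsOpenMap (B.towerCoord g) :=
  (TopCat.homeoOfIso B.towerCoordIso).isOpenMap

theorem towerCoordIso_hom_towerMap [DiscreteTopology Λ] :
    B.towerCoordIso.hom ≫ towerMap (Torus Λ) g = proj Λ := by
  ext p
  exact B.towerMap_towerCoord g p

end LatticeFrame

end Coordinates

section Identification

variable {V : Type} [NormedAddCommGroup V] [NormedSpace ℝ V] {Λ : Submodule ℤ V}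

theorem nablaHat2_eq_zero_of_eventuallyEq {f : V × StrongDual ℝ V → ℂ} {H : V → ℂ}
    {v : V × StrongDual ℝ V} (hH : DifferentiableAt ℝ H v.1) (hf : f =ᶠ[𝓝 v] fun v' => H v'.1)
    (e : StrongDual ℝ V) : nablaHat2 f v e = 0 := by
  have hd := hH.hasFDerivAt.comp v hasFDerivAt_fst
  rw [nablaHat2, dualConnection, hf.fderiv_eq, show (fun v' : V × StrongDual ℝ V => H v'.1) =
    H ∘ Prod.fst from rfl, hd.fderiv]
  simp

theorem hasFDerivAt_zero_of_mem_kerSections {W : Opens (TorusProd Λ)} {s : coverOpen Λ W → ℂ}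
    (hs : s ∈ kerSections Λ W) {v : V × StrongDual ℝ V} (hv : v ∈ coverOpen Λ W) :
    HasFDerivAt (fun φ => extendZero s (v.1, φ)) (0 : StrongDual ℝ V →L[ℝ] ℂ) v.2 := by
  have hd := ((hs.1.1 ⟨v, hv⟩).differentiableAt (by simp)).hasFDerivAt
  have hzero : (fderiv ℝ (extendZero s) v).comp
      (ContinuousLinearMap.inr ℝ V (StrongDual ℝ V)) = 0 := by
    ext e
    have he := hs.2 ⟨v, hv⟩ e
    simp only [nablaHat2, dualConnection, map_zero, Complex.ofReal_zero, mul_zero, zero_mul,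
      sub_zero] at he
    exact he
  exact hzero ▸ hd.comp v.2 (hasFDerivAt_prodMk_right v.1 v.2)

theorem exists_eventually_extendZero_eq {W : Opens (TorusProd Λ)} {s : coverOpen Λ W → ℂ}
    (hs : s ∈ kerSections Λ W) {v : V × StrongDual ℝ V} (hv : v ∈ coverOpen Λ W) :
    ∃ H : V → ℂ, (∀ᶠ x in 𝓝 v.1, ContDiffAt ℝ ∞ H x) ∧
      ∀ᶠ v' in 𝓝 v, extendZero s v' = H v'.1 := by
  obtain ⟨O₁, hO₁, O₂, hO₂, hO⟩ := mem_nhds_prod_iff.1 ((coverOpen Λ W).isOpen.mem_nhds hv)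
  obtain ⟨r, hr, hr₂⟩ := Metric.mem_nhds_iff.1 hO₂
  refine ⟨fun x => extendZero s (x, v.2), ?_, ?_⟩
  · filter_upwards [hO₁] with x hx
    have hcontDiff := hs.1.1 ⟨(x, v.2), hO ⟨hx, mem_of_mem_nhds hO₂⟩⟩
    exact hcontDiff.comp x (contDiffAt_id.prodMk contDiffAt_const)
  · filter_upwards [prod_mem_nhds hO₁ (Metric.ball_mem_nhds v.2 hr)] with v' hv'
    have hd (φ) (hφ : φ ∈ Metric.ball v.2 r) :
        HasFDerivAt (fun φ => extendZero s (v'.1, φ)) (0 : StrongDual ℝ V →L[ℝ] ℂ) φ :=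
      hasFDerivAt_zero_of_mem_kerSections hs (v := (v'.1, φ)) (hO ⟨hv'.1, hr₂ hφ⟩)
    exact Metric.isOpen_ball.is_const_of_fderiv_eq_zero (convex_ball v.2 r).isPreconnected
      (fun φ hφ => (hd φ hφ).differentiableAt.differentiableWithinAt)
      (fun φ hφ => (hd φ hφ).fderiv) hv'.2 (Metric.mem_ball_self hr)

theorem dualFactor_ne_zero (v l : V × StrongDual ℝ V) : dualFactor v l ≠ 0 := by
  rw [dualFactor_eq]
  exact Complex.exp_ne_zero _

namespace LatticeFrame

variable {g : ℕ} (B : LatticeFrame Λ g)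

/-- The iterated twist of the functions smooth along `A`, in which the circle with coordinate
`y_j` is twisted by the character `e_j`. -/
def towerCond (A : Set (Torus Λ)) (k : ℕ) : FunctionCondition ℂ (tower (Torus Λ) k) :=
  iteratedTwist (smoothOn A) (B.isMultiplier A) k

/-- The locally constant function of `y` that for `k = g` satisfies the automorphy condition of
the dual Poincaré bundle; multiplication by it turns functions on the tower into sections. -/
def weight (k : ℕ) (v : V × StrongDual ℝ V) : ℂ :=
  ∏ j ∈ Finset.range k, B.e j (torusMk Λ v.1) ^ ⌊v.2 (B.b j)⌋

theorem weight_ne_zero (k : ℕ) (v : V × StrongDual ℝ V) : B.weight k v ≠ 0 :=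
  Finset.prod_ne_zero_iff.2 fun _ _ => zpow_ne_zero _ (B.e_ne_zero _ _)

theorem weight_succ (k : ℕ) (v : V × StrongDual ℝ V) :
    B.weight (k + 1) v = B.weight k v * B.e k (torusMk Λ v.1) ^ ⌊v.2 (B.b k)⌋ :=
  Finset.prod_range_succ _ _

theorem dualFactor_eq_prod (v l : V × StrongDual ℝ V) : dualFactor v l = ∏ j ∈ Finset.range g,
    Complex.exp (2 * Real.pi * Complex.I * (l.2 (B.b j) * B.u j v.1 : ℝ)) := by
  have hl : l.2 v.1 = ∑ j ∈ Finset.range g, l.2 (B.b j) * B.u j v.1 := by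
    conv_lhs => rw [B.expand v.1, map_sum]
    simp only [map_smul, smul_eq_mul, mul_comm]
  rw [dualFactor_eq, ← Complex.exp_sum, ← Finset.mul_sum, hl, Complex.ofReal_sum]

theorem weight_add (v : V × StrongDual ℝ V) {l : V × StrongDual ℝ V} (h1 : l.1 ∈ Λ)
    (h2 : l.2 ∈ dualLattice Λ) : B.weight g (v + l) = dualFactor v l * B.weight g v := by
  have hl : torusMk Λ (v.1 + l.1) = torusMk Λ v.1 := torusMk_eq_iff.2 (by simpa using h1)
  rw [B.dualFactor_eq_prod, weight, weight, ← Finset.prod_mul_distrib]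
  refine Finset.prod_congr rfl fun j _ => ?_
  obtain ⟨n, hn⟩ := h2 (B.b j) (B.b_mem j)
  rw [Prod.fst_add, hl, Prod.snd_add, add_apply, hn, Int.floor_add_intCast,
    zpow_add₀ (B.e_ne_zero _ _), mul_comm]
  congr 1
  rw [e_torusMk, ← Complex.exp_int_mul]
  congr 1
  push_cast
  ring

/-- The map `V × V^∨ → T × (ℝ / ℤ)^k` induced by the coordinates. -/
def coverCoord (k : ℕ) (v : V × StrongDual ℝ V) : tower (Torus Λ) k := B.towerCoord k (cover Λ v)

theorem continuous_coverCoord (k : ℕ) : Continuous (B.coverCoord k) :=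
  (B.continuous_towerCoord k).comp (continuous_cover Λ)

theorem coverCoord_succ (k : ℕ) (v : V × StrongDual ℝ V) :
    B.coverCoord (k + 1) v = covCirc (tower (Torus Λ) k) (B.coverCoord k v, v.2 (B.b k)) :=
  Prod.ext rfl (B.dualCoord_dualMk k v.2)

theorem towerMap_coverCoord (k : ℕ) (v : V × StrongDual ℝ V) :
    towerMap (Torus Λ) k (B.coverCoord k v) = torusMk Λ v.1 :=
  B.towerMap_towerCoord k _

theorem continuous_coverCoord_prod (k : ℕ) :
    Continuous fun v => ((B.coverCoord k v, v.2 (B.b k)) : tower (Torus Λ) k × ℝ) :=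
  (B.continuous_coverCoord k).prodMk (by fun_prop)

theorem exists_smooth_of_mem {A : Set (Torus Λ)} {k : ℕ} {f : tower (Torus Λ) k → ℂ}
    {v : V × StrongDual ℝ V} (hf : f ∈ (B.towerCond A k).germs (B.coverCoord k v)) :
    ∃ H : V → ℂ, (∀ᶠ x in 𝓝 v.1, ContDiffAt ℝ ∞ H x) ∧
      ∀ᶠ v' in 𝓝 v,
        B.weight k v' * f (B.coverCoord k v') = A.indicator 1 (torusMk Λ v'.1) * H v'.1 := by
  induction k with
  | zero =>
    obtain ⟨H, hH, hfH⟩ := hf v.1 rfl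
    refine ⟨H, hH, ?_⟩
    filter_upwards [(continuous_fst.tendsto v).eventually hfH] with v' hv'
    rw [← hv']
    exact one_mul _
  | succ k ih =>
    rw [coverCoord_succ] at hf
    obtain ⟨h, hh, hf⟩ := (mem_twist (isMultiplier_iteratedTwist _ _ k k)).1 hf
    obtain ⟨H, hH, hhH⟩ := ih hh
    refine ⟨H, hH, ?_⟩
    filter_upwards [hhH, ((B.continuous_coverCoord_prod k).tendsto v).eventually hf] with v' h1 h2
    rw [← h1, ← h2, weight_succ, coverCoord_succ, towerMap_coverCoord, mul_assoc]

theorem exists_mem_of_smooth [DiscreteTopology Λ] (A : Set (Torus Λ)) (k : ℕ)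
    {v : V × StrongDual ℝ V} {H : V → ℂ} (hH : ∀ᶠ x in 𝓝 v.1, ContDiffAt ℝ ∞ H x) :
    ∃ f ∈ (B.towerCond A k).germs (B.coverCoord k v),
      ∀ᶠ v' in 𝓝 v,
        B.weight k v' * f (B.coverCoord k v') = A.indicator 1 (torusMk Λ v'.1) * H v'.1 := by
  induction k with
  | zero =>
    obtain ⟨f, hf, hfH⟩ := exists_mem_smoothOn A hH
    refine ⟨f, hf, ?_⟩
    filter_upwards [(continuous_fst.tendsto v).eventually hfH] with v' hv'
    rw [← hv']
    exact one_mul _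
  | succ k ih =>
    obtain ⟨h, hh, hhH⟩ := ih
    obtain ⟨f, hf, hfh⟩ := exists_mem_twist
      (isMultiplier_iteratedTwist (smoothOn A) (B.isMultiplier A) k k)
      (p := (B.coverCoord k v, v.2 (B.b k))) hh
    refine ⟨f, by rw [coverCoord_succ]; exact hf, ?_⟩
    filter_upwards [hhH, ((B.continuous_coverCoord_prod k).tendsto v).eventually hfh] with v' h1 h2
    rw [← h1, ← h2, weight_succ, coverCoord_succ, towerMap_coverCoord, mul_assoc]

theorem coverCoord_add (v : V × StrongDual ℝ V) {l : V × StrongDual ℝ V} (h1 : l.1 ∈ Λ)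
    (h2 : l.2 ∈ dualLattice Λ) : B.coverCoord g (v + l) = B.coverCoord g v :=
  congrArg (B.towerCoord g) (cover_eq_iff.2 ⟨by simpa using h1, by simpa using h2⟩)

theorem coverCoord_surjective : Function.Surjective (B.coverCoord g) :=
  B.towerCoord_surjective.comp cover_surjective

/-- The local condition on functions on `T × (ℝ / ℤ)^g` that corresponds to `ker ∇̂₂`. -/
abbrev kerCond : FunctionCondition ℂ (tower (Torus Λ) g) := B.towerCond Set.univ g

theorem exists_smooth_of_mem_kerCond {f : tower (Torus Λ) g → ℂ} {v : V × StrongDual ℝ V}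
    (hf : f ∈ B.kerCond.germs (B.coverCoord g v)) :
    ∃ H : V → ℂ, ContDiffAt ℝ ∞ H v.1 ∧
      ∀ᶠ v' in 𝓝 v, B.weight g v' * f (B.coverCoord g v') = H v'.1 := by
  obtain ⟨H, hH, hf⟩ := B.exists_smooth_of_mem hf
  exact ⟨H, hH.self_of_nhds, hf.mono fun v' h => by simpa using h⟩

/-- The quotient of a section by `weight` is invariant under the lattice. -/
theorem exists_weight_mul_eq_of_mem_kerSections {W : Opens (TorusProd Λ)} {s : coverOpen Λ W → ℂ}
    (hs : s ∈ kerSections Λ W) : ∃ f : tower (Torus Λ) g → ℂ,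
      ∀ v ∈ coverOpen Λ W, B.weight g v * f (B.coverCoord g v) = extendZero s v := by
  let σ : V × StrongDual ℝ V → ℂ := fun v => (B.weight g v)⁻¹ * extendZero s v
  refine ⟨fun x => σ (Function.surjInv B.coverCoord_surjective x), fun v hv => ?_⟩
  set w := Function.surjInv B.coverCoord_surjective (B.coverCoord g v)
  obtain ⟨h1, h2⟩ := cover_eq_iff.1
    (B.towerCoord_injective (Function.surjInv_eq B.coverCoord_surjective (B.coverCoord g v)))
  have hsection := hs.1.2 ⟨v, hv⟩ (w - v) h1 h2
  have hweight := B.weight_add v (l := w - v) h1 h2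
  dsimp only at hsection
  rw [add_sub_cancel] at hsection hweight
  have hσ : σ w = σ v := by
    simp only [σ]
    rw [hsection, hweight, mul_inv, mul_mul_mul_comm, inv_mul_cancel₀ (dualFactor_ne_zero _ _),
      one_mul]
  change B.weight g v * σ w = extendZero s v
  rw [hσ, mul_inv_cancel_left₀ (B.weight_ne_zero g v)]

variable [DiscreteTopology Λ]

theorem isOpenMap_coverCoord : IsOpenMap (B.coverCoord g) :=
  B.isOpenMap_towerCoord.comp isOpenMap_cover

theorem mem_kerCond_of_weight_mul_eq {W : Opens (TorusProd Λ)} {s : coverOpen Λ W → ℂ}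
    (hs : s ∈ kerSections Λ W) {f : tower (Torus Λ) g → ℂ}
    (hf : ∀ v ∈ coverOpen Λ W, B.weight g v * f (B.coverCoord g v) = extendZero s v)
    {v : V × StrongDual ℝ V} (hv : v ∈ coverOpen Λ W) : f ∈ B.kerCond.germs (B.coverCoord g v) := by
  obtain ⟨H, hH, hsH⟩ := exists_eventually_extendZero_eq hs hv
  obtain ⟨f', hf', hfH⟩ := B.exists_mem_of_smooth Set.univ g hH
  refine B.kerCond.congr_of_eventuallyEq
    (B.isOpenMap_coverCoord.nhds_le v (Filter.mem_map.2 ?_)) hf'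
  filter_upwards [hsH, hfH, (coverOpen Λ W).isOpen.mem_nhds hv] with v' h1 h2 h3
  rw [Set.indicator_univ, Pi.one_apply, one_mul, ← h1, ← hf v' h3] at h2
  exact mul_left_cancel₀ (B.weight_ne_zero g v') h2

theorem weight_mul_mem_kerSections {U : Opens (tower (Torus Λ) g)} {f : tower (Torus Λ) g → ℂ}
    (hf : ∀ x ∈ U, f ∈ B.kerCond.germs x) :
    (fun v : coverOpen Λ ((Opens.map B.towerCoordIso.hom).obj U) =>
      B.weight g v * f (B.coverCoord g v)) ∈
        kerSections Λ ((Opens.map B.towerCoordIso.hom).obj U) := by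
  set W := coverOpen Λ ((Opens.map B.towerCoordIso.hom).obj U)
  set s : W → ℂ := fun v => B.weight g v * f (B.coverCoord g v)
  have hev : ∀ v : W, ∃ H : V → ℂ, ContDiffAt ℝ ∞ H (v : V × StrongDual ℝ V).1 ∧
      extendZero s =ᶠ[𝓝 (v : V × StrongDual ℝ V)] fun v' => H v'.1 := by
    intro v
    obtain ⟨H, hH, hfH⟩ := B.exists_smooth_of_mem_kerCond (v := v) (hf _ v.2)
    refine ⟨H, hH, ?_⟩
    filter_upwards [hfH, W.isOpen.mem_nhds v.2] with v' h1 h2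
    rw [← h1]
    exact extendZero_apply s ⟨v', h2⟩
  refine ⟨⟨fun v => ?_, fun v l h1 h2 => ?_⟩, fun v e => ?_⟩
  · obtain ⟨H, hH, hs⟩ := hev v
    exact (hH.comp (v : V × StrongDual ℝ V) contDiffAt_fst).congr_of_eventuallyEq hs
  · have hm : (v : V × StrongDual ℝ V) + l ∈ W := add_mem_coverOpen Λ _ v.2 h1 h2
    rw [show extendZero s (v + l) = s ⟨v + l, hm⟩ from extendZero_apply s ⟨v + l, hm⟩,
      extendZero_apply s v]
    simp only [s]
    rw [B.weight_add _ h1 h2, B.coverCoord_add _ h1 h2, mul_assoc]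
  · obtain ⟨H, hH, hs⟩ := hev v
    exact nablaHat2_eq_zero_of_eventuallyEq (hH.differentiableAt (by simp)) hs e

/-- The morphism from the iterated twist to `ker ∇̂₂` given by multiplication by `weight`. -/
def kerHom : B.kerCond.sheaf ⟶
    (TopCat.Sheaf.pushforward (ModuleCat.{0} ℂ) B.towerCoordIso.hom).obj (kerSheaf Λ) :=
  ⟨{ app U := ModuleCat.ofHom
      { toFun := fun f =>
          (⟨fun v => B.weight g v * B.kerCond.val (W := U.unop) f (B.coverCoord g v),
          B.weight_mul_mem_kerSections fun x hx => B.kerCond.val_mem (W := U.unop) f hx⟩ :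
            kerSections Λ ((Opens.map B.towerCoordIso.hom).obj U.unop))
        map_add' := fun f f' => Subtype.ext (funext fun v => mul_add _ _ _)
        map_smul' := fun c f => Subtype.ext (funext fun v => mul_left_comm _ _ _) }
     naturality U U' i := by
      ext1
      refine LinearMap.ext fun f => Subtype.ext (funext fun v => ?_)
      exact congrArg (B.weight g v * ·) (B.kerCond.val_res i.unop.le f v.2) }⟩

theorem secMap_kerHom {U : Opens (tower (Torus Λ) g)} (f : Sec B.kerCond.sheaf U)
    (v : coverOpen Λ ((Opens.map B.towerCoordIso.hom).obj U)) :
    (secMap B.kerHom U f : kerSections Λ ((Opens.map B.towerCoordIso.hom).obj U)).1 v =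
      B.weight g v * B.kerCond.val f (B.coverCoord g v) := rfl

theorem kerHom_surjective (U : Opens (tower (Torus Λ) g)) :
    Function.Surjective (secMap B.kerHom U) := by
  intro (s : kerSections Λ ((Opens.map B.towerCoordIso.hom).obj U))
  obtain ⟨f, hf⟩ := B.exists_weight_mul_eq_of_mem_kerSections s.2
  have hmem : ∀ x ∈ U, f ∈ B.kerCond.germs x := by
    intro x hx
    obtain ⟨v, rfl⟩ := B.coverCoord_surjective x
    exact B.mem_kerCond_of_weight_mul_eq s.2 hf hx
  refine ⟨B.kerCond.sec U f hmem, Subtype.ext (funext fun v => ?_)⟩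
  refine (B.secMap_kerHom _ v).trans ?_
  rw [B.kerCond.val_sec (y := B.coverCoord g v) v.2, hf v v.2, extendZero_apply]

theorem kerHom_injective (U : Opens (tower (Torus Λ) g)) :
    Function.Injective (secMap B.kerHom U) := by
  refine (injective_iff_map_eq_zero _).2 fun f hf => B.kerCond.sec_ext fun x hx => ?_
  obtain ⟨v, rfl⟩ := B.coverCoord_surjective x
  have h : B.weight g v * B.kerCond.val f (B.coverCoord g v) = 0 :=
    (B.secMap_kerHom f ⟨v, hx⟩).symm.trans (congrFun (congrArg Subtype.val hf) ⟨v, hx⟩)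
  exact (mul_eq_zero.1 h).resolve_left (B.weight_ne_zero g v)

theorem isIso_kerHom : IsIso B.kerHom := by
  have := mono_of_secMap_injective B.kerHom B.kerHom_injective
  have : Epi B.kerHom := (epi_iff_sec _).2 fun U t x hx => by
    obtain ⟨s, hs⟩ := B.kerHom_surjective U t
    exact ⟨U, le_rfl, hx, s, hs.trans (res_self _ _ _).symm⟩
  exact isIso_of_mono_of_epi B.kerHom

end LatticeFrame

end Identification

section Skyscraper

open Limits

universe u

theorem nonempty_iso_skyscraperPresheaf {C : Type*} [Category C] [HasTerminal C] {X : TopCat.{u}}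
    (x : X) [∀ U : Opens X, Decidable (x ∈ U)] (M : C) (G : (Opens X)ᵒᵖ ⥤ C)
    (e : ∀ U : (Opens X)ᵒᵖ, x ∈ U.unop → (G.obj U ≅ M))
    (he : ∀ {U U' : (Opens X)ᵒᵖ} (i : U ⟶ U') (h : x ∈ U'.unop),
      G.map i ≫ (e U' h).hom = (e U (i.unop.le h)).hom)
    (hG : ∀ U : (Opens X)ᵒᵖ, x ∉ U.unop → Nonempty (IsTerminal (G.obj U))) :
    Nonempty (G ≅ skyscraperPresheaf x M) := by
  have hterminal (U : (Opens X)ᵒᵖ) (h : x ∉ U.unop) :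
      Nonempty (IsTerminal ((skyscraperPresheaf x M).obj U)) :=
    ⟨terminalIsTerminal.ofIso (eqToIso (if_neg h).symm)⟩
  have hobj (U : (Opens X)ᵒᵖ) (h : x ∈ U.unop) : (skyscraperPresheaf x M).obj U = M := if_pos h
  let a (U : (Opens X)ᵒᵖ) : G.obj U ≅ (skyscraperPresheaf x M).obj U :=
    if h : x ∈ U.unop then e U h ≪≫ eqToIso (hobj U h).symm
    else (hG U h).some.uniqueUpToIso (hterminal U h).some
  have ha (U : (Opens X)ᵒᵖ) (h : x ∈ U.unop) :
      (a U).hom = (e U h).hom ≫ eqToHom (hobj U h).symm := by simp [a, h]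
  refine ⟨NatIso.ofComponents a fun {U U'} i => ?_⟩
  by_cases h : x ∈ U'.unop
  · have hmap : (skyscraperPresheaf x M).map i =
        eqToHom ((hobj U (i.unop.le h)).trans (hobj U' h).symm) := dif_pos h
    rw [ha U' h, ha U (i.unop.le h), hmap, ← Category.assoc, he i h, Category.assoc,
      eqToHom_trans]
  · exact (hterminal U' h).some.hom_ext _ _

variable {V : Type} [NormedAddCommGroup V] [NormedSpace ℝ V] {Λ : Submodule ℤ V}

theorem indicator_mem_smoothOn (A : Set (Torus Λ)) (c : ℂ) (t : Torus Λ) :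
    (fun t => A.indicator 1 t * c) ∈ (smoothOn A).germs t := fun _ _ =>
  ⟨fun _ => c, Filter.Eventually.of_forall fun _ => contDiffAt_const,
    Filter.Eventually.of_forall fun _ => rfl⟩

theorem eq_zero_of_mem_smoothOn {A : Set (Torus Λ)} {t : Torus Λ} {f : Torus Λ → ℂ}
    (hf : f ∈ (smoothOn A).germs t) (ht : t ∉ A) : f t = 0 := by
  obtain ⟨x, rfl⟩ := torusMk_surjective t
  obtain ⟨h, -, hf⟩ := mem_smoothOn.1 hf
  rw [hf.self_of_nhds, Set.indicator_of_notMem ht, zero_mul]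

/-- Evaluation at `t` of the sections of the sheaf of functions supported at `t`. -/
def evalPoint {t : Torus Λ} {U : Opens (Torus Λ)} (ht : t ∈ U) :
    Sec (smoothOn {t}).sheaf U ≃ₗ[ℂ] ℂ where
  toFun f := (smoothOn {t}).val f t
  map_add' _ _ := rfl
  map_smul' _ _ := rfl
  invFun c := (smoothOn {t}).sec U _ fun t' _ => indicator_mem_smoothOn {t} c t'
  left_inv f := by
    refine (smoothOn {t}).sec_ext fun t' ht' => ((smoothOn {t}).val_sec ht').trans ?_
    rcases eq_or_ne t' t with rfl | h
    · simp
    · refine Eq.trans ?_ (eq_zero_of_mem_smoothOn ((smoothOn {t}).val_mem f ht') h).symm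
      simp [h]
  right_inv c := ((smoothOn {t}).val_sec (y := t) ht).trans (by simp)

theorem evalPoint_res {t : Torus Λ} {U U' : Opens (Torus Λ)} (h : U' ≤ U) (ht : t ∈ U')
    (f : Sec (smoothOn {t}).sheaf U) :
    evalPoint ht (res (smoothOn {t}).sheaf h f) = evalPoint (h ht) f :=
  (smoothOn {t}).val_res h f (y := t) ht

theorem isZero_sec_smoothOn {A : Set (Torus Λ)} {U : Opens (Torus Λ)} (h : ∀ t ∈ U, t ∉ A) :
    IsZero (Sec (smoothOn A).sheaf U) := by
  have : Subsingleton (Sec (smoothOn A).sheaf U) :=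
    ⟨fun f f' => (smoothOn A).sec_ext fun t ht =>
      (eq_zero_of_mem_smoothOn ((smoothOn A).val_mem f ht) (h t ht)).trans
        (eq_zero_of_mem_smoothOn ((smoothOn A).val_mem f' ht) (h t ht)).symm⟩
  exact ModuleCat.isZero_of_subsingleton _

theorem nonempty_smoothOn_singleton_iso_skyscraper (t : Torus Λ) :
    Nonempty ((smoothOn {t}).sheaf ≅ skyscraper (Torus Λ) t) := by
  classical
  obtain ⟨α⟩ := nonempty_iso_skyscraperPresheaf t (ModuleCat.of ℂ ℂ) (smoothOn {t}).presheaf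
    (fun U h => (evalPoint h).toModuleIso)
    (fun i h => ModuleCat.hom_ext (LinearMap.ext fun f => evalPoint_res i.unop.le h f))
    (fun U h => ⟨(isZero_sec_smoothOn fun t' ht' => by rintro rfl; exact h ht').isTerminal⟩)
  exact ⟨(fullyFaithfulSheafToPresheaf (Opens.grothendieckTopology (Torus Λ))
    (ModuleCat.{0} ℂ)).preimageIso (X := (smoothOn {t}).sheaf) (Y := skyscraper (Torus Λ) t) α⟩

end Skyscraper

section DerivedFunctors

open Limits

/-- The global sections functor on sheaves of complex vector spaces. -/
def globalSections (X : TopCat.{0}) : Sh ℂ X ⥤ ModuleCat.{0} ℂ :=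
  (sheafSections (Opens.grothendieckTopology X) (ModuleCat.{0} ℂ)).obj (op ⊤)

instance additive_globalSections (X : TopCat.{0}) : (globalSections X).Additive :=
  sections_additive X

instance preservesFiniteLimits_globalSections (X : TopCat.{0}) :
    PreservesFiniteLimits (globalSections X) :=
  preservesFiniteLimits_of_natIso
    (F := TopCat.Sheaf.forget (ModuleCat.{0} ℂ) X ⋙ (evaluation _ _).obj (op ⊤)) (Iso.refl _)

/-- Higher direct images in the form `R^j(Q ∘ f_*)`, with `Q` the identity. -/
def higherDirectImageIso {X Y : TopCat.{0}} (f : X ⟶ Y) (j : ℕ) (F : Sh ℂ X) :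
    higherDirectImage f j F ≅
      ((TopCat.Sheaf.pushforward (ModuleCat.{0} ℂ) f ⋙ 𝟭 _).rightDerived j).obj F :=
  (rightDerivedMapIso (TopCat.Sheaf.pushforward (ModuleCat.{0} ℂ) f).rightUnitor.symm j).app F

/-- Cohomology in the form `R^j(Q ∘ f_*)`, with `Q` the functor of global sections. -/
def sheafCohomologyIso {X Y : TopCat.{0}} (f : X ⟶ Y) (j : ℕ) (F : Sh ℂ X) :
    sheafCohomology X j F ≅ ((TopCat.Sheaf.pushforward (ModuleCat.{0} ℂ) f ⋙
      globalSections Y).rightDerived j).obj F :=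
  (rightDerivedMapIso (T := globalSections X) (Iso.refl _) j).app F

variable {V : Type} [NormedAddCommGroup V] [NormedSpace ℝ V] {Λ : Submodule ℤ V}
  [DiscreteTopology Λ] {E : Type*} [Category E] [Abelian E] (Q : Sh ℂ (Torus Λ) ⥤ E)
  [Q.Additive] [PreservesFiniteLimits Q]

namespace LatticeFrame

variable {g : ℕ} (B : LatticeFrame Λ g)

theorem rightDerived_towerFunctor_kerCond [FiniteDimensional ℝ V] :
    (∀ j < g, IsZero (((towerFunctor Q g).rightDerived j).obj B.kerCond.sheaf)) ∧
      Nonempty (((towerFunctor Q g).rightDerived g).obj B.kerCond.sheaf ≅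
        Q.obj (smoothOn {torusMk Λ 0}).sheaf) := by
  have := t2Space_torus (Λ := Λ)
  have h := rightDerived_towerFunctor Q (N := fun i => smoothOn (B.stratum i))
    (fun i => B.isMultiplier (B.stratum i)) g fun i hi => B.isMulShortExact_stratum hi
  simp only [B.stratum_self, B.stratum_zero] at h
  exact h

/-- In the coordinates of the tower, `p_*` is the pushforward along `towerMap`. -/
def pushforwardProjCompIso : TopCat.Sheaf.pushforward (ModuleCat.{0} ℂ) (proj Λ) ⋙ Q ≅
    TopCat.Sheaf.pushforward (ModuleCat.{0} ℂ) B.towerCoordIso.hom ⋙ towerFunctor Q g :=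
  Functor.isoWhiskerRight (eqToIso (congrArg (TopCat.Sheaf.pushforward (ModuleCat.{0} ℂ))
      B.towerCoordIso_hom_towerMap.symm)) Q ≪≫
    Functor.isoWhiskerLeft (TopCat.Sheaf.pushforward (ModuleCat.{0} ℂ) B.towerCoordIso.hom)
      (towerFunctorIso Q g).symm

theorem nonempty_rightDerived_proj_iso (j : ℕ) : Nonempty
    (((TopCat.Sheaf.pushforward (ModuleCat.{0} ℂ) (proj Λ) ⋙ Q).rightDerived j).obj
      (kerSheaf Λ) ≅ ((towerFunctor Q g).rightDerived j).obj B.kerCond.sheaf) := by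
  have := B.isIso_kerHom
  obtain ⟨α⟩ := rightDerived_pushforward_iso B.towerCoordIso (towerFunctor Q g) j (kerSheaf Λ)
  exact ⟨(rightDerivedMapIso (B.pushforwardProjCompIso Q) j).app _ ≪≫ α ≪≫
    (Functor.mapIso _ (asIso B.kerHom)).symm⟩

end LatticeFrame

theorem rightDerived_proj_kerSheaf [FiniteDimensional ℝ V] [IsZLattice ℝ Λ] :
    (∀ j < Module.finrank ℝ V, IsZero
      (((TopCat.Sheaf.pushforward (ModuleCat.{0} ℂ) (proj Λ) ⋙ Q).rightDerived j).obj
        (kerSheaf Λ))) ∧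
    Nonempty (((TopCat.Sheaf.pushforward (ModuleCat.{0} ℂ) (proj Λ) ⋙ Q).rightDerived
      (Module.finrank ℝ V)).obj (kerSheaf Λ) ≅ Q.obj (smoothOn {torusMk Λ 0}).sheaf) := by
  obtain ⟨B⟩ := exists_latticeFrame Λ
  obtain ⟨hzero, ⟨htop⟩⟩ := B.rightDerived_towerFunctor_kerCond Q
  exact ⟨fun j hj => (hzero j hj).of_iso (B.nonempty_rightDerived_proj_iso Q j).some,
    ⟨(B.nonempty_rightDerived_proj_iso Q _).some ≪≫ htop⟩⟩

end DerivedFunctors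

end PoincareTorus

end

theorem mainTheorem7 (V : Type) [NormedAddCommGroup V] [NormedSpace ℝ V] [FiniteDimensional ℝ V]
    (Λ : Submodule ℤ V) [DiscreteTopology Λ] [IsZLattice ℝ Λ] :
    (∀ j : ℕ, j < Module.finrank ℝ V →
      Limits.IsZero (PoincareTorus.higherDirectImage (PoincareTorus.proj Λ) j
        (PoincareTorus.kerSheaf Λ))) ∧
    Nonempty (PoincareTorus.higherDirectImage (PoincareTorus.proj Λ) (Module.finrank ℝ V)
        (PoincareTorus.kerSheaf Λ) ≅
      PoincareTorus.skyscraper (PoincareTorus.Torus Λ) (0 : V ⧸ Λ)) ∧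
    (∀ j : ℕ, j < Module.finrank ℝ V →
      Limits.IsZero (PoincareTorus.sheafCohomology (PoincareTorus.TorusProd Λ) j
        (PoincareTorus.kerSheaf Λ))) ∧
    Nonempty (PoincareTorus.sheafCohomology (PoincareTorus.TorusProd Λ) (Module.finrank ℝ V)
        (PoincareTorus.kerSheaf Λ) ≅ ModuleCat.of ℂ ℂ) := by
  obtain ⟨hR, ⟨hRtop⟩⟩ := PoincareTorus.rightDerived_proj_kerSheaf (Λ := Λ) (𝟭 _)
  obtain ⟨hH, ⟨hHtop⟩⟩ := PoincareTorus.rightDerived_proj_kerSheaf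
    (PoincareTorus.globalSections (PoincareTorus.Torus Λ))
  obtain ⟨hsky⟩ :=
    PoincareTorus.nonempty_smoothOn_singleton_iso_skyscraper (PoincareTorus.torusMk Λ 0)
  have hR' := fun j => PoincareTorus.higherDirectImageIso (PoincareTorus.proj Λ) j
    (PoincareTorus.kerSheaf Λ)
  have hH' := fun j => PoincareTorus.sheafCohomologyIso (PoincareTorus.proj Λ) j
    (PoincareTorus.kerSheaf Λ)
  exact ⟨fun j hj => (hR j hj).of_iso (hR' j), ⟨hR' _ ≪≫ hRtop ≪≫ hsky⟩,
    fun j hj => (hH j hj).of_iso (hH' j),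
    ⟨hH' _ ≪≫ hHtop ≪≫ (PoincareTorus.evalPoint (Opens.mem_top _)).toModuleIso⟩⟩
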